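/- Let $V:\mathbb R^3\to\mathbb R$ be an integrable radial function with $V\ge 0$, $V\not\equiv 0$ (i.e. $V$ is not almost everywhere zero), and let $\widehat V(p)=\int_{\mathbb R^3}e^{-ip\cdot x}V(x)\,dx$. Assume that $\widehat V\ge 0$, $\widehat V\in C^1(\mathbb R^3)\cap L^1(\mathbb R^3)$, $\|\widehat V\|_\infty<\infty$, $\|\nabla\widehat V\|_2<\infty$ and $\|\nabla\widehat V\|_\infty<\infty$. Assume in addition that $\widehat V\in C^3(\mathbb R^3)$ and that all derivatives of $\widehat V$ up to third order are bounded. Let $\mathcal D$ be the set of triples $(\gamma,\alpha,\rho_0)$ in which $\gamma,\alpha:\mathbb R^3\to\mathbb R$ are measurable, $\gamma\in L^1((1+p^2)\,dp)$, $\gamma\ge 0$ and $\alpha^2\le\gamma(1+\gamma)$ almost everywhere, and $\rho_0\ge 0$. Write $\rho_\gamma=(2\pi)^{-3}\int_{\mathbb R^3}\gamma(p)\,dp$. For every $\rho\ge 0$ the canonical minimization problem at temperature $T=0$ and density $\rho$ has a minimizer: among all $(\gamma,\alpha,\rho_0)\in\mathcal D$ with $\rho_0+\rho_\gamma=\rho$,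 the functional $$\begin{aligned}\mathcal F^{\rm can}(\gamma,\alpha,\rho_0)={}&(2\pi)^{-3}\int_{\mathbb R^3} p^2\gamma(p)\,dp+\tfrac12\widehat V(0)\rho^2+\rho_0(2\pi)^{-3}\int_{\mathbb R^3}\widehat V(p)\bigl(\gamma(p)+\alpha(p)\bigr)\,dp\\&+\tfrac12(2\pi)^{-6}\iint_{\mathbb R^3\times\mathbb R^3}\widehat V(p-q)\bigl(\alpha(p)\alpha(q)+\gamma(p)\gamma(q)\bigr)\,dp\,dq\end{aligned}$$ attains its infimum. -/

import Mathlib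

open MeasureTheory

noncomputable section

namespace Bogoliubov

/-- Three-dimensional Euclidean space (used both for positions `x` and momenta `p`). -/
abbrev E3 : Type := EuclideanSpace ℝ (Fin 3)

/-- A function on `ℝ³` is radial if its value depends only on the norm of the argument. -/
def IsRadial (f : E3 → ℝ) : Prop := ∀ x y : E3, ‖x‖ = ‖y‖ → f x = f y

/-- The Fourier integral `∫ e^{-i p·x} V(x) dx`, as a complex number. -/
def fourierC (V : E3 → ℝ) (p : E3) : ℂ :=
  ∫ x : E3, Complex.exp (-(Complex.I * ((inner ℝ p x : ℝ) : ℂ))) * (V x : ℂ)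

/-- The Fourier transform `V̂(p)` as a real number. For radial `V` the Fourier integral is
real, so that nothing is lost by taking the real part: see `ofReal_fourier`. -/
def fourier (V : E3 → ℝ) (p : E3) : ℝ := (fourierC V p).re

theorem ofReal_fourier {V : E3 → ℝ} (hV : IsRadial V) (p : E3) :
    ((fourier V p : ℝ) : ℂ) = fourierC V p := by
  have h : (starRingEnd ℂ) (fourierC V p) = fourierC V p := by
    unfold fourierC
    rw [← integral_conj, ← integral_neg_eq_self]
    congr 1
    funext x
    rw [map_mul, ← Complex.exp_conj, hV (-x) x (norm_neg x)]
    simp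
  exact Complex.conj_eq_iff_re.mp h

/-- The standing assumptions on the two-body interaction potential `V`. Integrability is what
gives a meaning to the Fourier integral. -/
structure IsInteractionPotential (V : E3 → ℝ) : Prop where
  integrable : Integrable V
  radial : IsRadial V
  nonneg : ∀ x, 0 ≤ V x
  ne_zero : ¬ (V =ᵐ[volume] 0)
  fourier_nonneg : ∀ p, 0 ≤ fourier V p
  fourier_contDiff : ContDiff ℝ 1 (fourier V)
  fourier_integrable : Integrable (fourier V)
  fourier_bounded : MemLp (fourier V) ⊤
  gradient_memLp_two : MemLp (gradient (fourier V)) 2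
  gradient_bounded : MemLp (gradient (fourier V)) ⊤

/-- `ρ_γ = (2π)⁻³ ∫ γ(p) dp`. -/
def rhoGamma (γ : E3 → ℝ) : ℝ := ((2 * Real.pi) ^ 3)⁻¹ * ∫ p, γ p

/-- `β(p) = √((1/2 + γ(p))² - α(p)²)`. -/
def beta (γ α : E3 → ℝ) (p : E3) : ℝ := √((1 / 2 + γ p) ^ 2 - α p ^ 2)

/-- `s(β) = (β + 1/2) ln (β + 1/2) - (β - 1/2) ln (β - 1/2)`, with `0 ln 0 = 0`. -/
def entropyDensity (b : ℝ) : ℝ :=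
  (b + 1 / 2) * Real.log (b + 1 / 2) - (b - 1 / 2) * Real.log (b - 1 / 2)

/-- The entropy `S(γ, α)`. -/
def entropy (γ α : E3 → ℝ) : ℝ :=
  ((2 * Real.pi) ^ 3)⁻¹ * ∫ p, entropyDensity (beta γ α p)

/-- The domain `𝒟` of triples `(γ, α, ρ₀)`: `γ` and `α` are measurable functions, subject to
`γ ∈ L¹((1 + p²) dp)`, `γ ≥ 0` and `α² ≤ γ (1 + γ)` almost everywhere, and `ρ₀ ≥ 0`. -/
def domain : Set ((E3 → ℝ) × (E3 → ℝ) × ℝ) :=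
  {u | Integrable (fun p => (1 + ‖p‖ ^ 2) * u.1 p) ∧
    AEStronglyMeasurable u.2.1 volume ∧
    (∀ᵐ p, 0 ≤ u.1 p) ∧
    (∀ᵐ p, u.2.1 p ^ 2 ≤ u.1 p * (1 + u.1 p)) ∧
    0 ≤ u.2.2}

/-- The triples of `𝒟` with total density `ρ₀ + ρ_γ = ρ`. -/
def canonicalDomain (ρ : ℝ) : Set ((E3 → ℝ) × (E3 → ℝ) × ℝ) :=
  {u | u ∈ domain ∧ u.2.2 + rhoGamma u.1 = ρ}

/-- The canonical free energy functional at temperature `T`, where `ρ = ρ₀ + ρ_γ`. -/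
def canonicalFreeEnergy (V : E3 → ℝ) (T : ℝ) (u : (E3 → ℝ) × (E3 → ℝ) × ℝ) : ℝ :=
  let γ := u.1
  let α := u.2.1
  let ρ₀ := u.2.2
  ((2 * Real.pi) ^ 3)⁻¹ * (∫ p, ‖p‖ ^ 2 * γ p)
    - T * entropy γ α
    + fourier V 0 / 2 * (ρ₀ + rhoGamma γ) ^ 2
    + ρ₀ * (((2 * Real.pi) ^ 3)⁻¹ * ∫ p, fourier V p * (γ p + α p))
    + 1 / 2 * ((2 * Real.pi) ^ 6)⁻¹ *
        ∫ p, ∫ q, fourier V (p - q) * (α p * α q + γ p * γ q)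

end Bogoliubov

end

noncomputable section

namespace Bogoliubov

open Filter Topology

/-! Eliminating `ρ₀ = ρ - ρ_γ` turns the problem into the minimization of `pairEnergy` over pairs
with `∫ γ ≤ r`, where `r = (2π)³ρ` and `k = (2π)⁻³V̂`. The kernel is positive definite because `V ≥
0`, so the kinetic and interaction terms are nonnegative; only the product of `r - ∫ γ` with `ℓ = ∫
k (γ + α)` can be negative, and it is not convex. If the infimum `I` is nonnegative, the zero pair
is a minimizer. The substance is the case `I < 0`, where compactness may fail because `γ`
concentrates on a sphere or at the origin.

A small multiple of a weighted `L²`-norm is added to the energy. The energy is quadratic along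
lines, and its only indefinite second-order term contains the factor `∫ g`, the change of mass.
Since masses lie in a compact interval, minimizing sequences are Cauchy along a subsequence and the
regularized minimizer exists; it is unique for its mass, hence invariant under isometries. Its
energy is negative, so the condensate `r - ∫ γ` is positive and `ℓ ≤ -δ` with `δ` independent of the
regularization. The Euler equations then hold pointwise, `α² = γ(1 + γ)`, with fields `A ≥ |p|² + δ`
and `B` multiplying `γ` and `α` (`IsKernel.isStationary_of_minimizer`).

The regularity of `V̂` passes to `A` and `B` through convolution, uniformly in the regularization,
and a subsequence of the fields converges. In the limit `|B| ≤ A`. Were `A = |B|` at some `q ≠ 0`,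
radiality would give equality on a whole sphere, and the bounded second differences would make the
gap at most quadratic in the distance to it. The Euler equation then forces `γ` to be at least of
the order of the inverse distance, which is not integrable across the sphere: a contradiction with
the mass bound (`FieldsConverge.abs_lt`). Hence `γ` and `α` converge pointwise and are dominated
away from the origin.

Mass can now be lost only at `p = 0`. There the kernel is nearly constant, so low momenta can be
moved into the condensate at small cost, provided the sign of the remaining `α` is chosen optimally
(`IsKernel.flippedEnergy_le`). Dominated convergence for the interaction and Fatou's lemma for the
kinetic energy yield a pair of energy at most `I`. -/

/-- The properties of the interaction kernel `k` (a positive multiple of `V̂`) that enter the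
existence proof: bounds on `k`, on its first and on its second differences, and positivity of
the associated quadratic form. -/
structure IsKernel (k : E3 → ℝ) (M L C : ℝ) : Prop where
  continuous : Continuous k
  nonneg : ∀ p, 0 ≤ k p
  integrable : Integrable k
  le : ∀ p, k p ≤ M
  radial : IsRadial k
  posdef : ∀ f : E3 → ℝ, Integrable f → 0 ≤ ∫ p, f p * ∫ q, k (p - q) * f q
  lip : ∀ x y, |k x - k y| ≤ L * ‖x - y‖
  second : ∀ x h, |k (x + h) + k (x - h) - 2 * k x| ≤ C * ‖h‖ ^ 2

/-- The convolution `k * f`. -/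
def conv (k f : E3 → ℝ) (p : E3) : ℝ := ∫ q, k (p - q) * f q

/-- The bilinear form `∬ k(p - q) f(p) g(q) dp dq`. -/
def pairing (k f g : E3 → ℝ) : ℝ := ∫ p, f p * conv k g p

theorem abs_integral_le_integral {f g : E3 → ℝ} (hg : Integrable g) (h : ∀ p, |f p| ≤ g p) :
    |∫ p, f p| ≤ ∫ p, g p :=
  norm_integral_le_of_norm_le (f := f) hg (Filter.Eventually.of_forall h)

/-! ### Convolution with the kernel and its quadratic form -/

section Kernel

variable {k : E3 → ℝ} {M L C : ℝ} {f g : E3 → ℝ}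

theorem IsKernel.abs_le (hk : IsKernel k M L C) (p : E3) : |k p| ≤ M := by
  rw [abs_of_nonneg (hk.nonneg p)]; exact hk.le p

theorem IsKernel.bound_nonneg (hk : IsKernel k M L C) : 0 ≤ M := (hk.nonneg 0).trans (hk.le 0)

theorem IsKernel.lip_nonneg (hk : IsKernel k M L C) : 0 ≤ L := by
  obtain ⟨x, hx⟩ := exists_ne (0 : E3)
  have h := (abs_nonneg _).trans (hk.lip x 0)
  rw [sub_zero] at h
  exact nonneg_of_mul_nonneg_left h (norm_pos_iff.mpr hx)

theorem IsKernel.second_nonneg (hk : IsKernel k M L C) : 0 ≤ C := by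
  obtain ⟨x, hx⟩ := exists_ne (0 : E3)
  have h := (abs_nonneg _).trans (hk.second 0 x)
  exact nonneg_of_mul_nonneg_left h (by have := norm_pos_iff.mpr hx; positivity)

theorem IsKernel.sub_comm (hk : IsKernel k M L C) (p q : E3) : k (p - q) = k (q - p) :=
  hk.radial _ _ (norm_sub_rev p q)

theorem IsKernel.integrable_conv (hk : IsKernel k M L C) (hf : Integrable f) (p : E3) :
    Integrable fun q => k (p - q) * f q :=
  hf.bdd_mul (hk.continuous.comp (by fun_prop)).aestronglyMeasurable
    (Filter.Eventually.of_forall fun _ => hk.abs_le _)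

theorem IsKernel.integrable_mul (hk : IsKernel k M L C) (hf : Integrable f) :
    Integrable fun q => k q * f q :=
  hf.bdd_mul hk.continuous.aestronglyMeasurable (Filter.Eventually.of_forall hk.abs_le)

theorem IsKernel.conv_zero (hk : IsKernel k M L C) : conv k f 0 = ∫ q, k q * f q := by
  unfold conv
  congr 1; funext q
  rw [hk.radial (0 - q) q (by simp)]

theorem conv_const_mul (c : ℝ) (p : E3) : conv k (fun q => c * f q) p = c * conv k f p := by
  unfold conv
  rw [← integral_const_mul]
  congr 1; funext q; ring

theorem IsKernel.abs_conv_sub_le (hk : IsKernel k M L C) (hf : Integrable f) (x y : E3) :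
    |conv k f x - conv k f y| ≤ L * ‖x - y‖ * ∫ q, |f q| := by
  unfold conv
  rw [← integral_sub (hk.integrable_conv hf x) (hk.integrable_conv hf y), ← integral_const_mul]
  refine abs_integral_le_integral (hf.abs.const_mul _) fun q => ?_
  rw [← sub_mul, abs_mul]
  have := hk.lip (x - q) (y - q)
  rw [sub_sub_sub_cancel_right] at this
  exact mul_le_mul_of_nonneg_right this (abs_nonneg _)

theorem IsKernel.abs_conv_le (hk : IsKernel k M L C) (hf : Integrable f) (x : E3) :
    |conv k f x| ≤ M * ∫ q, |f q| := by
  unfold conv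
  rw [← integral_const_mul]
  refine abs_integral_le_integral (hf.abs.const_mul _) fun q => ?_
  rw [abs_mul]
  exact mul_le_mul_of_nonneg_right (hk.abs_le _) (abs_nonneg _)

theorem IsKernel.conv_second (hk : IsKernel k M L C) (hf : Integrable f) (x h : E3) :
    |conv k f (x + h) + conv k f (x - h) - 2 * conv k f x| ≤ C * ‖h‖ ^ 2 * ∫ q, |f q| := by
  unfold conv
  have h1 : Integrable fun q => k (x + h - q) * f q + k (x - h - q) * f q :=
    (hk.integrable_conv hf _).add (hk.integrable_conv hf _)
  rw [← integral_add (hk.integrable_conv hf _) (hk.integrable_conv hf _), ← integral_const_mul,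
    ← integral_sub h1 ((hk.integrable_conv hf _).const_mul _), ← integral_const_mul]
  refine abs_integral_le_integral (hf.abs.const_mul _) fun q => ?_
  have := hk.second (x - q) h
  have e : k (x + h - q) * f q + k (x - h - q) * f q - 2 * (k (x - q) * f q)
      = (k (x - q + h) + k (x - q - h) - 2 * k (x - q)) * f q := by
    rw [show x + h - q = x - q + h by abel, show x - h - q = x - q - h by abel]; ring
  rw [e, abs_mul]
  exact mul_le_mul_of_nonneg_right this (abs_nonneg _)

theorem IsKernel.continuous_conv (hk : IsKernel k M L C) (hf : Integrable f) :
    Continuous (conv k f) := by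
  have hL : LipschitzWith (L * ∫ q, |f q|).toNNReal (conv k f) := by
    refine LipschitzWith.of_dist_le_mul fun x y => ?_
    rw [Real.coe_toNNReal _ (mul_nonneg hk.lip_nonneg (integral_nonneg fun _ => abs_nonneg _)),
      Real.dist_eq, dist_eq_norm]
    calc _ ≤ _ := hk.abs_conv_sub_le hf x y
      _ = _ := by ring
  exact hL.continuous

theorem IsKernel.conv_nonneg (hk : IsKernel k M L C) (hf : ∀ᵐ p, 0 ≤ f p) (x : E3) :
    0 ≤ conv k f x :=
  integral_nonneg_of_ae (hf.mono fun _ hq => mul_nonneg (hk.nonneg _) hq)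

theorem IsKernel.integrable_mul_conv (hk : IsKernel k M L C) (hf : Integrable f)
    (hg : Integrable g) : Integrable fun p => f p * conv k g p :=
  hf.mul_bdd (hk.continuous_conv hg).aestronglyMeasurable
    (Filter.Eventually.of_forall fun _ => hk.abs_conv_le hg _)

theorem IsKernel.integrable_prod (hk : IsKernel k M L C) (hf : Integrable f)
    (hg : Integrable g) :
    Integrable (fun z : E3 × E3 => k (z.1 - z.2) * (f z.1 * g z.2)) (volume.prod volume) :=
  (hf.mul_prod hg).bdd_mul (hk.continuous.comp (by fun_prop)).aestronglyMeasurable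
    (Filter.Eventually.of_forall fun _ => hk.abs_le _)

theorem pairing_eq_iterated : pairing k f g = ∫ p, ∫ q, k (p - q) * (f p * g q) := by
  unfold pairing conv
  congr 1; funext p
  rw [← integral_const_mul]
  congr 1; funext q; ring

theorem IsKernel.pairing_comm (hk : IsKernel k M L C) (hf : Integrable f) (hg : Integrable g) :
    pairing k f g = pairing k g f := by
  rw [pairing_eq_iterated, pairing_eq_iterated, integral_integral_swap (hk.integrable_prod hf hg)]
  congr 1; funext p; congr 1; funext q
  rw [hk.sub_comm]; ring

theorem pairing_const_mul_left (c : ℝ) : pairing k (fun p => c * f p) g = c * pairing k f g := by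
  unfold pairing
  rw [← integral_const_mul]
  congr 1; funext q; ring

theorem pairing_const_mul_right (c : ℝ) : pairing k f (fun p => c * g p) = c * pairing k f g := by
  unfold pairing
  simp_rw [conv_const_mul]
  rw [← integral_const_mul]
  congr 1; funext q; ring

theorem IsKernel.pairing_add_left (hk : IsKernel k M L C) {h : E3 → ℝ} (hf : Integrable f)
    (hg : Integrable g) (hh : Integrable h) :
    pairing k (fun p => f p + g p) h = pairing k f h + pairing k g h := by
  unfold pairing
  rw [← integral_add (hk.integrable_mul_conv hf hh) (hk.integrable_mul_conv hg hh)]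
  congr 1; funext q; ring

theorem IsKernel.pairing_add_right (hk : IsKernel k M L C) {h : E3 → ℝ} (hf : Integrable f)
    (hg : Integrable g) (hh : Integrable h) :
    pairing k h (fun p => f p + g p) = pairing k h f + pairing k h g := by
  have hfg : Integrable fun p => f p + g p := hf.add hg
  rw [hk.pairing_comm hh hfg, hk.pairing_comm hh hf, hk.pairing_comm hh hg]
  exact hk.pairing_add_left hf hg hh

theorem IsKernel.pairing_self_nonneg (hk : IsKernel k M L C) (hf : Integrable f) :
    0 ≤ pairing k f f := hk.posdef f hf

theorem IsKernel.abs_pairing_le (hk : IsKernel k M L C) (hf : Integrable f) (hg : Integrable g) :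
    |pairing k f g| ≤ M * (∫ q, |f q|) * ∫ q, |g q| := by
  unfold pairing
  have e : M * (∫ q, |f q|) * ∫ q, |g q| = ∫ p, |f p| * (M * ∫ q, |g q|) := by
    rw [integral_mul_const]; ring
  rw [e]
  refine abs_integral_le_integral (hf.abs.mul_const _) fun q => ?_
  rw [abs_mul]
  exact mul_le_mul_of_nonneg_left (hk.abs_conv_le hg q) (abs_nonneg _)

/-- Expansion of the quadratic form along a line. -/
theorem IsKernel.pairing_add_smul (hk : IsKernel k M L C) (hf : Integrable f) (hg : Integrable g)
    (t : ℝ) : pairing k (fun p => f p + t * g p) (fun p => f p + t * g p)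
      = pairing k f f + t * (2 * pairing k g f) + t ^ 2 * pairing k g g := by
  have htg : Integrable fun p => t * g p := hg.const_mul t
  have hs : Integrable fun p => f p + t * g p := hf.add htg
  rw [hk.pairing_add_left hf htg hs, hk.pairing_add_right hf htg hf,
    hk.pairing_add_right hf htg htg, pairing_const_mul_left, pairing_const_mul_left,
    pairing_const_mul_right, pairing_const_mul_right, hk.pairing_comm hf hg]
  ring

/-- The convolution with a function that is invariant under isometries is radial. -/
theorem IsKernel.conv_radial (hk : IsKernel k M L C)
    (hf : ∀ R : E3 ≃ₗᵢ[ℝ] E3, (fun p => f (R p)) =ᵐ[volume] f) : IsRadial (conv k f) := by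
  intro x y hxy
  -- The reflection in the hyperplane orthogonal to `x - y` exchanges two vectors of equal norm.
  obtain ⟨R, hR⟩ : ∃ R : E3 ≃ₗᵢ[ℝ] E3, R x = y := ⟨_, Submodule.reflection_sub hxy⟩
  have hc : conv k f (R x) = ∫ q, k (R x - R q) * f (R q) :=
    (R.measurePreserving.integral_comp R.toHomeomorph.measurableEmbedding
      fun q => k (R x - q) * f q).symm
  rw [← hR, hc]
  refine integral_congr_ae ((hf R).mono fun q hq => ?_)
  dsimp only at hq ⊢
  rw [hq, ← map_sub, hk.radial (R (x - q)) (x - q) (R.norm_map _)]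

end Kernel

/-! ### Admissible pairs -/

theorem abs_le_add_half {a g : ℝ} (hg : 0 ≤ g) (h : a ^ 2 ≤ g * (1 + g)) : |a| ≤ g + 1 / 2 :=
  abs_le_of_sq_le_sq (by nlinarith) (by linarith)

/-- Multiplying the bounds `|a| ≤ g + 1/2` and `|b| ≤ h + 1/2` would leave a constant, which is not
integrable against `k(p - q)` over both variables. This bound has only terms containing `g` or `h`,
and so gives a majorant of the interaction even when `α` is not integrable. -/
theorem abs_mul_le_of_sq_le {a b g h : ℝ} (hg : 0 ≤ g) (hh : 0 ≤ h) (ha : a ^ 2 ≤ g * (1 + g))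
    (hb : b ^ 2 ≤ h * (1 + h)) : |a * b| ≤ 3 * (g * h) + 2 * g + 2 * h := by
  have hgh := mul_nonneg hg hh
  refine abs_le_of_sq_le_sq ?_ (by positivity)
  calc (a * b) ^ 2 = a ^ 2 * b ^ 2 := by ring
    _ ≤ (g * (1 + g)) * (h * (1 + h)) := mul_le_mul ha hb (sq_nonneg _) (by positivity)
    _ ≤ _ := by
      nlinarith [mul_nonneg hgh hg, mul_nonneg hgh hh, mul_nonneg hgh hgh, sq_nonneg g,
        sq_nonneg h]

/-- The pairs `(γ, α)` that occur in the domain `𝒟`. -/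
structure IsPair (γ α : E3 → ℝ) : Prop where
  integrable_weight : Integrable fun p => (1 + ‖p‖ ^ 2) * γ p
  aesm : AEStronglyMeasurable α volume
  nonneg : ∀ᵐ p, 0 ≤ γ p
  sq_le : ∀ᵐ p, α p ^ 2 ≤ γ p * (1 + γ p)

section Pair

variable {γ α : E3 → ℝ}

theorem IsPair.integrable (h : IsPair γ α) : Integrable γ := by
  have hc : Continuous fun p : E3 => (1 + ‖p‖ ^ 2)⁻¹ :=
    Continuous.inv₀ (by fun_prop) fun p => by positivity
  refine (h.integrable_weight.bdd_mul (c := 1) hc.aestronglyMeasurable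
    (Eventually.of_forall fun p => ?_)).congr (Eventually.of_forall fun p => ?_)
  · rw [Real.norm_of_nonneg (by positivity)]
    exact inv_le_one_of_one_le₀ (by nlinarith [sq_nonneg ‖p‖])
  · exact inv_mul_cancel_left₀ (by positivity) _

theorem IsPair.integrable_kin (h : IsPair γ α) : Integrable fun p => ‖p‖ ^ 2 * γ p :=
  (h.integrable_weight.sub h.integrable).congr
    (Eventually.of_forall fun p => by simp only [Pi.sub_apply]; ring)

theorem IsPair.mk_of_integrable (h1 : Integrable γ) (h2 : Integrable fun p => ‖p‖ ^ 2 * γ p)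
    (h3 : AEStronglyMeasurable α volume) (h4 : ∀ᵐ p, 0 ≤ γ p)
    (h5 : ∀ᵐ p, α p ^ 2 ≤ γ p * (1 + γ p)) : IsPair γ α :=
  ⟨(h1.add h2).congr (Eventually.of_forall fun p => by simp only [Pi.add_apply]; ring), h3, h4, h5⟩

theorem IsPair.abs_le (h : IsPair γ α) : ∀ᵐ p, |α p| ≤ γ p + 1 / 2 := by
  filter_upwards [h.nonneg, h.sq_le] with p h1 h2 using abs_le_add_half h1 h2

theorem isPair_zero : IsPair (fun _ => 0) (fun _ => 0) :=
  ⟨by simp, by fun_prop, by simp, by simp⟩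

/-- Multiplication of both members of a pair by an indicator function, and of `α` by a sign. -/
theorem IsPair.indicator (h : IsPair γ α) {S : Set E3} (hS : MeasurableSet S) {s : ℝ}
    (hs : s ^ 2 ≤ 1) : IsPair (S.indicator γ) (fun p => s * S.indicator α p) := by
  refine ⟨?_, (h.aesm.indicator hS).const_mul s, ?_, ?_⟩
  · refine (h.integrable_weight.indicator hS).congr (Eventually.of_forall fun p => ?_)
    by_cases hp : p ∈ S <;> simp [hp]
  · filter_upwards [h.nonneg] with p hp
    by_cases hp' : p ∈ S <;> simp [hp', hp]
  · filter_upwards [h.nonneg, h.sq_le] with p h1 h2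
    by_cases hp : p ∈ S
    · simp only [hp, Set.indicator_of_mem]
      nlinarith [sq_nonneg (α p)]
    · simp [hp]

end Pair

/-- The interaction energy `∬ k(p - q) (α(p) α(q) + γ(p) γ(q)) dp dq`. -/
def interaction (k γ α : E3 → ℝ) : ℝ := ∫ p, ∫ q, k (p - q) * (α p * α q + γ p * γ q)

/-- The energy of a pair, after the condensate density has been expressed by `r - ∫ γ`. -/
def pairEnergy (k : E3 → ℝ) (r : ℝ) (γ α : E3 → ℝ) : ℝ :=
  (∫ p, ‖p‖ ^ 2 * γ p) + (r - ∫ p, γ p) * (∫ p, k p * (γ p + α p))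
    + 1 / 2 * interaction k γ α

/-! ### Integrability and dominated convergence of the energy terms -/

section Convergence

variable {k : E3 → ℝ} {M L C : ℝ}

theorem IsKernel.integrable_prod_fst (hk : IsKernel k M L C) {h : E3 → ℝ} (hh : Integrable h) :
    Integrable (fun z : E3 × E3 => k (z.1 - z.2) * h z.1) (volume.prod volume) := by
  have := (hh.convolution_integrand (ContinuousLinearMap.mul ℝ ℝ) hk.integrable).swap
  refine this.congr (Eventually.of_forall fun z => ?_)
  simp only [Function.comp, Prod.swap, ContinuousLinearMap.mul_apply']
  rw [hk.sub_comm, mul_comm]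

theorem IsKernel.integrable_prod_snd (hk : IsKernel k M L C) {h : E3 → ℝ} (hh : Integrable h) :
    Integrable (fun z : E3 × E3 => k (z.1 - z.2) * h z.2) (volume.prod volume) := by
  have := (hh.convolution_integrand (ContinuousLinearMap.mul ℝ ℝ) hk.integrable)
  refine this.congr (Eventually.of_forall fun z => ?_)
  simp only [ContinuousLinearMap.mul_apply']
  rw [mul_comm]

theorem IsKernel.integrable_majorant (hk : IsKernel k M L C) {h : E3 → ℝ} (hh : Integrable h) :
    Integrable (fun z : E3 × E3 => k (z.1 - z.2) * (4 * (h z.1 * h z.2) + 2 * h z.1 + 2 * h z.2))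
      (volume.prod volume) := by
  refine ((((hk.integrable_prod hh hh).const_mul 4).add
    ((hk.integrable_prod_fst hh).const_mul 2)).add
    ((hk.integrable_prod_snd hh).const_mul 2)).congr (Eventually.of_forall fun z => ?_)
  simp only [Pi.add_apply]; ring

theorem ae_prod_of_ae {P : E3 → Prop} (h : ∀ᵐ p, P p) :
    ∀ᵐ z : E3 × E3 ∂(volume.prod volume), P z.1 ∧ P z.2 :=
  (Measure.quasiMeasurePreserving_fst.ae h).and (Measure.quasiMeasurePreserving_snd.ae h)

theorem interaction_majorant (hk : ∀ p, 0 ≤ k p) {γ α h : E3 → ℝ} (hγ : ∀ᵐ p, 0 ≤ γ p)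
    (hα : ∀ᵐ p, α p ^ 2 ≤ γ p * (1 + γ p)) (hh : ∀ᵐ p, γ p ≤ h p) :
    ∀ᵐ z : E3 × E3 ∂(volume.prod volume),
      ‖k (z.1 - z.2) * (α z.1 * α z.2 + γ z.1 * γ z.2)‖
        ≤ k (z.1 - z.2) * (4 * (h z.1 * h z.2) + 2 * h z.1 + 2 * h z.2) := by
  filter_upwards [ae_prod_of_ae hγ, ae_prod_of_ae hα, ae_prod_of_ae hh] with z h1 h2 h3
  rw [Real.norm_eq_abs, abs_mul, abs_of_nonneg (hk _)]
  refine mul_le_mul_of_nonneg_left ?_ (hk _)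
  have e1 := abs_mul_le_of_sq_le h1.1 h1.2 h2.1 h2.2
  have e2 : γ z.1 * γ z.2 ≤ h z.1 * h z.2 := mul_le_mul h3.1 h3.2 h1.2 (h1.1.trans h3.1)
  have e3 := mul_nonneg h1.1 h1.2
  have := abs_add_le (α z.1 * α z.2) (γ z.1 * γ z.2)
  rw [abs_of_nonneg e3] at this
  linarith [h3.1, h3.2]

theorem aestronglyMeasurable_interaction (hk : Continuous k) {γ α : E3 → ℝ}
    (hγ : AEStronglyMeasurable γ volume) (hα : AEStronglyMeasurable α volume) :
    AEStronglyMeasurable (fun z : E3 × E3 => k (z.1 - z.2) * (α z.1 * α z.2 + γ z.1 * γ z.2))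
      (volume.prod volume) := by
  have h1 : Continuous fun z : E3 × E3 => k (z.1 - z.2) := hk.comp (by fun_prop)
  exact h1.aestronglyMeasurable.mul ((hα.comp_fst.mul hα.comp_snd).add
    (hγ.comp_fst.mul hγ.comp_snd))

theorem IsKernel.interaction_eq_prod (hk : IsKernel k M L C) {γ α : E3 → ℝ} (hi : Integrable γ)
    (hm : AEStronglyMeasurable α volume) (hγ : ∀ᵐ p, 0 ≤ γ p)
    (hα : ∀ᵐ p, α p ^ 2 ≤ γ p * (1 + γ p)) :
    interaction k γ α = ∫ z : E3 × E3, k (z.1 - z.2) * (α z.1 * α z.2 + γ z.1 * γ z.2)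
      ∂(volume.prod volume) := by
  unfold interaction
  rw [integral_prod _ ((hk.integrable_majorant hi).mono'
    (aestronglyMeasurable_interaction hk.continuous hi.1 hm)
    (interaction_majorant hk.nonneg hγ hα (Eventually.of_forall fun _ => le_rfl)))]

theorem IsKernel.integrable_mul_pair (hk : IsKernel k M L C) {γ α : E3 → ℝ} (hi : Integrable γ)
    (hm : AEStronglyMeasurable α volume) (hγ : ∀ᵐ p, 0 ≤ γ p)
    (hα : ∀ᵐ p, α p ^ 2 ≤ γ p * (1 + γ p)) : Integrable fun p => k p * α p := by
  refine ((hk.integrable_mul hi).add (hk.integrable.const_mul (1 / 2))).mono'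
    (hk.continuous.aestronglyMeasurable.mul hm) ?_
  filter_upwards [hγ, hα] with p h1 h2
  have := mul_le_mul_of_nonneg_left (abs_le_add_half h1 h2) (hk.nonneg p)
  rw [Real.norm_eq_abs, abs_mul, abs_of_nonneg (hk.nonneg p), Pi.add_apply]
  linarith

/-- Dominated convergence for all terms of the energy but the kinetic one. -/
theorem IsKernel.tendsto_of_dominated (hk : IsKernel k M L C) {γn αn : ℕ → E3 → ℝ}
    {γ α h : E3 → ℝ} (hh : Integrable h) (hm1 : ∀ n, AEStronglyMeasurable (γn n) volume)
    (hm2 : ∀ n, AEStronglyMeasurable (αn n) volume) (hγ : ∀ n, ∀ᵐ p, 0 ≤ γn n p)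
    (hα : ∀ n, ∀ᵐ p, αn n p ^ 2 ≤ γn n p * (1 + γn n p)) (hle : ∀ n, ∀ᵐ p, γn n p ≤ h p)
    (hlim1 : ∀ᵐ p, Tendsto (fun n => γn n p) atTop (𝓝 (γ p)))
    (hlim2 : ∀ᵐ p, Tendsto (fun n => αn n p) atTop (𝓝 (α p))) :
    Integrable γ ∧ AEStronglyMeasurable α volume ∧ (∀ᵐ p, 0 ≤ γ p) ∧
    (∀ᵐ p, α p ^ 2 ≤ γ p * (1 + γ p)) ∧
    Tendsto (fun n => ∫ p, γn n p) atTop (𝓝 (∫ p, γ p)) ∧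
    Tendsto (fun n => ∫ p, k p * γn n p) atTop (𝓝 (∫ p, k p * γ p)) ∧
    Tendsto (fun n => ∫ p, k p * αn n p) atTop (𝓝 (∫ p, k p * α p)) ∧
    Tendsto (fun n => interaction k (γn n) (αn n)) atTop (𝓝 (interaction k γ α)) := by
  have hγ' := ae_all_iff.mpr hγ
  have hα' := ae_all_iff.mpr hα
  have hle' := ae_all_iff.mpr hle
  have m1 : AEStronglyMeasurable γ volume := aestronglyMeasurable_of_tendsto_ae atTop hm1 hlim1
  have m2 : AEStronglyMeasurable α volume := aestronglyMeasurable_of_tendsto_ae atTop hm2 hlim2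
  have n1 : ∀ᵐ p, 0 ≤ γ p := by
    filter_upwards [hγ', hlim1] with p h1 h2 using ge_of_tendsto' h2 h1
  have n2 : ∀ᵐ p, γ p ≤ h p := by
    filter_upwards [hle', hlim1] with p h1 h2 using le_of_tendsto' h2 h1
  have n3 : ∀ᵐ p, α p ^ 2 ≤ γ p * (1 + γ p) := by
    filter_upwards [hα', hlim1, hlim2] with p h1 h2 h3
    exact le_of_tendsto_of_tendsto' (h3.pow 2) (h2.mul (h2.const_add 1)) h1
  have i1 : Integrable γ := hh.mono' m1 (by
    filter_upwards [n1, n2] with p h1 h2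
    rwa [Real.norm_of_nonneg h1])
  have in1 : ∀ n, Integrable (γn n) := fun n => hh.mono' (hm1 n) (by
    filter_upwards [hγ n, hle n] with p h1 h2
    rwa [Real.norm_of_nonneg h1])
  refine ⟨i1, m2, n1, n3, ?_, ?_, ?_, ?_⟩
  · refine tendsto_integral_of_dominated_convergence h hm1 hh (fun n => ?_) hlim1
    filter_upwards [hγ n, hle n] with p h1 h2
    rwa [Real.norm_of_nonneg h1]
  · refine tendsto_integral_of_dominated_convergence _
      (fun n => hk.continuous.aestronglyMeasurable.mul (hm1 n)) (hk.integrable_mul hh)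
      (fun n => ?_) (hlim1.mono fun p hp => hp.const_mul _)
    filter_upwards [hγ n, hle n] with p h1 h2
    rw [Real.norm_of_nonneg (mul_nonneg (hk.nonneg p) h1)]
    exact mul_le_mul_of_nonneg_left h2 (hk.nonneg p)
  · refine tendsto_integral_of_dominated_convergence _
      (fun n => hk.continuous.aestronglyMeasurable.mul (hm2 n))
      ((hk.integrable_mul hh).add (hk.integrable.const_mul (1 / 2)))
      (fun n => ?_) (hlim2.mono fun p hp => hp.const_mul _)
    filter_upwards [hγ n, hle n, hα n] with p h1 h2 h3
    have := mul_le_mul_of_nonneg_left ((abs_le_add_half h1 h3).trans (add_le_add_left h2 _))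
      (hk.nonneg p)
    rw [Real.norm_eq_abs, abs_mul, abs_of_nonneg (hk.nonneg p), Pi.add_apply]
    linarith
  · rw [hk.interaction_eq_prod i1 m2 n1 n3]
    simp_rw [fun n => hk.interaction_eq_prod (in1 n) (hm2 n) (hγ n) (hα n)]
    refine tendsto_integral_of_dominated_convergence _
      (fun n => aestronglyMeasurable_interaction hk.continuous (hm1 n) (hm2 n))
      (hk.integrable_majorant hh)
      (fun n => interaction_majorant hk.nonneg (hγ n) (hα n) (hle n)) ?_
    filter_upwards [ae_prod_of_ae hlim1, ae_prod_of_ae hlim2] with z h1 h2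
    exact ((h2.1.mul h2.2).add (h1.1.mul h1.2)).const_mul _

/-- Separating the two summands requires `α` to be integrable, which a general pair does not
guarantee; there `interaction` has to be handled through its joint integrand. -/
theorem IsKernel.interaction_eq_pairing (hk : IsKernel k M L C) {γ α : E3 → ℝ}
    (hγ : Integrable γ) (hα : Integrable α) :
    interaction k γ α = pairing k γ γ + pairing k α α := by
  unfold interaction pairing
  rw [← integral_add (hk.integrable_mul_conv hγ hγ) (hk.integrable_mul_conv hα hα)]
  congr 1; funext p
  unfold conv
  rw [← integral_const_mul, ← integral_const_mul,
    ← integral_add ((hk.integrable_conv hγ p).const_mul _) ((hk.integrable_conv hα p).const_mul _)]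
  congr 1; funext q; ring

theorem interaction_const_mul_right {γ α : E3 → ℝ} {s : ℝ} (hs : s ^ 2 = 1) :
    interaction k γ (fun p => s * α p) = interaction k γ α := by
  unfold interaction
  congr 1; funext p; congr 1; funext q
  linear_combination k (p - q) * α p * α q * hs

theorem IsKernel.integral_mul_add (hk : IsKernel k M L C) {γ α : E3 → ℝ} (h : IsPair γ α) :
    ∫ p, k p * (γ p + α p) = (∫ p, k p * γ p) + ∫ p, k p * α p := by
  rw [← integral_add (hk.integrable_mul h.integrable)
    (hk.integrable_mul_pair h.integrable h.aesm h.nonneg h.sq_le)]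
  congr 1; funext p; ring

end Convergence

/-! ### Square integrable functions and sequences -/

section L2

variable {X : Type*} [MeasurableSpace X] {μ : Measure X}

theorem norm_toLp_sq {f : X → ℝ} (hf : MemLp f 2 μ) : ‖hf.toLp f‖ ^ 2 = ∫ x, f x ^ 2 ∂μ := by
  rw [← real_inner_self_eq_norm_sq, L2.inner_def]
  refine integral_congr_ae ?_
  filter_upwards [hf.coeFn_toLp] with x hx
  rw [hx, real_inner_self_eq_norm_sq, Real.norm_eq_abs, sq_abs]

theorem integral_mul_sq_le {f g : X → ℝ} (hf : MemLp f 2 μ) (hg : MemLp g 2 μ) :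
    (∫ x, f x * g x ∂μ) ^ 2 ≤ (∫ x, f x ^ 2 ∂μ) * ∫ x, g x ^ 2 ∂μ := by
  have h : ∫ x, f x * g x ∂μ = inner ℝ (hf.toLp f) (hg.toLp g) := by
    rw [L2.inner_def]
    refine integral_congr_ae ?_
    filter_upwards [hf.coeFn_toLp, hg.coeFn_toLp] with x h1 h2
    rw [h1, h2, real_inner_eq_re_inner]; simp [mul_comm]
  rw [h, ← norm_toLp_sq hf, ← norm_toLp_sq hg, ← mul_pow, ← sq_abs]
  exact pow_le_pow_left₀ (abs_nonneg _) (abs_real_inner_le_norm _ _) 2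

/-- Completeness of `L²`, for sequences of functions. -/
theorem exists_L2_limit {f : ℕ → X → ℝ} (hf : ∀ n, MemLp (f n) 2 μ) {c : ℕ → ℝ}
    (hc : Tendsto c atTop (𝓝 0)) (h : ∀ n m, ∫ x, (f n x - f m x) ^ 2 ∂μ ≤ c n + c m) :
    ∃ g, MemLp g 2 μ ∧ Tendsto (fun n => ∫ x, (f n x - g x) ^ 2 ∂μ) atTop (𝓝 0) ∧
      ∃ φ : ℕ → ℕ, StrictMono φ ∧ ∀ᵐ x ∂μ, Tendsto (fun n => f (φ n) x) atTop (𝓝 (g x)) := by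
  have hd : ∀ n m, ‖(hf n).toLp _ - (hf m).toLp _‖ ^ 2 ≤ c n + c m := fun n m => by
    rw [← MemLp.toLp_sub, norm_toLp_sq]
    exact h n m
  have hcau : CauchySeq fun n => (hf n).toLp (f n) := by
    refine Metric.cauchySeq_iff.mpr fun ε hε => ?_
    have h2 : ∀ᶠ n in atTop, c n < ε ^ 2 / 2 := hc.eventually_lt_const (by positivity)
    obtain ⟨N, hN⟩ := eventually_atTop.mp h2
    refine ⟨N, fun m hm n hn => ?_⟩
    rw [dist_eq_norm]
    refine lt_of_pow_lt_pow_left₀ 2 hε.le ?_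
    linarith [hd m n, hN m hm, hN n hn]
  obtain ⟨G, hG⟩ := cauchySeq_tendsto_of_complete hcau
  refine ⟨G, Lp.memLp G, ?_, ?_⟩
  · have h3 : Tendsto (fun n => ‖(hf n).toLp (f n) - G‖ ^ 2) atTop (𝓝 (0 ^ 2)) :=
      (tendsto_iff_norm_sub_tendsto_zero.mp hG).pow 2
    rw [zero_pow two_ne_zero] at h3
    refine h3.congr fun n => ?_
    have e : (hf n).toLp (f n) - G = ((hf n).sub (Lp.memLp G)).toLp _ := by
      rw [MemLp.toLp_sub (hf n) (Lp.memLp G), Lp.toLp_coeFn]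
    rw [e, norm_toLp_sq]
    rfl
  · obtain ⟨φ, hφ, h4⟩ := (tendstoInMeasure_of_tendsto_Lp hG).exists_seq_tendsto_ae
    refine ⟨φ, hφ, ?_⟩
    filter_upwards [h4, ae_all_iff.mpr fun n => (hf n).coeFn_toLp] with x h5 h6
    exact h5.congr fun n => h6 _

end L2

/-! ### The weighted space of the regularization -/

/-- The weight of the regularization. -/
def wt (p : E3) : ℝ := (1 + ‖p‖ ^ 2) ^ 2

theorem continuous_wt : Continuous wt := by unfold wt; fun_prop

theorem wt_pos (p : E3) : 0 < wt p := by unfold wt; positivity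

/-- Functions that are square integrable with respect to the weight. -/
def IsRegular (f : E3 → ℝ) : Prop := MemLp (fun p => wt p * f p) 2 volume

/-- The square of the weighted `L²`-norm. -/
def sqNorm (f : E3 → ℝ) : ℝ := ∫ p, (wt p * f p) ^ 2

/-- In dimension three `(1 + |p|²)⁻²` is integrable, since `4 > 3`. By Cauchy–Schwarz the weighted
`L²`-norm therefore controls the norm of `L¹((1 + p²)dp)`. -/
theorem memLp_inv_one_add_sq : MemLp (fun p : E3 => (1 + ‖p‖ ^ 2)⁻¹) 2 volume := by
  have hc : Continuous fun p : E3 => (1 + ‖p‖ ^ 2)⁻¹ :=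
    Continuous.inv₀ (by fun_prop) fun p => by positivity
  rw [memLp_two_iff_integrable_sq hc.aestronglyMeasurable]
  have h := integrable_rpow_neg_one_add_norm_sq (E := E3) (μ := volume) (r := 4) (by simp; norm_num)
  refine h.congr (Eventually.of_forall fun p => ?_)
  have : (-4 / 2 : ℝ) = ((-2 : ℤ) : ℝ) := by norm_num
  simp only [this, Real.rpow_intCast]
  rw [inv_pow]; rfl

section Regular

variable {f g : E3 → ℝ}

theorem IsRegular.add (hf : IsRegular f) (hg : IsRegular g) : IsRegular fun p => f p + g p := by
  refine (MemLp.add hf hg).ae_eq (Eventually.of_forall fun p => ?_)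
  simp only [Pi.add_apply]; ring

theorem IsRegular.const_mul (hf : IsRegular f) (c : ℝ) : IsRegular fun p => c * f p := by
  refine (MemLp.const_mul hf c).ae_eq (Eventually.of_forall fun p => ?_)
  ring

theorem IsRegular.sub (hf : IsRegular f) (hg : IsRegular g) : IsRegular fun p => f p - g p := by
  refine (MemLp.sub hf hg).ae_eq (Eventually.of_forall fun p => ?_)
  simp only [Pi.sub_apply]; ring

theorem isRegular_zero : IsRegular fun _ => 0 := by simp [IsRegular]

theorem IsRegular.integrable_weight (hf : IsRegular f) :
    Integrable fun p => (1 + ‖p‖ ^ 2) * f p := by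
  refine (MemLp.integrable_mul hf memLp_inv_one_add_sq).congr (Eventually.of_forall fun p => ?_)
  have : (1 + ‖p‖ ^ 2) ≠ 0 := by positivity
  simp only [Pi.mul_apply, wt]
  field_simp

theorem IsRegular.integrable (hf : IsRegular f) : Integrable f := by
  have hc : Continuous fun p : E3 => (1 + ‖p‖ ^ 2)⁻¹ :=
    Continuous.inv₀ (by fun_prop) fun p => by positivity
  refine (hf.integrable_weight.bdd_mul (c := 1) hc.aestronglyMeasurable
    (Eventually.of_forall fun p => ?_)).congr (Eventually.of_forall fun p => ?_)
  · rw [Real.norm_of_nonneg (by positivity)]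
    exact inv_le_one_of_one_le₀ (by nlinarith [sq_nonneg ‖p‖])
  · exact inv_mul_cancel_left₀ (by positivity) _

theorem IsRegular.integrable_kin (hf : IsRegular f) : Integrable fun p => ‖p‖ ^ 2 * f p :=
  (hf.integrable_weight.sub hf.integrable).congr
    (Eventually.of_forall fun p => by simp only [Pi.sub_apply]; ring)

theorem IsRegular.integrable_wt_mul (hf : IsRegular f) (hg : IsRegular g) :
    Integrable fun p => wt p ^ 2 * (f p * g p) :=
  (MemLp.integrable_mul hf hg).congr
    (Eventually.of_forall fun p => by simp only [Pi.mul_apply]; ring)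

theorem sqNorm_nonneg : 0 ≤ sqNorm f := integral_nonneg fun _ => sq_nonneg _

theorem sqNorm_eq : sqNorm f = ∫ p, wt p ^ 2 * (f p * f p) := by
  unfold sqNorm; congr 1; funext p; ring

theorem IsRegular.inner_sq_le (hf : IsRegular f) (hg : IsRegular g) :
    (∫ p, wt p ^ 2 * (f p * g p)) ^ 2 ≤ sqNorm f * sqNorm g := by
  have := integral_mul_sq_le hf hg
  rwa [show (fun p => wt p * f p * (wt p * g p)) = fun p => wt p ^ 2 * (f p * g p) by
    funext p; ring] at this

theorem IsRegular.weight_sq_le (hf : IsRegular f) :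
    (∫ p, (1 + ‖p‖ ^ 2) * |f p|) ^ 2 ≤ sqNorm f * ∫ p : E3, ((1 + ‖p‖ ^ 2)⁻¹) ^ 2 := by
  have hf' : MemLp (fun p => wt p * |f p|) 2 volume := by
    refine (MemLp.norm hf).ae_eq (Eventually.of_forall fun p => ?_)
    simp only [norm_mul, Real.norm_eq_abs, abs_of_pos (wt_pos p)]
  have := integral_mul_sq_le hf' memLp_inv_one_add_sq
  rw [show (fun p : E3 => wt p * |f p| * (1 + ‖p‖ ^ 2)⁻¹) = fun p => (1 + ‖p‖ ^ 2) * |f p| by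
    funext p
    have : (1 + ‖p‖ ^ 2) ≠ 0 := by positivity
    simp only [wt]; field_simp] at this
  simpa only [sqNorm, mul_pow, sq_abs] using this

theorem IsRegular.integral_abs_le (hf : IsRegular f) :
    ∫ p, |f p| ≤ ∫ p, (1 + ‖p‖ ^ 2) * |f p| := by
  have h : Integrable fun p => (1 + ‖p‖ ^ 2) * |f p| :=
    hf.integrable_weight.abs.congr (Eventually.of_forall fun p => by
      simp only [abs_mul]; rw [abs_of_pos (by positivity)])
  refine integral_mono hf.integrable.abs h fun p => ?_
  have := abs_nonneg (f p)
  nlinarith [mul_nonneg (sq_nonneg ‖p‖) this]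

theorem IsRegular.abs_kin_le (hf : IsRegular f) :
    |∫ p, ‖p‖ ^ 2 * f p| ≤ ∫ p, (1 + ‖p‖ ^ 2) * |f p| := by
  have h : Integrable fun p => (1 + ‖p‖ ^ 2) * |f p| :=
    hf.integrable_weight.abs.congr (Eventually.of_forall fun p => by
      simp only [abs_mul]; rw [abs_of_pos (by positivity)])
  refine abs_integral_le_integral h fun p => ?_
  rw [abs_mul, abs_of_nonneg (by positivity)]
  nlinarith [abs_nonneg (f p)]

theorem sqNorm_add_smul (hf : IsRegular f) (hg : IsRegular g) (t : ℝ) :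
    sqNorm (fun p => f p + t * g p)
      = sqNorm f + t * (2 * ∫ p, wt p ^ 2 * (f p * g p)) + t ^ 2 * sqNorm g := by
  rw [sqNorm_eq, sqNorm_eq, sqNorm_eq]
  have h1 := hf.integrable_wt_mul hf
  have h2 := (hf.integrable_wt_mul hg).const_mul (t * 2)
  have h3 := (hg.integrable_wt_mul hg).const_mul (t ^ 2)
  rw [← mul_assoc, ← integral_const_mul, ← integral_const_mul, ← integral_add h1 h2,
    ← integral_add (by exact h1.add h2) h3]
  congr 1; funext p; ring

end Regular

/-! ### The regularized energy and its minimizers -/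

/-- The regularized energy. -/
def regEnergy (k : E3 → ℝ) (r ε : ℝ) (γ α : E3 → ℝ) : ℝ :=
  pairEnergy k r γ α + ε * (sqNorm γ + sqNorm α)

/-- The first-order term in the expansion of the regularized energy along a line. -/
def slope (k : E3 → ℝ) (r ε : ℝ) (γ α g a : E3 → ℝ) : ℝ :=
  (∫ p, ‖p‖ ^ 2 * g p) - (∫ p, g p) * (∫ p, k p * (γ p + α p))
    + (r - ∫ p, γ p) * (∫ p, k p * (g p + a p)) + pairing k g γ + pairing k a α
    + 2 * ε * ((∫ p, wt p ^ 2 * (γ p * g p)) + ∫ p, wt p ^ 2 * (α p * a p))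

/-- The second-order term in the expansion of the regularized energy along a line. -/
def curvature (k : E3 → ℝ) (ε : ℝ) (g a : E3 → ℝ) : ℝ :=
  -(∫ p, g p) * (∫ p, k p * (g p + a p)) + 1 / 2 * (pairing k g g + pairing k a a)
    + ε * (sqNorm g + sqNorm a)

/-- The domain of the regularized minimization problem. -/
structure IsRegularPair (r : ℝ) (γ α : E3 → ℝ) : Prop where
  left : IsRegular γ
  right : IsRegular α
  nonneg : ∀ᵐ p, 0 ≤ γ p
  sq_le : ∀ᵐ p, α p ^ 2 ≤ γ p * (1 + γ p)
  mass_le : ∫ p, γ p ≤ r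

theorem IsRegularPair.isPair {r : ℝ} {γ α : E3 → ℝ} (h : IsRegularPair r γ α) : IsPair γ α :=
  ⟨h.left.integrable_weight, h.right.integrable.1, h.nonneg, h.sq_le⟩

/-- Convexity of the constraint set, which reflects the concavity of `g ↦ √(g(1 + g))`. The cross
term rests on `gh(1 + g)(1 + h) ≤ (gh + (g + h)/2)²`, where the defect is `(g - h)²/4`. -/
theorem sq_le_of_segment {a b g h t : ℝ} (ht0 : 0 ≤ t) (ht1 : t ≤ 1) (hg : 0 ≤ g) (hh : 0 ≤ h)
    (ha : a ^ 2 ≤ g * (1 + g)) (hb : b ^ 2 ≤ h * (1 + h)) :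
    (a + t * (b - a)) ^ 2 ≤ (g + t * (h - g)) * (1 + (g + t * (h - g))) := by
  have hs : 0 ≤ 1 - t := by linarith
  have hab : 2 * (a * b) ≤ 2 * (g * h) + g + h := by
    have h1 : |a * b| ≤ g * h + (g + h) / 2 := by
      refine abs_le_of_sq_le_sq ?_ (by positivity)
      calc (a * b) ^ 2 = a ^ 2 * b ^ 2 := by ring
        _ ≤ (g * (1 + g)) * (h * (1 + h)) := mul_le_mul ha hb (sq_nonneg _) (by positivity)
        _ ≤ _ := by nlinarith [sq_nonneg (g - h)]
    linarith [le_abs_self (a * b)]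
  nlinarith [mul_le_mul_of_nonneg_left ha (mul_nonneg hs hs),
    mul_le_mul_of_nonneg_left hb (mul_nonneg ht0 ht0),
    mul_le_mul_of_nonneg_left hab (mul_nonneg ht0 hs)]

section Regularized

variable {k : E3 → ℝ} {M L C r ε : ℝ} {γ α γ' α' g a : E3 → ℝ}

theorem IsRegularPair.segment (h : IsRegularPair r γ α) (hγ : IsRegular γ') (hα : IsRegular α')
    (h0 : ∀ᵐ p, 0 ≤ γ' p) (h1 : ∀ᵐ p, α' p ^ 2 ≤ γ' p * (1 + γ' p)) {t : ℝ} (ht0 : 0 ≤ t)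
    (ht1 : t ≤ 1) (hm : (∫ p, γ p) + t * ((∫ p, γ' p) - ∫ p, γ p) ≤ r) :
    IsRegularPair r (fun p => γ p + t * (γ' p - γ p)) (fun p => α p + t * (α' p - α p)) := by
  refine ⟨h.left.add ((hγ.sub h.left).const_mul t), h.right.add ((hα.sub h.right).const_mul t),
    ?_, ?_, ?_⟩
  · filter_upwards [h.nonneg, h0] with p h2 h3
    nlinarith [mul_nonneg ht0 h3, mul_nonneg (sub_nonneg.mpr ht1) h2]
  · filter_upwards [h.nonneg, h0, h.sq_le, h1] with p h2 h3 h4 h5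
    exact sq_le_of_segment ht0 ht1 h2 h3 h4 h5
  · have i1 : Integrable fun p => t * (γ' p - γ p) := (hγ.sub h.left).integrable.const_mul t
    rw [integral_add h.left.integrable i1, integral_const_mul,
      integral_sub hγ.integrable h.left.integrable]
    exact hm

/-- Every term is linear or quadratic in the pair, the condensate term being a product of two affine
functions, so the expansion is exact. -/
theorem IsKernel.regEnergy_add_smul (hk : IsKernel k M L C) (hγ : IsRegular γ) (hα : IsRegular α)
    (hg : IsRegular g) (ha : IsRegular a) (t : ℝ) :
    regEnergy k r ε (fun p => γ p + t * g p) (fun p => α p + t * a p)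
      = regEnergy k r ε γ α + t * slope k r ε γ α g a + t ^ 2 * curvature k ε g a := by
  have e1 : ∫ p, ‖p‖ ^ 2 * (γ p + t * g p) = (∫ p, ‖p‖ ^ 2 * γ p) + t * ∫ p, ‖p‖ ^ 2 * g p := by
    rw [← integral_const_mul, ← integral_add hγ.integrable_kin (hg.integrable_kin.const_mul t)]
    congr 1; funext p; ring
  have e2 : ∫ p, (γ p + t * g p) = (∫ p, γ p) + t * ∫ p, g p := by
    rw [← integral_const_mul, ← integral_add hγ.integrable (hg.integrable.const_mul t)]
  have i1 : Integrable fun p => k p * (γ p + α p) :=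
    hk.integrable_mul (hγ.integrable.add hα.integrable)
  have i2 : Integrable fun p => k p * (g p + a p) :=
    hk.integrable_mul (hg.integrable.add ha.integrable)
  have e3 : ∫ p, k p * ((γ p + t * g p) + (α p + t * a p))
      = (∫ p, k p * (γ p + α p)) + t * ∫ p, k p * (g p + a p) := by
    rw [← integral_const_mul, ← integral_add i1 (i2.const_mul t)]
    congr 1; funext p; ring
  have i3 : Integrable fun p => γ p + t * g p := hγ.integrable.add (hg.integrable.const_mul t)
  have i4 : Integrable fun p => α p + t * a p := hα.integrable.add (ha.integrable.const_mul t)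
  unfold regEnergy pairEnergy slope curvature
  rw [e1, e2, e3, hk.interaction_eq_pairing hγ.integrable hα.integrable,
    hk.interaction_eq_pairing i3 i4, hk.pairing_add_smul hγ.integrable hg.integrable,
    hk.pairing_add_smul hα.integrable ha.integrable, sqNorm_add_smul hγ hg, sqNorm_add_smul hα ha]
  ring

theorem IsKernel.regEnergy_add (hk : IsKernel k M L C) (hγ : IsRegular γ) (hα : IsRegular α)
    (hγ' : IsRegular γ') (hα' : IsRegular α') :
    regEnergy k r ε γ' α' = regEnergy k r ε γ α
      + slope k r ε γ α (fun p => γ' p - γ p) (fun p => α' p - α p)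
      + curvature k ε (fun p => γ' p - γ p) (fun p => α' p - α p) := by
  have := hk.regEnergy_add_smul (r := r) (ε := ε) hγ hα (hγ'.sub hγ) (hα'.sub hα) 1
  simpa only [one_mul, one_pow, add_sub_cancel] using this

/-- The energy at a midpoint. -/
theorem IsKernel.regEnergy_midpoint (hk : IsKernel k M L C) (hγ : IsRegular γ) (hα : IsRegular α)
    (hγ' : IsRegular γ') (hα' : IsRegular α') :
    regEnergy k r ε (fun p => γ p + 1 / 2 * (γ' p - γ p)) (fun p => α p + 1 / 2 * (α' p - α p))
      = 1 / 2 * regEnergy k r ε γ α + 1 / 2 * regEnergy k r ε γ' α'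
        - 1 / 4 * curvature k ε (fun p => γ' p - γ p) (fun p => α' p - α p) := by
  rw [hk.regEnergy_add_smul hγ hα (hγ'.sub hγ) (hα'.sub hα),
    hk.regEnergy_add hγ hα hγ' hα']
  ring

/-- Since `α ≥ -γ - 1/2`, the contribution of `γ` cancels and only the integral of `k` remains, so
the bound does not depend on the pair. -/
theorem IsKernel.le_pairing_integral (hk : IsKernel k M L C) (h : IsPair γ α) :
    -(1 / 2 * ∫ p, k p) ≤ ∫ p, k p * (γ p + α p) := by
  rw [← integral_const_mul, ← integral_neg]
  have i := (hk.integrable_mul h.integrable).add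
    (hk.integrable_mul_pair h.integrable h.aesm h.nonneg h.sq_le)
  refine integral_mono_ae (hk.integrable.const_mul _).neg
    (i.congr (Eventually.of_forall fun p => by simp only [Pi.add_apply]; ring)) ?_
  filter_upwards [h.abs_le] with p hp
  have := mul_le_mul_of_nonneg_left (neg_le_of_abs_le hp) (hk.nonneg p)
  linarith

theorem IsKernel.abs_integral_pair_le (hk : IsKernel k M L C) (h : IsPair γ α)
    (hr : ∫ p, γ p ≤ r) : |∫ p, k p * (γ p + α p)| ≤ 2 * M * r + 1 / 2 * ∫ p, k p := by
  have hM := hk.bound_nonneg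
  refine _root_.abs_le.mpr ⟨?_, ?_⟩
  · have := hk.le_pairing_integral h
    have h0 : 0 ≤ ∫ p, γ p := integral_nonneg_of_ae h.nonneg
    have := mul_nonneg hM (h0.trans hr)
    linarith
  · have i := (hk.integrable_mul h.integrable).add
      (hk.integrable_mul_pair h.integrable h.aesm h.nonneg h.sq_le)
    have e : ∫ p, k p * (γ p + α p) ≤ ∫ p, (2 * M * γ p + 1 / 2 * k p) := by
      refine integral_mono_ae
        (i.congr (Eventually.of_forall fun p => by simp only [Pi.add_apply]; ring))
        ((h.integrable.const_mul _).add (hk.integrable.const_mul _)) ?_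
      filter_upwards [h.abs_le, h.nonneg] with p hp h0
      have h1 := mul_le_mul_of_nonneg_left ((le_abs_self _).trans hp) (hk.nonneg p)
      have h2 := mul_le_mul_of_nonneg_right (hk.le p) h0
      linarith
    rw [integral_add (h.integrable.const_mul _) (hk.integrable.const_mul _), integral_const_mul,
      integral_const_mul] at e
    have := mul_le_mul_of_nonneg_left hr hM
    linarith

theorem IsKernel.le_pairEnergy (hk : IsKernel k M L C) (h : IsPair γ α) (hα : Integrable α) :
    (r - ∫ p, γ p) * (∫ p, k p * (γ p + α p)) ≤ pairEnergy k r γ α := by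
  unfold pairEnergy
  rw [hk.interaction_eq_pairing h.integrable hα]
  have h1 : 0 ≤ ∫ p, ‖p‖ ^ 2 * γ p :=
    integral_nonneg_of_ae (h.nonneg.mono fun p hp => mul_nonneg (sq_nonneg _) hp)
  have h2 := hk.pairing_self_nonneg h.integrable
  have h3 := hk.pairing_self_nonneg hα
  linarith

theorem IsKernel.le_regEnergy (hk : IsKernel k M L C) (hε : 0 ≤ ε) (h : IsRegularPair r γ α) :
    -(r * (1 / 2 * ∫ p, k p)) ≤ regEnergy k r ε γ α := by
  have h1 := hk.le_pairEnergy (r := r) h.isPair h.right.integrable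
  have h2 := hk.le_pairing_integral h.isPair
  have h3 : 0 ≤ ∫ p, γ p := integral_nonneg_of_ae h.nonneg
  have h4 : 0 ≤ ∫ p, k p := integral_nonneg hk.nonneg
  have h5 := mul_nonneg hε (add_nonneg (sqNorm_nonneg (f := γ)) (sqNorm_nonneg (f := α)))
  have h6 := h.mass_le
  unfold regEnergy
  nlinarith [mul_le_mul_of_nonneg_left h2 (sub_nonneg.mpr h6)]

theorem isRegularPair_zero (hr : 0 ≤ r) : IsRegularPair r (fun _ => 0) (fun _ => 0) :=
  ⟨isRegular_zero, isRegular_zero, by simp, by simp, by simpa⟩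

/-- The distance of two pairs in terms of their energies and of the differences in mass. -/
theorem IsKernel.sqNorm_sub_le (hk : IsKernel k M L C) (h : IsRegularPair r γ α)
    (h' : IsRegularPair r γ' α') {I : ℝ}
    (hI : ∀ g a, IsRegularPair r g a → I ≤ regEnergy k r ε g a) :
    ε * (sqNorm (fun p => γ' p - γ p) + sqNorm (fun p => α' p - α p))
      ≤ 2 * (regEnergy k r ε γ α - I) + 2 * (regEnergy k r ε γ' α' - I)
        + |(∫ p, γ' p) - ∫ p, γ p| * (2 * (2 * M * r + 1 / 2 * ∫ p, k p)) := by
  -- The midpoint is admissible by convexity, so its energy is at least `I`; the excess of the two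
  -- energies then bounds the curvature.
  have hmid := hI _ _ (h.segment h'.left h'.right h'.nonneg h'.sq_le (t := 1 / 2) (by norm_num)
    (by norm_num) (by linarith [h.mass_le, h'.mass_le]))
  rw [hk.regEnergy_midpoint h.left h.right h'.left h'.right] at hmid
  unfold curvature at hmid
  have i1 : Integrable fun p => k p * (γ p + α p) :=
    hk.integrable_mul (h.left.integrable.add h.right.integrable)
  have i2 : Integrable fun p => k p * (γ' p + α' p) :=
    hk.integrable_mul (h'.left.integrable.add h'.right.integrable)
  have e : ∫ p, k p * (γ' p - γ p + (α' p - α p))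
      = (∫ p, k p * (γ' p + α' p)) - ∫ p, k p * (γ p + α p) := by
    rw [← integral_sub i2 i1]; congr 1; funext p; ring
  rw [integral_sub h'.left.integrable h.left.integrable, e] at hmid
  have p1 := hk.pairing_self_nonneg (h'.left.sub h.left).integrable
  have p2 := hk.pairing_self_nonneg (h'.right.sub h.right).integrable
  have b1 := hk.abs_integral_pair_le h.isPair h.mass_le
  have b2 := hk.abs_integral_pair_le h'.isPair h'.mass_le
  set m := (∫ p, γ' p) - ∫ p, γ p
  set l := (∫ p, k p * (γ' p + α' p)) - ∫ p, k p * (γ p + α p) with hl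
  -- The pairings are nonnegative, so this product is the only part of the curvature that can work
  -- against the norm; its second factor is bounded, hence it is small when the masses are close.
  have b3 : m * l ≤ |m| * (2 * (2 * M * r + 1 / 2 * ∫ p, k p)) := by
    refine (le_abs_self _).trans ?_
    rw [abs_mul]
    refine mul_le_mul_of_nonneg_left ?_ (abs_nonneg _)
    have := abs_sub (∫ p, k p * (γ' p + α' p)) (∫ p, k p * (γ p + α p))
    linarith
  linarith

theorem IsRegular.tendsto_weight {gn : ℕ → E3 → ℝ} (h : ∀ n, IsRegular (gn n))
    (h0 : Tendsto (fun n => sqNorm (gn n)) atTop (𝓝 0)) :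
    Tendsto (fun n => ∫ p, (1 + ‖p‖ ^ 2) * |gn n p|) atTop (𝓝 0) := by
  have h1 : Tendsto (fun n => √(sqNorm (gn n) * ∫ p : E3, ((1 + ‖p‖ ^ 2)⁻¹) ^ 2)) atTop
      (𝓝 0) := by
    have := (h0.mul_const (∫ p : E3, ((1 + ‖p‖ ^ 2)⁻¹) ^ 2)).sqrt
    simpa using this
  refine squeeze_zero (fun n => integral_nonneg fun p => by positivity) (fun n => ?_) h1
  exact Real.le_sqrt_of_sq_le (h n).weight_sq_le

/-- The regularized energy is continuous in the weighted `L²`-norm. -/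
theorem IsKernel.tendsto_regEnergy (hk : IsKernel k M L C) (hγ : IsRegular γ) (hα : IsRegular α)
    {γn αn : ℕ → E3 → ℝ} (hγn : ∀ n, IsRegular (γn n)) (hαn : ∀ n, IsRegular (αn n))
    (h1 : Tendsto (fun n => sqNorm fun p => γn n p - γ p) atTop (𝓝 0))
    (h2 : Tendsto (fun n => sqNorm fun p => αn n p - α p) atTop (𝓝 0)) :
    Tendsto (fun n => regEnergy k r ε (γn n) (αn n)) atTop (𝓝 (regEnergy k r ε γ α)) := by
  have hg : ∀ n, IsRegular fun p => γn n p - γ p := fun n => (hγn n).sub hγ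
  have ha : ∀ n, IsRegular fun p => αn n p - α p := fun n => (hαn n).sub hα
  have w1 := IsRegular.tendsto_weight hg h1
  have w2 := IsRegular.tendsto_weight ha h2
  have a1 : Tendsto (fun n => ∫ p, |γn n p - γ p|) atTop (𝓝 0) :=
    squeeze_zero (fun n => integral_nonneg fun p => abs_nonneg _)
      (fun n => (hg n).integral_abs_le) w1
  have a2 : Tendsto (fun n => ∫ p, |αn n p - α p|) atTop (𝓝 0) :=
    squeeze_zero (fun n => integral_nonneg fun p => abs_nonneg _)
      (fun n => (ha n).integral_abs_le) w2
  have kin : Tendsto (fun n => ∫ p, ‖p‖ ^ 2 * (γn n p - γ p)) atTop (𝓝 0) :=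
    squeeze_zero_norm (fun n => (hg n).abs_kin_le) w1
  have mass : Tendsto (fun n => ∫ p, (γn n p - γ p)) atTop (𝓝 0) :=
    squeeze_zero_norm (fun n => abs_integral_le_integral (hg n).integrable.abs
      fun p => le_rfl) a1
  have ell : Tendsto (fun n => ∫ p, k p * (γn n p - γ p + (αn n p - α p))) atTop (𝓝 0) := by
    have h3 := (a1.add a2).const_mul M
    rw [add_zero, mul_zero] at h3
    refine squeeze_zero_norm (fun n => ?_) h3
    rw [← integral_add (hg n).integrable.abs (ha n).integrable.abs, ← integral_const_mul]
    refine abs_integral_le_integral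
      (((hg n).integrable.abs.add (ha n).integrable.abs).const_mul M) fun p => ?_
    rw [abs_mul]
    exact mul_le_mul (hk.abs_le p) (abs_add_le _ _) (abs_nonneg _) hk.bound_nonneg
  have pr : ∀ {f : E3 → ℝ} {gn : ℕ → E3 → ℝ}, Integrable f → (∀ n, Integrable (gn n)) →
      Tendsto (fun n => ∫ p, |gn n p|) atTop (𝓝 0) →
      Tendsto (fun n => pairing k (gn n) f) atTop (𝓝 0) := fun {f gn} i1 i2 h3 => by
    have h4 := (h3.const_mul M).mul_const (∫ p, |f p|)
    rw [mul_zero, zero_mul] at h4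
    exact squeeze_zero_norm (fun n => hk.abs_pairing_le (i2 n) i1) h4
  have pr2 : ∀ {gn : ℕ → E3 → ℝ}, (∀ n, Integrable (gn n)) →
      Tendsto (fun n => ∫ p, |gn n p|) atTop (𝓝 0) →
      Tendsto (fun n => pairing k (gn n) (gn n)) atTop (𝓝 0) := fun {gn} i2 h3 => by
    have h4 := (h3.const_mul M).mul h3
    rw [mul_zero] at h4
    exact squeeze_zero_norm (fun n => hk.abs_pairing_le (i2 n) (i2 n)) h4
  have inn : ∀ {f : E3 → ℝ} {gn : ℕ → E3 → ℝ}, IsRegular f → (∀ n, IsRegular (gn n)) →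
      Tendsto (fun n => sqNorm (gn n)) atTop (𝓝 0) →
      Tendsto (fun n => ∫ p, wt p ^ 2 * (f p * gn n p)) atTop (𝓝 0) := fun {f gn} i1 i2 h3 => by
    have h4 := (h3.const_mul (sqNorm f)).sqrt
    rw [mul_zero, Real.sqrt_zero] at h4
    exact squeeze_zero_norm (fun n => Real.abs_le_sqrt (i1.inner_sq_le (i2 n))) h4
  have hs : Tendsto (fun n => slope k r ε γ α (fun p => γn n p - γ p) (fun p => αn n p - α p))
      atTop (𝓝 0) := by
    unfold slope
    have := ((((kin.sub (mass.mul_const (∫ p, k p * (γ p + α p)))).add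
      (ell.const_mul (r - ∫ p, γ p))).add
      (pr hγ.integrable (fun n => (hg n).integrable) a1)).add
      (pr hα.integrable (fun n => (ha n).integrable) a2)).add
      (((inn hγ hg h1).add (inn hα ha h2)).const_mul (2 * ε))
    simpa only [zero_mul, mul_zero, sub_zero, add_zero] using this
  have hc : Tendsto (fun n => curvature k ε (fun p => γn n p - γ p) (fun p => αn n p - α p))
      atTop (𝓝 0) := by
    unfold curvature
    have := ((mass.neg.mul ell).add
      (((pr2 (fun n => (hg n).integrable) a1).add
        (pr2 (fun n => (ha n).integrable) a2)).const_mul (1 / 2))).add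
      ((h1.add h2).const_mul ε)
    simpa only [neg_zero, mul_zero, add_zero] using this
  have := (hs.const_add (regEnergy k r ε γ α)).add hc
  rw [add_zero, add_zero] at this
  exact this.congr fun n => (hk.regEnergy_add hγ hα (hγn n) (hαn n)).symm

theorem sqNorm_sub_eq (f g : E3 → ℝ) :
    sqNorm (fun p => f p - g p) = ∫ p, (wt p * f p - wt p * g p) ^ 2 := by
  unfold sqNorm; congr 1; funext p; ring

/-- Completeness of the weighted `L²`-space, for sequences of functions. -/
theorem IsRegular.exists_limit {f : ℕ → E3 → ℝ} (hf : ∀ n, IsRegular (f n)) {c : ℕ → ℝ}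
    (hc : Tendsto c atTop (𝓝 0)) (h : ∀ n m, sqNorm (fun p => f n p - f m p) ≤ c n + c m) :
    ∃ g, IsRegular g ∧ Tendsto (fun n => sqNorm fun p => f n p - g p) atTop (𝓝 0) ∧
      ∃ φ : ℕ → ℕ, StrictMono φ ∧ ∀ᵐ p, Tendsto (fun n => f (φ n) p) atTop (𝓝 (g p)) := by
  simp_rw [sqNorm_sub_eq] at h
  obtain ⟨g, hg, h1, φ, hφ, h2⟩ := exists_L2_limit hf hc h
  have e : ∀ p, wt p * ((wt p)⁻¹ * g p) = g p := fun p =>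
    mul_inv_cancel_left₀ (wt_pos p).ne' _
  refine ⟨fun p => (wt p)⁻¹ * g p, ?_, ?_, φ, hφ, ?_⟩
  · unfold IsRegular; simpa only [e] using hg
  · simpa only [sqNorm_sub_eq, e] using h1
  · filter_upwards [h2] with p hp
    refine (hp.const_mul (wt p)⁻¹).congr fun n => ?_
    exact inv_mul_cancel_left₀ (wt_pos p).ne' _

/-- Existence of minimizers for the regularized problem. -/
theorem IsKernel.exists_regularized_minimizer (hk : IsKernel k M L C) (hε : 0 < ε) (hr : 0 ≤ r) :
    ∃ γ α, IsRegularPair r γ α ∧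
      ∀ g a, IsRegularPair r g a → regEnergy k r ε γ α ≤ regEnergy k r ε g a := by
  set S : Set ℝ := {x | ∃ g a, IsRegularPair r g a ∧ regEnergy k r ε g a = x} with hS
  have hne : S.Nonempty := ⟨_, _, _, isRegularPair_zero hr, rfl⟩
  have hbd : BddBelow S := ⟨-(r * (1 / 2 * ∫ p, k p)), by
    rintro x ⟨g, a, hga, rfl⟩
    exact hk.le_regEnergy hε.le hga⟩
  have hI : ∀ g a, IsRegularPair r g a → sInf S ≤ regEnergy k r ε g a :=
    fun g a h => csInf_le hbd ⟨g, a, h, rfl⟩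
  obtain ⟨u, -, hu, huS⟩ := exists_seq_tendsto_sInf hne hbd
  choose γ₀ α₀ hp₀ he₀ using huS
  -- Along a subsequence the masses converge, which removes the only obstruction to a Cauchy
  -- estimate.
  obtain ⟨m, -, φ, hφ, hm⟩ := (isCompact_Icc (a := (0 : ℝ)) (b := r)).tendsto_subseq
    (x := fun n => ∫ p, γ₀ n p)
    fun n => ⟨integral_nonneg_of_ae (hp₀ n).nonneg, (hp₀ n).mass_le⟩
  set Λ := 2 * (2 * M * r + 1 / 2 * ∫ p, k p) with hΛ
  have hΛ0 : 0 ≤ Λ := by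
    have := mul_nonneg hk.bound_nonneg hr
    have : 0 ≤ ∫ p, k p := integral_nonneg hk.nonneg
    rw [hΛ]; linarith
  -- `c n` collects the energy excess and the distance of the mass from its limit, scaled so that
  -- `sqNorm_sub_le` becomes the estimate `c n + c l` asked for by `IsRegular.exists_limit`.
  set c : ℕ → ℝ := fun n => ε⁻¹ * (2 * (u (φ n) - sInf S) + |(∫ p, γ₀ (φ n) p) - m| * Λ) with hc
  have hc0 : Tendsto c atTop (𝓝 0) := by
    have h1 : Tendsto (fun n => u (φ n) - sInf S) atTop (𝓝 0) := by
      simpa using (hu.comp hφ.tendsto_atTop).sub_const (sInf S)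
    have h2 : Tendsto (fun n => |(∫ p, γ₀ (φ n) p) - m|) atTop (𝓝 0) := by
      simpa using (hm.sub_const m).abs
    simpa using ((h1.const_mul 2).add (h2.mul_const Λ)).const_mul ε⁻¹
  have hD : ∀ n l, sqNorm (fun p => γ₀ (φ n) p - γ₀ (φ l) p)
      + sqNorm (fun p => α₀ (φ n) p - α₀ (φ l) p) ≤ c n + c l := fun n l => by
    have h1 := hk.sqNorm_sub_le (hp₀ (φ l)) (hp₀ (φ n)) hI
    rw [he₀, he₀, ← hΛ] at h1
    have h2 : |(∫ p, γ₀ (φ n) p) - ∫ p, γ₀ (φ l) p| * Λ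
        ≤ (|(∫ p, γ₀ (φ n) p) - m| + |(∫ p, γ₀ (φ l) p) - m|) * Λ := by
      refine mul_le_mul_of_nonneg_right ?_ hΛ0
      rw [abs_sub_comm (∫ p, γ₀ (φ l) p) m]
      exact abs_sub_le _ _ _
    have h3 : c n + c l = ε⁻¹ * (2 * (u (φ n) - sInf S) + 2 * (u (φ l) - sInf S)
        + (|(∫ p, γ₀ (φ n) p) - m| + |(∫ p, γ₀ (φ l) p) - m|) * Λ) := by simp only [hc]; ring
    rw [h3, le_inv_mul_iff₀ hε]
    linarith
  obtain ⟨γ, hγ, hγlim, ψ, hψ, hγae⟩ := IsRegular.exists_limit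
    (fun n => (hp₀ (φ n)).left) hc0
    fun n l => by linarith [hD n l, sqNorm_nonneg (f := fun p => α₀ (φ n) p - α₀ (φ l) p)]
  obtain ⟨α, hα, hαlim, χ, hχ, hαae⟩ := IsRegular.exists_limit
    (fun n => (hp₀ (φ (ψ n))).right) (hc0.comp hψ.tendsto_atTop)
    fun n l => by
      have := hD (ψ n) (ψ l)
      simp only [Function.comp]
      linarith [sqNorm_nonneg (f := fun p => γ₀ (φ (ψ n)) p - γ₀ (φ (ψ l)) p)]
  have hγlim' := hγlim.comp (hψ.comp hχ).tendsto_atTop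
  have hαlim' := hαlim.comp hχ.tendsto_atTop
  have hE := hk.tendsto_regEnergy (r := r) (ε := ε) hγ hα
    (fun n => (hp₀ (φ (ψ (χ n)))).left) (fun n => (hp₀ (φ (ψ (χ n)))).right) hγlim' hαlim'
  have hmass : Tendsto (fun n => ∫ p, (γ₀ (φ (ψ (χ n))) p - γ p)) atTop (𝓝 0) := by
    have hreg : ∀ n, IsRegular fun p => γ₀ (φ (ψ (χ n))) p - γ p :=
      fun n => (hp₀ _).left.sub hγ
    refine squeeze_zero_norm (fun n => ?_) (IsRegular.tendsto_weight hreg hγlim')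
    exact (abs_integral_le_integral (hreg n).integrable.abs fun p => le_rfl).trans
      (hreg n).integral_abs_le
  have hae1 := ae_all_iff.mpr fun n => (hp₀ n).nonneg
  have hae2 := ae_all_iff.mpr fun n => (hp₀ n).sq_le
  refine ⟨γ, α, ⟨hγ, hα, ?_, ?_, ?_⟩, fun g a hga => ?_⟩
  · filter_upwards [hγae, hae1] with p h1 h2
    exact ge_of_tendsto' h1 fun n => h2 _
  · filter_upwards [hγae, hαae, hae2] with p h1 h3 h2
    have h1' := h1.comp hχ.tendsto_atTop
    exact le_of_tendsto_of_tendsto' (h3.pow 2) (h1'.mul (h1'.const_add 1)) fun n => h2 _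
  · have h1 : Tendsto (fun n => ∫ p, γ₀ (φ (ψ (χ n))) p) atTop (𝓝 (∫ p, γ p)) := by
      have := hmass.add_const (∫ p, γ p)
      rw [zero_add] at this
      refine this.congr fun n => ?_
      rw [integral_sub (hp₀ _).left.integrable hγ.integrable]; ring
    exact le_of_tendsto' h1 fun n => (hp₀ _).mass_le
  · have h1 : Tendsto (fun n => regEnergy k r ε (γ₀ (φ (ψ (χ n)))) (α₀ (φ (ψ (χ n))))) atTop
        (𝓝 (sInf S)) :=
      (hu.comp (hφ.comp (hψ.comp hχ)).tendsto_atTop).congr fun n => (he₀ _).symm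
    rw [tendsto_nhds_unique hE h1]
    exact hI g a hga

end Regularized

/-! ### Euler equations and symmetry of the regularized minimizers -/

/-- The coefficient of `γ` in the linearization of the energy. -/
def fieldA (k : E3 → ℝ) (r : ℝ) (γ α : E3 → ℝ) (p : E3) : ℝ :=
  ‖p‖ ^ 2 - (∫ q, k q * (γ q + α q)) + (r - ∫ q, γ q) * k p + conv k γ p

/-- The coefficient of `α` in the linearization of the energy. -/
def fieldB (k : E3 → ℝ) (r : ℝ) (γ α : E3 → ℝ) (p : E3) : ℝ :=
  (r - ∫ q, γ q) * k p + conv k α p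

/-- Solution of the pointwise linear minimization problem. -/
theorem euler_of_forall_le {A B g a : ℝ} (hA : 0 < A) (hg : 0 ≤ g) (ha : a ^ 2 ≤ g * (1 + g))
    (h : ∀ y : ℝ, 0 ≤ A * ((√(1 + y ^ 2) - 1) / 2 - g) + B * (y / 2 - a)) :
    a ^ 2 = g * (1 + g) ∧ 2 * a * A = -(B * (2 * g + 1)) := by
  have hs : ∀ y : ℝ, 0 < √(1 + y ^ 2) := fun y => Real.sqrt_pos.mpr (by positivity)
  -- The points `((√(1 + y²) - 1)/2, y/2)` parametrize the boundary curve `a² = g(1 + g)`. At `y =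
  -- 2a` the `B` term drops out, which leaves `g` no larger than its boundary value.
  have h1 : 2 * g + 1 ≤ √(1 + (2 * a) ^ 2) := by
    have := h (2 * a)
    rw [mul_div_cancel_left₀ a two_ne_zero, sub_self, mul_zero, add_zero] at this
    have := nonneg_of_mul_nonneg_right this hA
    linarith
  have h2 : √(1 + (2 * a) ^ 2) ≤ 2 * g + 1 := by
    refine Real.sqrt_le_iff.mpr ⟨by linarith, by nlinarith⟩
  have h3 : √(1 + (2 * a) ^ 2) = 2 * g + 1 := le_antisymm h2 h1
  have h4 : (2 * g + 1) ^ 2 = 1 + (2 * a) ^ 2 := by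
    rw [← h3, Real.sq_sqrt (by positivity)]
  refine ⟨by linarith, ?_⟩
  have hd : HasDerivAt (fun y : ℝ => A * ((√(1 + y ^ 2) - 1) / 2 - g) + B * (y / 2 - a))
      (A * ((2 * (2 * a)) / (2 * √(1 + (2 * a) ^ 2)) / 2) + B * (1 / 2)) (2 * a) := by
    have e1 : HasDerivAt (fun y : ℝ => 1 + y ^ 2) (2 * (2 * a)) (2 * a) := by
      simpa using (hasDerivAt_pow 2 (2 * a)).const_add 1
    have e2 := e1.sqrt (by positivity)
    exact ((((e2.sub_const 1).div_const 2).sub_const g).const_mul A).add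
      ((((hasDerivAt_id (2 * a)).div_const 2).sub_const a).const_mul B)
  -- As `(g, a)` lies on the curve, the function vanishes at `y = 2a` and is nonnegative everywhere,
  -- so its derivative there is zero; that is the Euler equation.
  have hmin : IsLocalMin (fun y : ℝ => A * ((√(1 + y ^ 2) - 1) / 2 - g) + B * (y / 2 - a))
      (2 * a) := by
    refine Eventually.of_forall fun y => ?_
    dsimp only
    rw [h3]
    have := h y
    ring_nf at this ⊢
    linarith
  have h5 := hmin.hasDerivAt_eq_zero hd
  rw [h3] at h5
  have h6 : (2 * g + 1) ≠ 0 := by positivity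
  field_simp at h5
  linarith

theorem integral_comp_isometry (R : E3 ≃ₗᵢ[ℝ] E3) (f : E3 → ℝ) : ∫ p, f (R p) = ∫ p, f p :=
  R.measurePreserving.integral_comp R.toHomeomorph.measurableEmbedding f

section Stationary

variable {k : E3 → ℝ} {M L C r ε : ℝ} {γ α g a : E3 → ℝ}

theorem IsRegular.comp_isometry (h : IsRegular g) (R : E3 ≃ₗᵢ[ℝ] E3) :
    IsRegular fun p => g (R p) := by
  have := h.comp_measurePreserving R.measurePreserving
  refine this.ae_eq (Eventually.of_forall fun p => ?_)
  simp [wt]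

theorem IsRegularPair.comp_isometry (h : IsRegularPair r γ α) (R : E3 ≃ₗᵢ[ℝ] E3) :
    IsRegularPair r (fun p => γ (R p)) (fun p => α (R p)) where
  left := h.left.comp_isometry R
  right := h.right.comp_isometry R
  nonneg := R.measurePreserving.quasiMeasurePreserving.ae h.nonneg
  sq_le := R.measurePreserving.quasiMeasurePreserving.ae h.sq_le
  mass_le := by rw [integral_comp_isometry R γ]; exact h.mass_le

theorem IsKernel.regEnergy_comp_isometry (hk : IsKernel k M L C) (R : E3 ≃ₗᵢ[ℝ] E3) :
    regEnergy k r ε (fun p => γ (R p)) (fun p => α (R p)) = regEnergy k r ε γ α := by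
  have hkR : ∀ p, k p = k (R p) := fun p => hk.radial _ _ (R.norm_map p).symm
  have e1 := integral_comp_isometry R fun p => ‖p‖ ^ 2 * γ p
  have e2 := integral_comp_isometry R γ
  have e3 := integral_comp_isometry R fun p => k p * (γ p + α p)
  have e4 := integral_comp_isometry R fun p => (wt p * γ p) ^ 2
  have e5 := integral_comp_isometry R fun p => (wt p * α p) ^ 2
  have e6 : interaction k (fun p => γ (R p)) (fun p => α (R p)) = interaction k γ α := by
    have := integral_comp_isometry R fun p => ∫ q, k (p - q) * (α p * α q + γ p * γ q)
    unfold interaction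
    rw [← this]
    congr 1; funext p
    rw [← integral_comp_isometry R fun q => k (R p - q) * (α (R p) * α q + γ (R p) * γ q)]
    congr 1; funext q
    rw [hkR (p - q), map_sub]
  have hw : ∀ p, wt (R p) = wt p := fun p => by simp [wt]
  simp only [LinearIsometryEquiv.norm_map, ← hkR, hw] at e1 e3 e4 e5
  unfold regEnergy pairEnergy sqNorm
  rw [e1, e2, e3, e4, e5, e6]

theorem ae_eq_of_sqNorm_sub_eq_zero (hf : IsRegular γ) (hg : IsRegular α)
    (h : sqNorm (fun p => γ p - α p) = 0) : γ =ᵐ[volume] α := by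
  have hi : Integrable fun p => (wt p * (γ p - α p)) ^ 2 := MemLp.integrable_sq (hf.sub hg)
  have := (integral_eq_zero_iff_of_nonneg (fun p => sq_nonneg _) hi).mp h
  filter_upwards [this] with p hp
  have h1 : wt p * (γ p - α p) = 0 := pow_eq_zero_iff two_ne_zero |>.mp hp
  exact sub_eq_zero.mp ((mul_eq_zero.mp h1).resolve_left (wt_pos p).ne')

/-- The rotated pair is a minimizer of the same mass, so both the energy excess and the mass term in
`sqNorm_sub_le` vanish. -/
theorem IsKernel.minimizer_comp_isometry (hk : IsKernel k M L C) (hε : 0 < ε)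
    (h : IsRegularPair r γ α)
    (hmin : ∀ g a, IsRegularPair r g a → regEnergy k r ε γ α ≤ regEnergy k r ε g a)
    (R : E3 ≃ₗᵢ[ℝ] E3) :
    (fun p => γ (R p)) =ᵐ[volume] γ ∧ (fun p => α (R p)) =ᵐ[volume] α := by
  have h' := h.comp_isometry R
  have h1 := hk.sqNorm_sub_le h h' hmin
  rw [hk.regEnergy_comp_isometry R, integral_comp_isometry R γ] at h1
  simp only [sub_self, mul_zero, abs_zero, zero_mul, add_zero] at h1
  have h2 := nonpos_of_mul_nonpos_right h1 hε
  have h3 := sqNorm_nonneg (f := fun p => γ (R p) - γ p)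
  have h4 := sqNorm_nonneg (f := fun p => α (R p) - α p)
  exact ⟨ae_eq_of_sqNorm_sub_eq_zero h'.left h.left (by linarith),
    ae_eq_of_sqNorm_sub_eq_zero h'.right h.right (by linarith)⟩

theorem IsKernel.integrable_fieldA_mul (hk : IsKernel k M L C) (hγ : IsRegular γ)
    (hg : IsRegular g) :
    Integrable fun p => (fieldA k r γ α p + 2 * ε * wt p ^ 2 * γ p) * g p := by
  have i1 := hg.integrable_kin.sub (hg.integrable.const_mul (∫ q, k q * (γ q + α q)))
  have i2 := i1.add ((hk.integrable_mul hg.integrable).const_mul (r - ∫ q, γ q))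
  have i3 := i2.add (hk.integrable_mul_conv hg.integrable hγ.integrable)
  refine (i3.add ((hγ.integrable_wt_mul hg).const_mul (2 * ε))).congr
    (Eventually.of_forall fun p => ?_)
  simp only [Pi.add_apply, Pi.sub_apply, fieldA]; ring

theorem IsKernel.integrable_fieldB_mul (hk : IsKernel k M L C) (hα : IsRegular α)
    (ha : IsRegular a) :
    Integrable fun p => (fieldB k r γ α p + 2 * ε * wt p ^ 2 * α p) * a p := by
  have i2 := (hk.integrable_mul ha.integrable).const_mul (r - ∫ q, γ q)
  have i3 := i2.add (hk.integrable_mul_conv ha.integrable hα.integrable)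
  refine (i3.add ((hα.integrable_wt_mul ha).const_mul (2 * ε))).congr
    (Eventually.of_forall fun p => ?_)
  simp only [Pi.add_apply, fieldB]; ring

theorem IsKernel.slope_eq (hk : IsKernel k M L C) (hγ : IsRegular γ) (hα : IsRegular α)
    (hg : IsRegular g) (ha : IsRegular a) :
    slope k r ε γ α g a = ∫ p, ((fieldA k r γ α p + 2 * ε * wt p ^ 2 * γ p) * g p
      + (fieldB k r γ α p + 2 * ε * wt p ^ 2 * α p) * a p) := by
  have i1 := (hg.integrable.const_mul (∫ q, k q * (γ q + α q)))
  have i2 := (hk.integrable_mul hg.integrable).const_mul (r - ∫ q, γ q)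
  have i3 := hk.integrable_mul_conv hg.integrable hγ.integrable
  have i4 := (hγ.integrable_wt_mul hg).const_mul (2 * ε)
  have i5 := (hk.integrable_mul ha.integrable).const_mul (r - ∫ q, γ q)
  have i6 := hk.integrable_mul_conv ha.integrable hα.integrable
  have i7 := (hα.integrable_wt_mul ha).const_mul (2 * ε)
  have e1 : ∫ p, (fieldA k r γ α p + 2 * ε * wt p ^ 2 * γ p) * g p
      = (∫ p, ‖p‖ ^ 2 * g p) - (∫ q, k q * (γ q + α q)) * (∫ p, g p)
        + (r - ∫ q, γ q) * (∫ p, k p * g p) + pairing k g γ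
        + 2 * ε * ∫ p, wt p ^ 2 * (γ p * g p) := by
    unfold pairing
    rw [← integral_const_mul, ← integral_const_mul, ← integral_const_mul,
      ← integral_sub hg.integrable_kin i1, ← integral_add (by exact hg.integrable_kin.sub i1) i2,
      ← integral_add (by exact (hg.integrable_kin.sub i1).add i2) i3,
      ← integral_add (by exact ((hg.integrable_kin.sub i1).add i2).add i3) i4]
    congr 1; funext p; simp only [fieldA]; ring
  have e2 : ∫ p, (fieldB k r γ α p + 2 * ε * wt p ^ 2 * α p) * a p
      = (r - ∫ q, γ q) * (∫ p, k p * a p) + pairing k a α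
        + 2 * ε * ∫ p, wt p ^ 2 * (α p * a p) := by
    unfold pairing
    rw [← integral_const_mul, ← integral_const_mul, ← integral_add i5 i6,
      ← integral_add (by exact i5.add i6) i7]
    congr 1; funext p; simp only [fieldB]; ring
  have e3 : ∫ p, k p * (g p + a p) = (∫ p, k p * g p) + ∫ p, k p * a p := by
    rw [← integral_add (hk.integrable_mul hg.integrable) (hk.integrable_mul ha.integrable)]
    congr 1; funext p; ring
  rw [integral_add (hk.integrable_fieldA_mul hγ hg) (hk.integrable_fieldB_mul hα ha), e1, e2]
  unfold slope
  rw [e3]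
  ring

/-- The mass constraint is not active, so any competitor, whatever its mass, may be approached by a
short segment; the first-order term then dominates as `t → 0`. -/
theorem IsKernel.slope_nonneg (hk : IsKernel k M L C) (h : IsRegularPair r γ α)
    (hmin : ∀ g a, IsRegularPair r g a → regEnergy k r ε γ α ≤ regEnergy k r ε g a)
    (hm : ∫ p, γ p < r) (hg : IsRegular g) (ha : IsRegular a) (h0 : ∀ᵐ p, 0 ≤ g p)
    (h1 : ∀ᵐ p, a p ^ 2 ≤ g p * (1 + g p)) :
    0 ≤ slope k r ε γ α (fun p => g p - γ p) (fun p => a p - α p) := by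
  set s := slope k r ε γ α (fun p => g p - γ p) (fun p => a p - α p) with hs
  set c := curvature k ε (fun p => g p - γ p) (fun p => a p - α p) with hc
  have hlim : Tendsto (fun t : ℝ => s + t * c) (𝓝[>] 0) (𝓝 (s + 0 * c)) :=
    (Continuous.tendsto (by fun_prop) 0).mono_left nhdsWithin_le_nhds
  rw [zero_mul, add_zero] at hlim
  refine ge_of_tendsto hlim ?_
  have hm' : Tendsto (fun t : ℝ => (∫ p, γ p) + t * ((∫ p, g p) - ∫ p, γ p)) (𝓝[>] 0)
      (𝓝 ((∫ p, γ p) + 0 * ((∫ p, g p) - ∫ p, γ p))) :=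
    (Continuous.tendsto (by fun_prop) 0).mono_left nhdsWithin_le_nhds
  rw [zero_mul, add_zero] at hm'
  filter_upwards [self_mem_nhdsWithin, hm'.eventually_lt_const hm,
    nhdsWithin_le_nhds (eventually_lt_nhds one_pos)] with t ht htm ht1
  rw [Set.mem_Ioi] at ht
  have h2 := hmin _ _ (h.segment hg ha h0 h1 ht.le ht1.le htm.le)
  rw [hk.regEnergy_add_smul h.left h.right (hg.sub h.left) (ha.sub h.right), ← hs, ← hc] at h2
  have h3 : 0 ≤ t * (s + t * c) := by nlinarith
  exact nonneg_of_mul_nonneg_right h3 ht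

theorem isRegular_indicator_const {S : Set E3} (hS : MeasurableSet S) {n : ℝ}
    (hn : S ⊆ Metric.closedBall 0 n) (c : ℝ) : IsRegular (S.indicator fun _ => c) := by
  unfold IsRegular
  have e : (fun p => wt p * S.indicator (fun _ => c) p) = S.indicator fun p => wt p * c := by
    funext p; by_cases hp : p ∈ S <;> simp [hp]
  rw [e, memLp_indicator_iff_restrict hS]
  have : IsFiniteMeasure (volume.restrict S) := ⟨by
    rw [Measure.restrict_apply_univ]
    exact (measure_mono hn).trans_lt measure_closedBall_lt_top⟩
  refine MemLp.of_bound (by have := continuous_wt; fun_prop) ((1 + n ^ 2) ^ 2 * |c|) ?_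
  filter_upwards [ae_restrict_mem hS] with p hp
  have h1 : ‖p‖ ≤ n := mem_closedBall_zero_iff.mp (hn hp)
  rw [norm_mul, Real.norm_eq_abs, Real.norm_eq_abs, abs_of_pos (wt_pos p)]
  unfold wt
  gcongr

theorem IsRegular.indicator (hg : IsRegular g) {S : Set E3} (hS : MeasurableSet S) :
    IsRegular (S.indicator g) := by
  refine (MemLp.indicator hS hg).ae_eq (Eventually.of_forall fun p => ?_)
  by_cases hp : p ∈ S <;> simp [hp]

/-- The pointwise first-order condition, against a constant competitor. -/
theorem IsKernel.ae_linear_nonneg (hk : IsKernel k M L C) (h : IsRegularPair r γ α)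
    (hmin : ∀ g a, IsRegularPair r g a → regEnergy k r ε γ α ≤ regEnergy k r ε g a)
    (hm : ∫ p, γ p < r) {x y : ℝ} (hx : 0 ≤ x) (hxy : y ^ 2 ≤ x * (1 + x)) :
    ∀ᵐ p, 0 ≤ (fieldA k r γ α p + 2 * ε * wt p ^ 2 * γ p) * (x - γ p)
      + (fieldB k r γ α p + 2 * ε * wt p ^ 2 * α p) * (y - α p) := by
  set φ : E3 → ℝ := fun p => (fieldA k r γ α p + 2 * ε * wt p ^ 2 * γ p) * (x - γ p)
      + (fieldB k r γ α p + 2 * ε * wt p ^ 2 * α p) * (y - α p) with hφ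
  have key : ∀ (n : ℕ) (S : Set E3), MeasurableSet S → S ⊆ Metric.closedBall 0 n →
      Integrable (S.indicator φ) ∧ 0 ≤ ∫ p, S.indicator φ p := by
    intro n S hS hSn
    -- The competitor is the constant pair `(x, y)` on `S` and the minimizer itself elsewhere, so
    -- that the slope localizes to `S`.
    have r1 := (isRegular_indicator_const hS hSn x).add (h.left.indicator hS.compl)
    have r2 := (isRegular_indicator_const hS hSn y).add (h.right.indicator hS.compl)
    have e : S.indicator φ = fun p => (fieldA k r γ α p + 2 * ε * wt p ^ 2 * γ p)
          * (S.indicator (fun _ => x) p + Sᶜ.indicator γ p - γ p)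
        + (fieldB k r γ α p + 2 * ε * wt p ^ 2 * α p)
          * (S.indicator (fun _ => y) p + Sᶜ.indicator α p - α p) := by
      funext p; by_cases hp : p ∈ S <;> simp [hp, hφ]
    refine ⟨?_, ?_⟩
    · rw [e]
      exact (hk.integrable_fieldA_mul h.left (r1.sub h.left)).add
        (hk.integrable_fieldB_mul h.right (r2.sub h.right))
    · rw [e, ← hk.slope_eq h.left h.right (r1.sub h.left) (r2.sub h.right)]
      refine hk.slope_nonneg h hmin hm r1 r2 ?_ ?_
      · filter_upwards [h.nonneg] with p hp
        by_cases hpS : p ∈ S <;> simp [hpS, hx, hp]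
      · filter_upwards [h.sq_le] with p hp
        by_cases hpS : p ∈ S <;> simp [hpS, hxy, hp]
  have hball : ∀ n : ℕ, ∀ᵐ p ∂volume.restrict (Metric.closedBall (0 : E3) n), 0 ≤ φ p := by
    intro n
    have hB : MeasurableSet (Metric.closedBall (0 : E3) n) := Metric.isClosed_closedBall.measurableSet
    refine ae_nonneg_of_forall_setIntegral_nonneg
      ((integrable_indicator_iff hB).mp (key n _ hB subset_rfl).1) fun S hS _ => ?_
    rw [Measure.restrict_restrict hS, ← integral_indicator (hS.inter hB)]
    exact (key n _ (hS.inter hB) Set.inter_subset_right).2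
  have hall := ae_all_iff.mpr fun n =>
    (ae_restrict_iff' (Metric.isClosed_closedBall.measurableSet)).mp (hball n)
  filter_upwards [hall] with p hp
  obtain ⟨n, hn⟩ := exists_nat_ge ‖p‖
  exact hp n (mem_closedBall_zero_iff.mpr hn)

/-- The properties of the minimizers of the regularized problem that persist in the limit. -/
structure IsStationary (k : E3 → ℝ) (r ε δ : ℝ) (γ α : E3 → ℝ) : Prop where
  pair : IsRegularPair r γ α
  inv_left : ∀ R : E3 ≃ₗᵢ[ℝ] E3, (fun p => γ (R p)) =ᵐ[volume] γ
  inv_right : ∀ R : E3 ≃ₗᵢ[ℝ] E3, (fun p => α (R p)) =ᵐ[volume] α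
  ell_le : ∫ p, k p * (γ p + α p) ≤ -δ
  sq_eq : ∀ᵐ p, α p ^ 2 = γ p * (1 + γ p)
  euler : ∀ᵐ p, 2 * α p * (fieldA k r γ α p + 2 * ε * wt p ^ 2 * γ p)
    = -((fieldB k r γ α p + 2 * ε * wt p ^ 2 * α p) * (2 * γ p + 1))

theorem IsKernel.le_fieldA (hk : IsKernel k M L C) (h0 : ∀ᵐ p, 0 ≤ γ p) (hm : ∫ p, γ p ≤ r)
    {δ : ℝ} (hδ : ∫ p, k p * (γ p + α p) ≤ -δ) (p : E3) : ‖p‖ ^ 2 + δ ≤ fieldA k r γ α p := by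
  have h1 := hk.conv_nonneg h0 p
  have h2 := mul_nonneg (sub_nonneg.mpr hm) (hk.nonneg p)
  unfold fieldA
  linarith

/-- All terms except the condensate product are nonnegative, so a negative energy makes `(r - ∫ γ)ℓ
≤ -η`. Thus the mass constraint is not active and `ℓ ≤ -η/r`; the latter makes `fieldA` positive, as
is needed to solve the pointwise minimization. -/
theorem IsKernel.isStationary_of_minimizer (hk : IsKernel k M L C) (hε : 0 < ε) (hr : 0 < r)
    (h : IsRegularPair r γ α)
    (hmin : ∀ g a, IsRegularPair r g a → regEnergy k r ε γ α ≤ regEnergy k r ε g a)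
    {η : ℝ} (hη : 0 < η) (hneg : regEnergy k r ε γ α ≤ -η) :
    IsStationary k r ε (η / r) γ α := by
  have h1 := hk.le_pairEnergy (r := r) h.isPair h.right.integrable
  have h2 := mul_nonneg hε.le (add_nonneg (sqNorm_nonneg (f := γ)) (sqNorm_nonneg (f := α)))
  have h3 : (r - ∫ p, γ p) * (∫ p, k p * (γ p + α p)) ≤ -η := by
    unfold regEnergy at hneg; linarith
  have h4 : 0 ≤ ∫ p, γ p := integral_nonneg_of_ae h.nonneg
  have h5 : 0 < r - ∫ p, γ p := by
    refine lt_of_le_of_ne (sub_nonneg.mpr h.mass_le) fun h0 => ?_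
    rw [← h0, zero_mul] at h3
    linarith
  have hell : ∫ p, k p * (γ p + α p) ≤ -(η / r) := by
    have h6 : ∫ p, k p * (γ p + α p) ≤ 0 := by
      by_contra! hc
      nlinarith [mul_pos h5 hc]
    rw [← neg_div, le_div_iff₀ hr]
    nlinarith
  have hpos : ∀ p, 0 < fieldA k r γ α p := fun p =>
    lt_of_lt_of_le (by positivity) (hk.le_fieldA h.nonneg h.mass_le hell p)
  -- Rational parameters give one common null set; continuity in `y` then covers all real
  -- parameters.
  have hlin := ae_all_iff.mpr fun y : ℚ =>
    hk.ae_linear_nonneg h hmin (sub_pos.mp h5) (x := (√(1 + (y : ℝ) ^ 2) - 1) / 2)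
      (y := (y : ℝ) / 2)
      (by
        have : 1 ≤ √(1 + (y : ℝ) ^ 2) := Real.one_le_sqrt.mpr (by nlinarith [sq_nonneg (y : ℝ)])
        linarith)
      (by nlinarith [Real.sq_sqrt (show 0 ≤ 1 + (y : ℝ) ^ 2 by positivity)])
  have hpt : ∀ᵐ p, α p ^ 2 = γ p * (1 + γ p) ∧
      2 * α p * (fieldA k r γ α p + 2 * ε * wt p ^ 2 * γ p)
        = -((fieldB k r γ α p + 2 * ε * wt p ^ 2 * α p) * (2 * γ p + 1)) := by
    filter_upwards [hlin, h.nonneg, h.sq_le] with p q1 q2 q3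
    refine euler_of_forall_le ?_ q2 q3 fun y => ?_
    · have := hpos p
      have := wt_pos p
      positivity
    · have hcl : IsClosed {y : ℝ | 0 ≤ (fieldA k r γ α p + 2 * ε * wt p ^ 2 * γ p)
          * ((√(1 + y ^ 2) - 1) / 2 - γ p)
          + (fieldB k r γ α p + 2 * ε * wt p ^ 2 * α p) * (y / 2 - α p)} :=
        isClosed_le continuous_const (by fun_prop)
      exact isClosed_property Rat.isDenseEmbedding_coe_real.dense hcl q1 y
  exact ⟨h, fun R => (hk.minimizer_comp_isometry hε h hmin R).1,
    fun R => (hk.minimizer_comp_isometry hε h hmin R).2, hell,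
    hpt.mono fun p hp => hp.1, hpt.mono fun p hp => hp.2⟩

end Stationary

/-! ### Approximation by regular pairs and the minimizing sequence -/

section Truncation

variable {k : E3 → ℝ} {M L C r : ℝ} {γ α : E3 → ℝ}

theorem IsPair.indicator_one (h : IsPair γ α) {S : Set E3} (hS : MeasurableSet S) :
    IsPair (S.indicator γ) (S.indicator α) := by
  simpa only [one_mul] using h.indicator hS (s := 1) (by norm_num)

theorem IsPair.indicator_le (h : IsPair γ α) (S : Set E3) : ∀ᵐ p, S.indicator γ p ≤ γ p := by
  filter_upwards [h.nonneg] with p hp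
  by_cases hpS : p ∈ S <;> simp [hpS, hp]

theorem tendsto_indicator_of_eventually_mem {S : ℕ → Set E3} {p : E3}
    (h : ∀ᶠ n in atTop, p ∈ S n) (f : E3 → ℝ) :
    Tendsto (fun n => (S n).indicator f p) atTop (𝓝 (f p)) :=
  tendsto_const_nhds.congr' (h.mono fun _ hn => (Set.indicator_of_mem hn f).symm)

/-- Convergence of the terms of the energy of a pair under truncation. -/
theorem IsKernel.tendsto_indicator (hk : IsKernel k M L C) (h : IsPair γ α) {S : ℕ → Set E3}
    (hS : ∀ n, MeasurableSet (S n)) (hlim : ∀ᵐ p, ∀ᶠ n in atTop, p ∈ S n) :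
    Tendsto (fun n => ∫ p, ‖p‖ ^ 2 * (S n).indicator γ p) atTop (𝓝 (∫ p, ‖p‖ ^ 2 * γ p)) ∧
    Tendsto (fun n => ∫ p, (S n).indicator γ p) atTop (𝓝 (∫ p, γ p)) ∧
    Tendsto (fun n => ∫ p, k p * (S n).indicator γ p) atTop (𝓝 (∫ p, k p * γ p)) ∧
    Tendsto (fun n => ∫ p, k p * (S n).indicator α p) atTop (𝓝 (∫ p, k p * α p)) ∧
    Tendsto (fun n => interaction k ((S n).indicator γ) ((S n).indicator α)) atTop
      (𝓝 (interaction k γ α)) := by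
  have hp := fun n => h.indicator_one (hS n)
  obtain ⟨-, -, -, -, h1, h2, h3, h4⟩ := hk.tendsto_of_dominated (γ := γ) (α := α) h.integrable
    (fun n => (hp n).integrable.1) (fun n => (hp n).aesm) (fun n => (hp n).nonneg)
    (fun n => (hp n).sq_le) (fun n => h.indicator_le (S n))
    (hlim.mono fun p hp => tendsto_indicator_of_eventually_mem hp γ)
    (hlim.mono fun p hp => tendsto_indicator_of_eventually_mem hp α)
  refine ⟨?_, h1, h2, h3, h4⟩
  refine tendsto_integral_of_dominated_convergence _ (fun n => (hp n).integrable_kin.1)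
    h.integrable_kin (fun n => ?_)
    (hlim.mono fun p hp => (tendsto_indicator_of_eventually_mem hp γ).const_mul _)
  filter_upwards [h.indicator_le (S n), (hp n).nonneg] with p q1 q2
  rw [Real.norm_of_nonneg (mul_nonneg (sq_nonneg _) q2)]
  exact mul_le_mul_of_nonneg_left q1 (sq_nonneg _)

theorem isRegular_indicator_of_bound {f : E3 → ℝ} (hf : AEStronglyMeasurable f volume)
    {S : Set E3} (hS : MeasurableSet S) {n c : ℝ} (hn : S ⊆ Metric.closedBall 0 n)
    (hc : ∀ᵐ p, p ∈ S → |f p| ≤ c) : IsRegular (S.indicator f) := by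
  unfold IsRegular
  have e : (fun p => wt p * S.indicator f p) = S.indicator fun p => wt p * f p := by
    funext p; by_cases hp : p ∈ S <;> simp [hp]
  rw [e, memLp_indicator_iff_restrict hS]
  have : IsFiniteMeasure (volume.restrict S) := ⟨by
    rw [Measure.restrict_apply_univ]
    exact (measure_mono hn).trans_lt measure_closedBall_lt_top⟩
  refine MemLp.of_bound (continuous_wt.aestronglyMeasurable.mul hf.restrict)
    ((1 + n ^ 2) ^ 2 * c) ?_
  filter_upwards [ae_restrict_mem hS, ae_restrict_of_ae hc] with p hp h2
  have h1 : ‖p‖ ≤ n := mem_closedBall_zero_iff.mp (hn hp)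
  rw [norm_mul, Real.norm_eq_abs, Real.norm_eq_abs, abs_of_pos (wt_pos p)]
  refine mul_le_mul ?_ (h2 hp) (abs_nonneg _) (by positivity)
  unfold wt
  gcongr

/-- Regular pairs are dense in energy. -/
theorem IsKernel.exists_regular_pair (hk : IsKernel k M L C) (h : IsPair γ α)
    (hm : ∫ p, γ p ≤ r) {η : ℝ} (hη : 0 < η) :
    ∃ g a, IsRegularPair r g a ∧ pairEnergy k r g a < pairEnergy k r γ α + η := by
  obtain ⟨γm, hγm, hae⟩ := h.integrable.1
  -- Cutting off in momentum and in the value of `γ` bounds both functions on a bounded set, since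
  -- `|α| ≤ γ + 1/2`; a measurable representative of `γ` makes the sets measurable.
  set S : ℕ → Set E3 := fun n => Metric.closedBall 0 n ∩ {p | γm p ≤ n} with hSdef
  have hS : ∀ n, MeasurableSet (S n) := fun n =>
    Metric.isClosed_closedBall.measurableSet.inter
      (measurableSet_le hγm.measurable measurable_const)
  have hlim : ∀ᵐ p, ∀ᶠ n in atTop, p ∈ S n := by
    refine Eventually.of_forall fun p => ?_
    obtain ⟨N, hN⟩ := exists_nat_ge (max ‖p‖ (γm p))
    filter_upwards [eventually_ge_atTop N] with n hn
    have : (N : ℝ) ≤ n := Nat.cast_le.mpr hn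
    exact ⟨mem_closedBall_zero_iff.mpr ((le_max_left _ _).trans (hN.trans this)),
      (le_max_right _ _).trans (hN.trans this)⟩
  have hb : ∀ n, ∀ᵐ p, p ∈ S n → γ p ≤ n := fun n => by
    filter_upwards [hae] with p hp hpS
    rw [hp]; exact hpS.2
  have hreg : ∀ n, IsRegularPair r ((S n).indicator γ) ((S n).indicator α) := fun n => by
    refine ⟨isRegular_indicator_of_bound h.integrable.1 (hS n) (n := n) (c := n)
      Set.inter_subset_left ?_, isRegular_indicator_of_bound h.aesm (hS n) (n := n)
      (c := n + 1 / 2) Set.inter_subset_left ?_, (h.indicator_one (hS n)).nonneg,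
      (h.indicator_one (hS n)).sq_le,
      (integral_mono_ae (h.indicator_one (hS n)).integrable h.integrable
        (h.indicator_le (S n))).trans hm⟩
    · filter_upwards [hb n, h.nonneg] with p h1 h2 h3
      rw [abs_of_nonneg h2]; exact h1 h3
    · filter_upwards [hb n, h.abs_le] with p h1 h2 h3
      linarith [h1 h3]
  obtain ⟨t1, t2, t3, t4, t5⟩ := hk.tendsto_indicator h hS hlim
  have ht : Tendsto (fun n => pairEnergy k r ((S n).indicator γ) ((S n).indicator α)) atTop
      (𝓝 (pairEnergy k r γ α)) := by
    unfold pairEnergy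
    simp_rw [fun n => hk.integral_mul_add (h.indicator_one (hS n)), hk.integral_mul_add h]
    exact (t1.add ((t2.const_sub r).mul (t3.add t4))).add (t5.const_mul _)
  obtain ⟨n, hn⟩ := (ht.eventually_lt_const (lt_add_of_pos_right _ hη)).exists
  exact ⟨_, _, hreg n, hn⟩

/-- A minimizing sequence consisting of stationary points of regularized problems. -/
theorem IsKernel.exists_stationary_sequence (hk : IsKernel k M L C) (hr : 0 < r) {I : ℝ}
    (hI : I < 0)
    (hinf : ∀ η > 0, ∃ γ α, IsPair γ α ∧ ∫ p, γ p ≤ r ∧ pairEnergy k r γ α < I + η) :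
    ∃ (ε : ℕ → ℝ) (γ α : ℕ → E3 → ℝ), (∀ n, 0 < ε n) ∧ Tendsto ε atTop (𝓝 0) ∧
      (∀ n, IsStationary k r (ε n) (-I / 2 / r) (γ n) (α n)) ∧
      ∀ η > 0, ∀ᶠ n in atTop, pairEnergy k r (γ n) (α n) < I + η := by
  have key : ∀ n : ℕ, ∃ (ε : ℝ) (γ α : E3 → ℝ), 0 < ε ∧ ε ≤ 1 / ((n : ℝ) + 1) ∧
      IsStationary k r ε (-I / 2 / r) γ α ∧
      pairEnergy k r γ α ≤ I + min (1 / ((n : ℝ) + 1)) (-I / 2) := fun n => by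
    -- The cap `-I/2` keeps all energies below `I/2`, which gives the same `δ = -I/(2r)` for every
    -- `n`.
    set η := min (1 / ((n : ℝ) + 1)) (-I / 2) with hη
    have hη0 : 0 < η := lt_min (by positivity) (by linarith)
    obtain ⟨γ₁, α₁, h1, h2, h3⟩ := hinf (η / 3) (by positivity)
    obtain ⟨g, a, h4, h5⟩ := hk.exists_regular_pair h1 h2 (η := η / 3) (by positivity)
    have hs : 0 ≤ sqNorm g + sqNorm a := add_nonneg sqNorm_nonneg sqNorm_nonneg
    -- The second entry makes the penalty of the nearly optimal regular pair at most `η/3`; the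
    -- other two thirds pay for near-optimality and for the regular approximation.
    set ε := min (1 / ((n : ℝ) + 1)) (η / 3 / (sqNorm g + sqNorm a + 1)) with hεdef
    have hε : 0 < ε := lt_min (by positivity) (by positivity)
    obtain ⟨γ, α, h6, h7⟩ := hk.exists_regularized_minimizer hε hr.le
    have h8 : ε * (sqNorm g + sqNorm a) ≤ η / 3 := by
      calc ε * (sqNorm g + sqNorm a) ≤ ε * (sqNorm g + sqNorm a + 1) := by nlinarith
        _ ≤ _ := (le_div_iff₀ (by positivity)).mp (min_le_right _ _)
    have h9 : regEnergy k r ε γ α ≤ I + η := by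
      have := h7 g a h4
      have e : regEnergy k r ε g a = pairEnergy k r g a + ε * (sqNorm g + sqNorm a) := rfl
      linarith
    have h10 : η ≤ -I / 2 := min_le_right _ _
    refine ⟨ε, γ, α, hε, min_le_left _ _, hk.isStationary_of_minimizer hε hr h6 h7
      (by linarith) (by linarith), ?_⟩
    have := mul_nonneg hε.le (add_nonneg (sqNorm_nonneg (f := γ)) (sqNorm_nonneg (f := α)))
    have e : regEnergy k r ε γ α = pairEnergy k r γ α + ε * (sqNorm γ + sqNorm α) := rfl
    linarith
  choose ε γ α h1 h2 h3 h4 using key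
  have h0 : Tendsto (fun n : ℕ => 1 / ((n : ℝ) + 1)) atTop (𝓝 0) :=
    tendsto_one_div_add_atTop_nhds_zero_nat
  refine ⟨ε, γ, α, h1, squeeze_zero (fun n => (h1 n).le) h2 h0, h3, fun η hη => ?_⟩
  filter_upwards [h0.eventually_lt_const hη] with n hn
  have := h4 n
  have := min_le_left (1 / ((n : ℝ) + 1)) (-I / 2)
  linarith

end Truncation

/-! ### Pointwise consequences of the Euler equations, with `w` for `2ε·wt²` -/

section Scalar

variable {A B w g a : ℝ}

theorem euler_identity (h : 2 * a * (A + w * g) = -((B + w * a) * (2 * g + 1))) :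
    a * (2 * A + w * (4 * g + 1)) = -(B * (2 * g + 1)) := by linear_combination h

theorem euler_abs_identity (hA : 0 < A) (hw : 0 ≤ w) (hg : 0 ≤ g)
    (h : 2 * a * (A + w * g) = -((B + w * a) * (2 * g + 1))) :
    |a| * (2 * A + w * (4 * g + 1)) = |B| * (2 * g + 1) := by
  have h1 := congrArg abs (euler_identity h)
  rwa [abs_mul, abs_neg, abs_mul, abs_of_pos (a := 2 * g + 1) (by positivity),
    abs_of_pos (a := 2 * A + w * (4 * g + 1)) (by positivity)] at h1

theorem euler_abs_le (hA : 0 < A) (hw : 0 ≤ w) (hg : 0 ≤ g)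
    (h : 2 * a * (A + w * g) = -((B + w * a) * (2 * g + 1))) :
    2 * |a| * A ≤ |B| * (2 * g + 1) := by
  have h1 := euler_abs_identity hA hw hg h
  have : 0 ≤ |a| * (w * (4 * g + 1)) := by positivity
  linarith

/-- Squaring `2|a|A ≤ |B|(2g + 1)` and using `(2g + 1)² = 4g(1 + g) + 1` bounds `g` wherever `A`
stays away from `|B|`, with no loss from the regularization. -/
theorem euler_upper_bound (hA : 0 < A) (hw : 0 ≤ w) (hg : 0 ≤ g) (ha : a ^ 2 = g * (1 + g))
    (h : 2 * a * (A + w * g) = -((B + w * a) * (2 * g + 1))) :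
    4 * (g * (1 + g)) * (A ^ 2 - B ^ 2) ≤ B ^ 2 := by
  have h1 := pow_le_pow_left₀ (by positivity) (euler_abs_le hA hw hg h) 2
  rw [mul_pow, mul_pow, mul_pow, sq_abs, sq_abs, ha] at h1
  linarith

/-- Inserting `|a| ≤ g + 1/2` into the Euler equation lets the factor `2g + 1` cancel; in the limit
this will give `|B| ≤ A`. -/
theorem euler_field_le (hA : 0 < A) (hw : 0 ≤ w) (hg : 0 ≤ g) (ha : a ^ 2 = g * (1 + g))
    (h : 2 * a * (A + w * g) = -((B + w * a) * (2 * g + 1))) :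
    |B| ≤ A + w * (2 * g + 1) := by
  have h1 := euler_abs_identity hA hw hg h
  have h2 := abs_le_add_half hg ha.le
  have h3 : |a| * (2 * A + w * (4 * g + 1)) ≤ (g + 1 / 2) * (2 * A + w * (4 * g + 1)) :=
    mul_le_mul_of_nonneg_right h2 (by positivity)
  rw [h1] at h3
  have h4 : |B| * (2 * g + 1) ≤ (A + w * (2 * g + 1)) * (2 * g + 1) := by
    have : 0 ≤ w * (2 * g + 1) := by positivity
    nlinarith
  exact le_of_mul_le_mul_right h4 (by positivity)

/-- The two factors of `(2g + 1)² - 4a² = 1` give `2g + 1 - 2|a| ≥ 1/(2(2g + 1))`. Hence a small gap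
`A - |B|` forces `g` to be large, up to the term in `w`. -/
theorem euler_lower_bound (hA : 0 < A) (hw : 0 ≤ w) (hg : 0 ≤ g) (ha : a ^ 2 = g * (1 + g))
    (h : 2 * a * (A + w * g) = -((B + w * a) * (2 * g + 1))) :
    A / 2 ≤ (A - |B|) * (2 * g + 1) ^ 2 + w * (2 * g + 1) ^ 3 := by
  have h1 := euler_abs_identity hA hw hg h
  have h2 := abs_le_add_half hg ha.le
  have h5 : |a| ^ 2 = g * (1 + g) := by rw [sq_abs, ha]
  have h3 : (2 * g + 1 - 2 * |a|) * (2 * g + 1 + 2 * |a|) = 1 := by nlinarith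
  have h6 : 0 ≤ 2 * g + 1 - 2 * |a| := by linarith
  have h4 : 1 ≤ (2 * g + 1 - 2 * |a|) * (2 * (2 * g + 1)) := by nlinarith
  have h7 : |a| * (w * (4 * g + 1)) ≤ w * (2 * g + 1) ^ 2 := by
    have : |a| * (w * (4 * g + 1)) ≤ (g + 1 / 2) * (w * (4 * g + 1)) :=
      mul_le_mul_of_nonneg_right h2 (by positivity)
    nlinarith [mul_nonneg hw hg]
  have h8 : (A - |B|) * (2 * g + 1) + w * (2 * g + 1) ^ 2 ≥ A * (2 * g + 1 - 2 * |a|) := by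
    linarith
  have h9 := mul_le_mul_of_nonneg_right h8 (show 0 ≤ 2 * g + 1 by positivity)
  nlinarith [mul_le_mul_of_nonneg_left h4 hA.le]

/-- When `2|B| ≤ A` the upper bound makes `g ≤ 1/4`, so that `2g + 1 ≤ 2` in the Euler equation.
This gives the decay at large momenta. -/
theorem euler_tail (hA : 0 < A) (hw : 0 ≤ w) (hg : 0 ≤ g) (ha : a ^ 2 = g * (1 + g))
    (h : 2 * a * (A + w * g) = -((B + w * a) * (2 * g + 1))) (hB : 2 * |B| ≤ A) :
    g ≤ B ^ 2 / A ^ 2 ∧ |a| ≤ |B| / A := by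
  have h1 := euler_upper_bound hA hw hg ha h
  have h2 := euler_abs_le hA hw hg h
  have h3 : 4 * B ^ 2 ≤ A ^ 2 := by
    have := pow_le_pow_left₀ (by positivity) hB 2
    rw [mul_pow, sq_abs] at this; linarith
  have h4 : g * (1 + g) * (3 * A ^ 2) ≤ B ^ 2 := by nlinarith [mul_nonneg hg (by linarith : 0 ≤ 1 + g)]
  have hA2 : 0 < A ^ 2 := by positivity
  have h5 : g * A ^ 2 ≤ B ^ 2 := by nlinarith [mul_nonneg (mul_nonneg hg hg) hA2.le, mul_nonneg hg hA2.le]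
  have h6 : g ≤ 1 / 4 := by
    by_contra! hc
    nlinarith [mul_lt_mul_of_pos_right hc hA2]
  refine ⟨(le_div_iff₀ hA2).mpr h5, (le_div_iff₀ hA).mpr ?_⟩
  nlinarith [abs_nonneg B]

end Scalar

/-! ### Bounds uniform in the regularization -/

section Bounds

variable {k : E3 → ℝ} {M L C r ε δ : ℝ} {γ α f : E3 → ℝ}

theorem IsKernel.integral_sub_left (hk : IsKernel k M L C) (p : E3) :
    ∫ q, k (p - q) = ∫ q, k q := by
  simp_rw [hk.sub_comm p]
  exact integral_sub_right_eq_self k p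

theorem IsKernel.abs_conv_pair_le (hk : IsKernel k M L C) (h : IsPair γ α)
    (hm : ∫ p, γ p ≤ r) (p : E3) : |conv k α p| ≤ M * r + 1 / 2 * ∫ q, k q := by
  have hkp : Integrable fun q => k (p - q) := hk.integrable.comp_sub_left p
  have h1 : |conv k α p| ≤ ∫ q, (M * γ q + 1 / 2 * k (p - q)) := by
    unfold conv
    rw [← Real.norm_eq_abs]
    refine norm_integral_le_of_norm_le ((h.integrable.const_mul M).add (hkp.const_mul _)) ?_
    filter_upwards [h.abs_le, h.nonneg] with q h2 h3
    rw [Real.norm_eq_abs, abs_mul, abs_of_nonneg (hk.nonneg _)]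
    have := mul_le_mul_of_nonneg_left h2 (hk.nonneg (p - q))
    have := mul_le_mul_of_nonneg_right (hk.le (p - q)) h3
    linarith
  rw [integral_add (h.integrable.const_mul M) (hkp.const_mul _), integral_const_mul,
    integral_const_mul, hk.integral_sub_left] at h1
  have := mul_le_mul_of_nonneg_left hm hk.bound_nonneg
  linarith

theorem IsKernel.integrable_conv_self (hk : IsKernel k M L C) (hf : Integrable f) :
    Integrable (conv k f) :=
  (hk.integrable_prod_snd hf).integral_prod_left

theorem IsKernel.integral_abs_conv_le (hk : IsKernel k M L C) (hf : Integrable f) :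
    ∫ p, |conv k f p| ≤ (∫ p, k p) * ∫ p, |f p| := by
  have h1 : ∫ p, |conv k f p| ≤ ∫ p, conv k (fun q => |f q|) p := by
    refine integral_mono (hk.integrable_conv_self hf).abs (hk.integrable_conv_self hf.abs)
      fun p => ?_
    unfold conv
    refine abs_integral_le_integral (hk.integrable_conv hf.abs p) fun q => ?_
    rw [abs_mul, abs_of_nonneg (hk.nonneg _)]
  have h2 : ∫ p, conv k (fun q => |f q|) p = (∫ p, k p) * ∫ p, |f p| := by
    unfold conv
    rw [integral_integral_swap (hk.integrable_prod_snd hf.abs), ← integral_const_mul]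
    congr 1; funext q
    rw [integral_mul_const, integral_sub_right_eq_self k q]
  exact h1.trans h2.le

theorem IsStationary.mass_nonneg (h : IsStationary k r ε δ γ α) : 0 ≤ ∫ p, γ p :=
  integral_nonneg_of_ae h.pair.nonneg

theorem IsStationary.integral_abs_left (h : IsStationary k r ε δ γ α) :
    ∫ p, |γ p| ≤ r := by
  rw [integral_congr_ae (h.pair.nonneg.mono fun p hp => abs_of_nonneg hp)]
  exact h.pair.mass_le

theorem IsStationary.le_fieldA (hk : IsKernel k M L C) (h : IsStationary k r ε δ γ α) (p : E3) :
    ‖p‖ ^ 2 + δ ≤ fieldA k r γ α p :=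
  hk.le_fieldA h.pair.nonneg h.pair.mass_le h.ell_le p

theorem IsStationary.abs_fieldB_le (hk : IsKernel k M L C) (h : IsStationary k r ε δ γ α)
    (p : E3) : |fieldB k r γ α p| ≤ 2 * M * r + 1 / 2 * ∫ q, k q := by
  have h1 := hk.abs_conv_pair_le h.pair.isPair h.pair.mass_le p
  have h2 : |(r - ∫ q, γ q) * k p| ≤ r * M := by
    rw [abs_mul, abs_of_nonneg (sub_nonneg.mpr h.pair.mass_le)]
    exact mul_le_mul (by linarith [h.mass_nonneg]) (hk.abs_le p) (abs_nonneg _)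
      (by linarith [h.mass_nonneg, h.pair.mass_le])
  have := abs_add_le ((r - ∫ q, γ q) * k p) (conv k α p)
  unfold fieldB
  linarith

theorem IsStationary.integrable_fieldB (hk : IsKernel k M L C) (h : IsStationary k r ε δ γ α) :
    Integrable (fieldB k r γ α) :=
  (hk.integrable.const_mul _).add (hk.integrable_conv_self h.pair.right.integrable)

theorem IsStationary.integral_abs_fieldB_le (hk : IsKernel k M L C)
    (h : IsStationary k r ε δ γ α) :
    ∫ p, |fieldB k r γ α p| ≤ (∫ p, k p) * (r + ∫ p, |α p|) := by
  have i1 : Integrable fun p => r * k p := hk.integrable.const_mul r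
  have i2 := (hk.integrable_conv_self h.pair.right.integrable).abs
  have h1 : ∫ p, |fieldB k r γ α p| ≤ ∫ p, (r * k p + |conv k α p|) := by
    refine integral_mono (h.integrable_fieldB hk).abs (i1.add i2) fun p => ?_
    refine (abs_add_le _ _).trans (add_le_add_left ?_ _)
    rw [abs_mul, abs_of_nonneg (sub_nonneg.mpr h.pair.mass_le), abs_of_nonneg (hk.nonneg p)]
    exact mul_le_mul_of_nonneg_right (by linarith [h.mass_nonneg]) (hk.nonneg p)
  rw [integral_add i1 i2, integral_const_mul] at h1
  have := hk.integral_abs_conv_le h.pair.right.integrable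
  linarith

/-- The `L¹`-norms of the functions `α` are uniformly bounded. -/
theorem IsStationary.integral_abs_right_le (hk : IsKernel k M L C) (hε : 0 < ε) (hδ : 0 < δ)
    (h : IsStationary k r ε δ γ α) {T : ℝ} (hT0 : 0 < T)
    (hT1 : 2 * (2 * M * r + 1 / 2 * ∫ q, k q) ≤ T) (hT2 : 2 * ∫ q, k q ≤ T) :
    ∫ p, |α p| ≤ 3 * r + volume.real (Metric.closedBall (0 : E3) √T) := by
  have hα := h.pair.right.integrable
  have hball : MeasurableSet (Metric.closedBall (0 : E3) √T) :=
    Metric.isClosed_closedBall.measurableSet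
  have hB := (h.integrable_fieldB hk).abs
  have i1 : Integrable ((Metric.closedBall (0 : E3) √T).indicator fun _ => (1 / 2 : ℝ)) :=
    (integrableOn_const measure_closedBall_lt_top.ne).integrable_indicator hball
  -- Inside the ball the constraint gives `γ + 1/2`; outside it `A ≥ T ≥ 2|B|`, so `euler_tail`
  -- gives `|B|/A`.
  have hpt : ∀ᵐ p, |α p| ≤ γ p + (Metric.closedBall (0 : E3) √T).indicator (fun _ => (1 / 2 : ℝ)) p
      + T⁻¹ * |fieldB k r γ α p| := by
    filter_upwards [h.pair.nonneg, h.sq_eq, h.euler] with p h1 h2 h3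
    have h4 : 0 ≤ T⁻¹ * |fieldB k r γ α p| := by positivity
    by_cases hp : p ∈ Metric.closedBall (0 : E3) √T
    · rw [Set.indicator_of_mem hp]
      linarith [abs_le_add_half h1 h2.le]
    · rw [Set.indicator_of_notMem hp]
      rw [mem_closedBall_zero_iff, not_le, Real.sqrt_lt' ((norm_nonneg p).lt_of_ne' ?_)] at hp
      · have h5 := h.le_fieldA hk p
        have hA : T ≤ fieldA k r γ α p := by linarith
        have h6 := (euler_tail (hT0.trans_le hA) (by positivity) h1 h2 h3
          (by linarith [h.abs_fieldB_le hk p])).2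
        have h7 : |fieldB k r γ α p| / fieldA k r γ α p ≤ T⁻¹ * |fieldB k r γ α p| := by
          rw [div_eq_inv_mul]
          exact mul_le_mul_of_nonneg_right (inv_anti₀ hT0 hA) (abs_nonneg _)
        linarith
      · rintro h0
        rw [h0] at hp
        exact hp.not_ge (Real.sqrt_nonneg _)
  have h8 := integral_mono_ae hα.abs ((h.pair.left.integrable.add i1).add (hB.const_mul T⁻¹)) hpt
  have e : ∫ p, ((γ + (Metric.closedBall (0 : E3) √T).indicator fun _ => (1 / 2 : ℝ))
      + fun p => T⁻¹ * |fieldB k r γ α p|) p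
      = (∫ p, γ p) + volume.real (Metric.closedBall (0 : E3) √T) * (1 / 2)
        + T⁻¹ * ∫ p, |fieldB k r γ α p| := by
    rw [integral_add' (h.pair.left.integrable.add i1) (hB.const_mul T⁻¹),
      integral_add' h.pair.left.integrable i1, integral_const_mul, integral_indicator hball,
      setIntegral_const, smul_eq_mul]
  -- The integral of `|B|` itself contains `∫ |α|`; the choice `T ≥ 2∫ k` leaves it with the factor
  -- 1/2, so that it can be absorbed.
  have h9 : T⁻¹ * ∫ p, |fieldB k r γ α p| ≤ 1 / 2 * (r + ∫ p, |α p|) := by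
    rw [inv_mul_le_iff₀ hT0]
    have h10 := h.integral_abs_fieldB_le hk
    have h11 : 0 ≤ r + ∫ p, |α p| := by
      have : 0 ≤ ∫ p, |α p| := integral_nonneg fun p => abs_nonneg _
      linarith [h.mass_nonneg, h.pair.mass_le]
    nlinarith
  have h12 : ∫ p, |α p| ≤ (∫ p, γ p) + volume.real (Metric.closedBall (0 : E3) √T) * (1 / 2)
        + T⁻¹ * ∫ p, |fieldB k r γ α p| := e ▸ h8
  linarith [h.pair.mass_le]

/-- Bounds on the fields which are uniform in the regularization. -/
structure IsUniformBound (k : E3 → ℝ) (r K : ℝ) (γ α : E3 → ℝ) : Prop where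
  integral_abs_le : ∫ p, |α p| ≤ K
  abs_fieldA_le : ∀ p, |fieldA k r γ α p - ‖p‖ ^ 2| ≤ K
  abs_fieldB_le : ∀ p, |fieldB k r γ α p| ≤ K
  lipA : ∀ x y, |(fieldA k r γ α x - ‖x‖ ^ 2) - (fieldA k r γ α y - ‖y‖ ^ 2)| ≤ K * ‖x - y‖
  lipB : ∀ x y, |fieldB k r γ α x - fieldB k r γ α y| ≤ K * ‖x - y‖
  secondA : ∀ x h, |fieldA k r γ α (x + h) + fieldA k r γ α (x - h) - 2 * fieldA k r γ α x|
    ≤ K * ‖h‖ ^ 2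
  secondB : ∀ x h, |fieldB k r γ α (x + h) + fieldB k r γ α (x - h) - 2 * fieldB k r γ α x|
    ≤ K * ‖h‖ ^ 2

/-- Convolutions inherit the bounds on the first and second differences of `k`, multiplied by the
`L¹`-norms of `γ` and `α`, which are bounded independently of `ε`. -/
theorem IsKernel.exists_uniformBound (hk : IsKernel k M L C) (hr : 0 < r) (hδ : 0 < δ) :
    ∃ K, 0 < K ∧ ∀ ε γ α, 0 < ε → IsStationary k r ε δ γ α → IsUniformBound k r K γ α := by
  have hM := hk.bound_nonneg
  have hL := hk.lip_nonneg
  have hC := hk.second_nonneg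
  have hk0 : 0 ≤ ∫ q, k q := integral_nonneg hk.nonneg
  set T := 2 * (2 * M * r + 1 / 2 * ∫ q, k q) + 2 * (∫ q, k q) + 1 with hT
  have hT0 : 0 < T := by positivity
  set V := 3 * r + volume.real (Metric.closedBall (0 : E3) √T) with hV
  have hV0 : 0 ≤ V := by positivity
  -- The final `2` accounts for the second difference of `|p|²`, which is `2‖h‖²` by the
  -- parallelogram law.
  set K := V + (4 * M * r + ∫ q, k q) + L * (2 * r + V) + C * (2 * r + V) + 2 with hK
  have hKL : L * (2 * r + V) ≤ K := by
    have : 0 ≤ C * (2 * r + V) := by positivity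
    have : 0 ≤ M * r := by positivity
    linarith
  have hKC : C * (2 * r + V) + 2 ≤ K := by
    have : 0 ≤ L * (2 * r + V) := by positivity
    have : 0 ≤ M * r := by positivity
    linarith
  have hKM : 4 * M * r + ∫ q, k q ≤ K := by
    have : 0 ≤ L * (2 * r + V) := by positivity
    have : 0 ≤ C * (2 * r + V) := by positivity
    linarith
  have hKV : V ≤ K := by
    have : 0 ≤ L * (2 * r + V) := by positivity
    have : 0 ≤ C * (2 * r + V) := by positivity
    have : 0 ≤ M * r := by positivity
    linarith
  refine ⟨K, by positivity, fun ε γ α hε h => ?_⟩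
  have hα := h.pair.right.integrable
  have hγ := h.pair.left.integrable
  have hαV : ∫ p, |α p| ≤ V := h.integral_abs_right_le hk hε hδ hT0
    (by linarith) (by have : 0 ≤ M * r := by positivity
                      linarith)
  have hγr := h.integral_abs_left
  have hs0 : 0 ≤ r - ∫ q, γ q := sub_nonneg.mpr h.pair.mass_le
  have hs1 : r - ∫ q, γ q ≤ r := by linarith [h.mass_nonneg]
  have lip_k : ∀ x y, |(r - ∫ q, γ q) * k x - (r - ∫ q, γ q) * k y| ≤ L * r * ‖x - y‖ := by
    intro x y
    rw [← mul_sub, abs_mul, abs_of_nonneg hs0]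
    have := mul_le_mul hs1 (hk.lip x y) (abs_nonneg _) hr.le
    linarith
  have lip_conv : ∀ {f : E3 → ℝ} {c : ℝ}, Integrable f → ∫ p, |f p| ≤ c → ∀ x y,
      |conv k f x - conv k f y| ≤ L * c * ‖x - y‖ := fun {f c} hf hc x y => by
    have h1 := hk.abs_conv_sub_le hf x y
    have h2 := mul_le_mul_of_nonneg_left hc (show 0 ≤ L * ‖x - y‖ by positivity)
    linarith
  have sec_k : ∀ x z, |(r - ∫ q, γ q) * k (x + z) + (r - ∫ q, γ q) * k (x - z)
      - 2 * ((r - ∫ q, γ q) * k x)| ≤ C * r * ‖z‖ ^ 2 := by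
    intro x z
    rw [show (r - ∫ q, γ q) * k (x + z) + (r - ∫ q, γ q) * k (x - z)
      - 2 * ((r - ∫ q, γ q) * k x) = (r - ∫ q, γ q) * (k (x + z) + k (x - z) - 2 * k x) by ring,
      abs_mul, abs_of_nonneg hs0]
    have := mul_le_mul hs1 (hk.second x z) (abs_nonneg _) hr.le
    linarith
  have sec_conv : ∀ {f : E3 → ℝ} {c : ℝ}, Integrable f → ∫ p, |f p| ≤ c → ∀ x z,
      |conv k f (x + z) + conv k f (x - z) - 2 * conv k f x| ≤ C * c * ‖z‖ ^ 2 :=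
    fun {f c} hf hc x z => by
    have h1 := hk.conv_second hf x z
    have h2 := mul_le_mul_of_nonneg_left hc (show 0 ≤ C * ‖z‖ ^ 2 by positivity)
    linarith
  constructor
  · exact hαV.trans hKV
  · intro p
    have h1 := hk.abs_integral_pair_le h.pair.isPair h.pair.mass_le
    have h2 := hk.abs_conv_le hγ p
    have h3 := mul_le_mul_of_nonneg_left hγr hM
    have h4 := mul_le_mul hs1 (hk.le p) (hk.nonneg p) hr.le
    have h5 := mul_nonneg hs0 (hk.nonneg p)
    have h6 : 0 ≤ conv k γ p := hk.conv_nonneg h.pair.nonneg p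
    have h7 := (le_abs_self _).trans h2
    rw [_root_.abs_le] at h1 ⊢
    unfold fieldA
    constructor <;> linarith
  · intro p
    have := h.abs_fieldB_le hk p
    have : 0 ≤ M * r := by positivity
    linarith
  · intro x y
    have h1 := lip_k x y
    have h2 := lip_conv hγ hγr x y
    have h3 := mul_le_mul_of_nonneg_right hKL (norm_nonneg (x - y))
    have h4 : 0 ≤ L * V * ‖x - y‖ := by positivity
    rw [_root_.abs_le] at h1 h2 ⊢
    unfold fieldA
    constructor <;> linarith
  · intro x y
    have h1 := lip_k x y
    have h2 := lip_conv hα hαV x y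
    have h3 := mul_le_mul_of_nonneg_right hKL (norm_nonneg (x - y))
    have h4 : 0 ≤ L * r * ‖x - y‖ := by positivity
    rw [_root_.abs_le] at h1 h2 ⊢
    unfold fieldB
    constructor <;> linarith
  · intro x z
    have h1 := sec_k x z
    have h2 := sec_conv hγ hγr x z
    have h3 := mul_le_mul_of_nonneg_right hKC (sq_nonneg ‖z‖)
    have h4 : 0 ≤ C * V * ‖z‖ ^ 2 := by positivity
    have h5 : ‖x + z‖ ^ 2 + ‖x - z‖ ^ 2 - 2 * ‖x‖ ^ 2 = 2 * ‖z‖ ^ 2 := by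
      linear_combination parallelogram_law_with_norm ℝ x z
    have h6 := sq_nonneg ‖z‖
    rw [_root_.abs_le] at h1 h2 ⊢
    unfold fieldA
    constructor <;> linarith
  · intro x z
    have h1 := sec_k x z
    have h2 := sec_conv hα hαV x z
    have h3 := mul_le_mul_of_nonneg_right hKC (sq_nonneg ‖z‖)
    have h4 : 0 ≤ C * r * ‖z‖ ^ 2 := by positivity
    have h5 := sq_nonneg ‖z‖
    rw [_root_.abs_le] at h1 h2 ⊢
    unfold fieldB
    constructor <;> linarith

end Bounds

/-! ### Compactness of equi-Lipschitz sequences -/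

section Compactness

variable {f : ℕ → E3 → ℝ} {g : E3 → ℝ} {K : ℝ}

/-- A bounded equi-Lipschitz sequence has a pointwise convergent subsequence. -/
theorem exists_pointwise_subseq (hb : ∀ n p, |f n p| ≤ K)
    (hl : ∀ n x y, |f n x - f n y| ≤ K * ‖x - y‖) :
    ∃ φ : ℕ → ℕ, StrictMono φ ∧ ∃ g : E3 → ℝ, ∀ p, Tendsto (fun n => f (φ n) p) atTop (𝓝 (g p)) := by
  have hK : 0 ≤ K := (abs_nonneg _).trans (hb 0 0)
  set d := TopologicalSpace.denseSeq E3
  -- Compactness of the countable product of intervals takes the place of a diagonal argument on a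
  -- dense sequence.
  obtain ⟨x, -, φ, hφ, hx⟩ := (isCompact_univ_pi fun _ : ℕ => isCompact_Icc (a := -K) (b := K)).tendsto_subseq
    (x := fun n j => f n (d j)) fun n j _ => _root_.abs_le.mp (hb n (d j))
  rw [tendsto_pi_nhds] at hx
  have : ∀ p, ∃ y, Tendsto (fun n => f (φ n) p) atTop (𝓝 y) := fun p => by
    refine cauchySeq_tendsto_of_complete (Metric.cauchySeq_iff.mpr fun e he => ?_)
    obtain ⟨j, hj⟩ := (TopologicalSpace.denseRange_denseSeq E3).exists_dist_lt p
      (show 0 < e / (3 * (K + 1)) by positivity)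
    obtain ⟨N, hN⟩ := Metric.cauchySeq_iff.mp (hx j).cauchySeq (e / 3) (by positivity)
    refine ⟨N, fun m hm n hn => ?_⟩
    have h1 := hN m hm n hn
    rw [Real.dist_eq] at h1 ⊢
    have h2 : K * ‖p - d j‖ ≤ e / 3 := by
      rw [dist_eq_norm, lt_div_iff₀ (by positivity)] at hj
      nlinarith [norm_nonneg (p - d j)]
    have h3 := hl (φ m) p (d j)
    have h4 := hl (φ n) p (d j)
    simp only [Function.comp] at h1
    rw [_root_.abs_le] at h3 h4
    rw [abs_lt] at h1 ⊢
    constructor <;> linarith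
  choose g hg using this
  exact ⟨φ, hφ, g, hg⟩

theorem abs_sub_le_of_tendsto (hl : ∀ n x y, |f n x - f n y| ≤ K * ‖x - y‖)
    (hg : ∀ p, Tendsto (fun n => f n p) atTop (𝓝 (g p))) (x y : E3) :
    |g x - g y| ≤ K * ‖x - y‖ :=
  le_of_tendsto' ((hg x).sub (hg y)).abs fun n => hl n x y

theorem continuous_of_abs_sub_le (hl : ∀ x y, |g x - g y| ≤ K * ‖x - y‖) : Continuous g := by
  have hL : LipschitzWith K.toNNReal g := by
    refine LipschitzWith.of_dist_le_mul fun x y => ?_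
    rw [Real.dist_eq, dist_eq_norm]
    exact (hl x y).trans (mul_le_mul_of_nonneg_right (Real.le_coe_toNNReal K) (norm_nonneg _))
  exact hL.continuous

/-- Pointwise convergence of an equi-Lipschitz sequence is uniform on compact sets. -/
theorem eventually_abs_sub_le (hK : 0 ≤ K) (hl : ∀ n x y, |f n x - f n y| ≤ K * ‖x - y‖)
    (hg : ∀ p, Tendsto (fun n => f n p) atTop (𝓝 (g p))) {S : Set E3} (hS : IsCompact S)
    {e : ℝ} (he : 0 < e) : ∀ᶠ n in atTop, ∀ p ∈ S, |f n p - g p| ≤ e := by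
  obtain ⟨t, -, htf, ht⟩ := hS.finite_cover_balls (show 0 < e / (3 * (K + 1)) by positivity)
  have h1 : ∀ᶠ n in atTop, ∀ c ∈ t, |f n c - g c| ≤ e / 3 := by
    refine (htf.eventually_all).mpr fun c _ => ?_
    have := ((hg c).sub_const (g c)).abs
    rw [sub_self, abs_zero] at this
    exact this.eventually_le_const (by positivity)
  filter_upwards [h1] with n hn p hp
  obtain ⟨c, hc, hpc⟩ := Set.mem_iUnion₂.mp (ht hp)
  have h2 : K * ‖p - c‖ ≤ e / 3 := by
    rw [Metric.mem_ball, dist_eq_norm, lt_div_iff₀ (by positivity)] at hpc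
    nlinarith [norm_nonneg (p - c)]
  have h3 := hl n p c
  have h4 := abs_sub_le_of_tendsto hl hg p c
  have h5 := hn c hc
  rw [_root_.abs_le] at h3 h4 h5 ⊢
  constructor <;> linarith

end Compactness

/-! ### Exclusion of blow-up on spheres, and convergence elsewhere -/

/-- The function `| |p| - s |⁻¹` is not integrable near the sphere of radius `s`. -/
theorem not_integrable_inv_shell {s : ℝ} (hs : 0 < s) :
    ¬ Integrable fun p : E3 => (Set.Iio (2 * s)).indicator (fun y => |y - s|⁻¹) ‖p‖ := by
  intro h
  -- In polar coordinates the density `y²` is bounded below near `s > 0`, which leaves the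
  -- non-integrable function `(y - s)⁻¹`.
  have h1 := (integrable_fun_norm_addHaar (E := E3) volume).mp h
  have h2 : IntegrableOn (fun y : ℝ => y ^ (Module.finrank ℝ E3 - 1)
      • (Set.Iio (2 * s)).indicator (fun y => |y - s|⁻¹) y) (Set.Ioc s (3 / 2 * s)) :=
    h1.mono_set fun y hy => hs.trans hy.1
  have h3 : IntegrableOn (fun y : ℝ => (y - s)⁻¹) (Set.Ioc s (3 / 2 * s)) := by
    have hm : AEStronglyMeasurable (fun y : ℝ => (y ^ 2)⁻¹)
        (volume.restrict (Set.Ioc s (3 / 2 * s))) := by fun_prop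
    refine (Integrable.bdd_mul h2 (c := (s ^ 2)⁻¹) hm ?_).congr ?_
    · filter_upwards [ae_restrict_mem measurableSet_Ioc] with y hy
      rw [Real.norm_of_nonneg (by positivity)]
      exact inv_anti₀ (by positivity) (pow_le_pow_left₀ hs.le hy.1.le 2)
    · filter_upwards [ae_restrict_mem measurableSet_Ioc] with y hy
      have hy0 : y ≠ 0 := (hs.trans hy.1).ne'
      have hy1 : y ∈ Set.Iio (2 * s) := by
        have := hy.2
        rw [Set.mem_Iio]; linarith
      rw [Set.indicator_of_mem hy1, abs_of_pos (sub_pos.mpr hy.1), smul_eq_mul]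
      simp only [finrank_euclideanSpace, Fintype.card_fin]
      field_simp
  have h4 : IntervalIntegrable (fun y : ℝ => (y - s)⁻¹) volume s (3 / 2 * s) :=
    (intervalIntegrable_iff_integrableOn_Ioc_of_le (by linarith)).mpr h3
  rcases intervalIntegrable_sub_inv_iff.mp h4 with h5 | h5
  · linarith
  · exact h5 Set.left_mem_uIcc

/-- Functions that blow up at least like the inverse distance to a sphere have infinite mass. -/
theorem false_of_shell_bound {γ : ℕ → E3 → ℝ} {r c s : ℝ} (hc : 0 < c) (hs : 0 < s)
    (hi : ∀ n, Integrable (γ n)) (h0 : ∀ n, ∀ᵐ p, 0 ≤ γ n p) (hm : ∀ n, ∫ p, γ n p ≤ r)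
    (hlow : ∀ᵐ p : E3, ∀ t, 0 ≤ t → (2 * t + 1) * |‖p‖ - s| < c → ∀ᶠ n in atTop, t ≤ γ n p) :
    False := by
  refine not_integrable_inv_shell hs ?_
  set F : E3 → ℝ := fun p => (Set.Iio (2 * s)).indicator (fun y => |y - s|⁻¹) ‖p‖ with hF
  have hFm : Measurable F := by
    have : Measurable ((Set.Iio (2 * s)).indicator fun y : ℝ => |y - s|⁻¹) :=
      (by fun_prop : Measurable fun y : ℝ => |y - s|⁻¹).indicator measurableSet_Iio
    exact this.comp measurable_norm
  have hF0 : ∀ p, 0 ≤ F p := fun p => Set.indicator_nonneg (fun _ _ => by positivity) _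
  have hpt : ∀ᵐ p : E3, ENNReal.ofReal (c / 4 * F p) ≤
      liminf (fun n => ENNReal.ofReal (γ n p)) atTop
        + (Metric.ball (0 : E3) (2 * s)).indicator (fun _ => 1) p := by
    filter_upwards [hlow] with p hp
    by_cases hps : ‖p‖ < 2 * s
    · have hmem : p ∈ Metric.ball (0 : E3) (2 * s) := mem_ball_zero_iff.mpr hps
      rw [Set.indicator_of_mem hmem]
      have hFp : F p = |‖p‖ - s|⁻¹ := Set.indicator_of_mem (show ‖p‖ ∈ Set.Iio (2 * s) from hps) _
      set x := c / 4 * |‖p‖ - s|⁻¹ with hx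
      rw [hFp]
      rcases le_or_gt x (1 / 2) with h1 | h1
      · refine le_add_left ?_
        rw [← ENNReal.ofReal_one]
        exact ENNReal.ofReal_le_ofReal (by linarith)
      · have hτ : 0 < |‖p‖ - s| := by
          by_contra! hn
          have : |‖p‖ - s| = 0 := le_antisymm hn (abs_nonneg _)
          rw [hx, this, inv_zero, mul_zero] at h1
          linarith
        -- With `t = x - 1/2` the product `(2t + 1)·| |p| - s |` equals `c/2`, safely below `c`; the
        -- lost 1/2 is paid by the indicator of the ball.
        have h2 := hp (x - 1 / 2) (by linarith) (by
          have : (2 * (x - 1 / 2) + 1) * |‖p‖ - s| = c / 2 := by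
            rw [hx]; field_simp; ring
          rw [this]; linarith)
        have h3 : ENNReal.ofReal (x - 1 / 2) ≤ liminf (fun n => ENNReal.ofReal (γ n p)) atTop :=
          le_liminf_of_le (by isBoundedDefault) (h2.mono fun n hn => ENNReal.ofReal_le_ofReal hn)
        calc ENNReal.ofReal x = ENNReal.ofReal (x - 1 / 2 + 1 / 2) := by ring_nf
          _ ≤ ENNReal.ofReal (x - 1 / 2) + ENNReal.ofReal (1 / 2) := ENNReal.ofReal_add_le
          _ ≤ _ := add_le_add h3 (by
            rw [← ENNReal.ofReal_one]
            exact ENNReal.ofReal_le_ofReal (by norm_num))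
    · have hFp : F p = 0 := Set.indicator_of_notMem (show ‖p‖ ∉ Set.Iio (2 * s) from hps) _
      rw [hFp, mul_zero, ENNReal.ofReal_zero]
      exact zero_le
  have hfat : ∫⁻ p, liminf (fun n => ENNReal.ofReal (γ n p)) atTop ≤ ENNReal.ofReal r := by
    refine (lintegral_liminf_le' fun n => (hi n).1.aemeasurable.ennreal_ofReal).trans ?_
    refine liminf_le_of_frequently_le' (Frequently.of_forall fun n => ?_)
    rw [← ofReal_integral_eq_lintegral_ofReal (hi n) (h0 n)]
    exact ENNReal.ofReal_le_ofReal (hm n)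
  have hball : MeasurableSet (Metric.ball (0 : E3) (2 * s)) := Metric.isOpen_ball.measurableSet
  have hfin : ∫⁻ p, ENNReal.ofReal (c / 4 * F p) < ⊤ := by
    refine (lintegral_mono_ae hpt).trans_lt ?_
    rw [lintegral_add_right _ (measurable_const.indicator hball), lintegral_indicator hball,
      setLIntegral_one]
    exact ENNReal.add_lt_top.mpr ⟨hfat.trans_lt ENNReal.ofReal_lt_top, measure_ball_lt_top⟩
  have h5 : Integrable fun p => c / 4 * F p := by
    refine ⟨(hFm.const_mul _).aestronglyMeasurable, ?_⟩
    rw [hasFiniteIntegral_iff_ofReal (Eventually.of_forall fun p => by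
      have := hF0 p
      simp only [Pi.zero_apply]; positivity)]
    exact hfin
  exact (integrable_const_mul_iff (IsUnit.mk0 _ (by positivity)) _).mp h5

/-- Convergence of the solutions of the Euler equation away from the degenerate set. -/
theorem euler_tendsto {A B w g a : ℕ → ℝ} {A₀ B₀ K : ℝ} (hA : Tendsto A atTop (𝓝 A₀))
    (hB : Tendsto B atTop (𝓝 B₀)) (hw : Tendsto w atTop (𝓝 0)) (hA0 : ∀ n, 0 < A n)
    (hw0 : ∀ n, 0 ≤ w n) (hg : ∀ n, 0 ≤ g n) (ha : ∀ n, a n ^ 2 = g n * (1 + g n))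
    (h : ∀ n, 2 * a n * (A n + w n * g n) = -((B n + w n * a n) * (2 * g n + 1)))
    (hBK : ∀ n, |B n| ≤ K) (hlt : |B₀| < A₀) :
    ∃ g₀ a₀, Tendsto g atTop (𝓝 g₀) ∧ Tendsto a atTop (𝓝 a₀) := by
  have hA₀ : 0 < A₀ := (abs_nonneg _).trans_lt hlt
  have hD : 0 < A₀ ^ 2 - B₀ ^ 2 := by
    have := sq_lt_sq' (by linarith [abs_nonneg B₀]) hlt
    rw [sq_abs] at this; linarith
  set D := A₀ ^ 2 - B₀ ^ 2
  have hgb : ∀ᶠ n in atTop, g n ≤ K ^ 2 / (2 * D) := by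
    have h1 : Tendsto (fun n => A n ^ 2 - B n ^ 2) atTop (𝓝 D) := (hA.pow 2).sub (hB.pow 2)
    filter_upwards [h1.eventually_const_lt (half_lt_self hD)] with n hn
    have h2 := euler_upper_bound (hA0 n) (hw0 n) (hg n) (ha n) (h n)
    have h3 : B n ^ 2 ≤ K ^ 2 := by
      rw [← sq_abs]; exact pow_le_pow_left₀ (abs_nonneg _) (hBK n) 2
    rw [le_div_iff₀ (by positivity)]
    nlinarith [hg n, mul_nonneg (hg n) (hg n), mul_nonneg (hg n) hD.le,
      mul_nonneg (mul_nonneg (hg n) (hg n)) hD.le,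
      mul_le_mul_of_nonneg_left hn.le (mul_nonneg (hg n) (by linarith [hg n] : 0 ≤ 1 + g n))]
  have hw' : Tendsto (fun n => w n * (4 * g n + 1)) atTop (𝓝 0) := by
    have h1 : Tendsto (fun n => w n * (4 * (K ^ 2 / (2 * D)) + 1)) atTop (𝓝 0) := by
      simpa using hw.mul_const (4 * (K ^ 2 / (2 * D)) + 1)
    refine squeeze_zero' (Eventually.of_forall fun n => ?_) ?_ h1
    · have := hw0 n
      have := hg n
      positivity
    · filter_upwards [hgb] with n hn
      exact mul_le_mul_of_nonneg_left (by linarith) (hw0 n)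
  have hden : Tendsto (fun n => 2 * A n + w n * (4 * g n + 1)) atTop (𝓝 (2 * A₀)) := by
    simpa using (hA.const_mul 2).add hw'
  -- Squaring the Euler identity and using `(2g + 1)² = 4g(1 + g) + 1` determines `g(1 + g)` as a
  -- quotient whose limiting denominator is `4(A₀² - B₀²) > 0`.
  have hX : Tendsto (fun n => g n * (1 + g n)) atTop (𝓝 (B₀ ^ 2 / ((2 * A₀) ^ 2 - 4 * B₀ ^ 2))) := by
    have hq : Tendsto (fun n => (2 * A n + w n * (4 * g n + 1)) ^ 2 - 4 * B n ^ 2) atTop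
        (𝓝 ((2 * A₀) ^ 2 - 4 * B₀ ^ 2)) := (hden.pow 2).sub ((hB.pow 2).const_mul 4)
    have hq0 : 0 < (2 * A₀) ^ 2 - 4 * B₀ ^ 2 := by
      have : (2 * A₀) ^ 2 - 4 * B₀ ^ 2 = 4 * D := by ring
      rw [this]; positivity
    refine ((hB.pow 2).div hq hq0.ne').congr' ?_
    filter_upwards [hq.eventually_const_lt hq0] with n hn
    simp only [Pi.div_apply]
    rw [div_eq_iff hn.ne']
    have h1 := congrArg (· ^ 2) (euler_identity (h n))
    simp only [mul_pow, neg_sq, ha n] at h1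
    linarith
  have hg' : Tendsto g atTop (𝓝 (√(B₀ ^ 2 / ((2 * A₀) ^ 2 - 4 * B₀ ^ 2) + 1 / 4) - 1 / 2)) := by
    refine ((hX.add_const (1 / 4)).sqrt.sub_const (1 / 2)).congr fun n => ?_
    rw [show g n * (1 + g n) + 1 / 4 = (g n + 1 / 2) ^ 2 by ring, Real.sqrt_sq (by linarith [hg n])]
    ring
  refine ⟨_, _, hg', ((hB.mul ((hg'.const_mul 2).add_const 1)).neg.div hden
    (by positivity)).congr fun n => ?_⟩
  have hpos : 0 < 2 * A n + w n * (4 * g n + 1) := by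
    have := hA0 n
    have := hw0 n
    have := hg n
    positivity
  simp only [Pi.div_apply]
  rw [div_eq_iff hpos.ne', euler_identity (h n)]

/-! ### Limits of the fields and of the pairs -/

section Limit

variable {k : E3 → ℝ} {M L C r δ K : ℝ} {ε : ℕ → ℝ} {γ α : ℕ → E3 → ℝ}

/-- A sequence that tends to zero in `L¹` has a subsequence that tends to zero almost
everywhere. -/
theorem exists_subseq_tendsto_zero {f : ℕ → E3 → ℝ} (hf : ∀ n, Integrable (f n))
    (h : Tendsto (fun n => ∫ p, |f n p|) atTop (𝓝 0)) :
    ∃ φ : ℕ → ℕ, StrictMono φ ∧ ∀ᵐ p, Tendsto (fun n => f (φ n) p) atTop (𝓝 0) := by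
  have h1 : Tendsto (fun n => eLpNorm (f n - fun _ => 0) 1 volume) atTop (𝓝 0) := by
    have e : ∀ n, eLpNorm (f n - fun _ => 0) 1 volume = ENNReal.ofReal (∫ p, |f n p|) := fun n => by
      rw [show (f n - fun _ => (0 : ℝ)) = f n by funext p; simp, eLpNorm_one_eq_lintegral_enorm,
        ← ofReal_integral_norm_eq_lintegral_enorm (hf n)]
      simp only [Real.norm_eq_abs]
    simp_rw [e]
    rw [← ENNReal.ofReal_zero]
    exact (ENNReal.continuous_ofReal.tendsto 0).comp h
  exact (tendstoInMeasure_of_tendsto_eLpNorm one_ne_zero (fun n => (hf n).1)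
    aestronglyMeasurable_const h1).exists_seq_tendsto_ae

theorem IsStationary.radial_fieldA {ε : ℝ} {γ α : E3 → ℝ} (hk : IsKernel k M L C)
    (h : IsStationary k r ε δ γ α) : IsRadial (fieldA k r γ α) := fun x y hxy => by
  unfold fieldA
  rw [hxy, hk.radial x y hxy, hk.conv_radial h.inv_left x y hxy]

theorem IsStationary.radial_fieldB {ε : ℝ} {γ α : E3 → ℝ} (hk : IsKernel k M L C)
    (h : IsStationary k r ε δ γ α) : IsRadial (fieldB k r γ α) := fun x y hxy => by
  unfold fieldB
  rw [hk.radial x y hxy, hk.conv_radial h.inv_right x y hxy]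

/-- Convergence of the fields along a sequence of stationary points. -/
structure FieldsConverge (k : E3 → ℝ) (r δ K : ℝ) (ε : ℕ → ℝ) (γ α : ℕ → E3 → ℝ)
    (A B : E3 → ℝ) : Prop where
  eps_pos : ∀ n, 0 < ε n
  eps_tendsto : Tendsto ε atTop (𝓝 0)
  stationary : ∀ n, IsStationary k r (ε n) δ (γ n) (α n)
  bound : ∀ n, IsUniformBound k r K (γ n) (α n)
  tendstoA : ∀ p, Tendsto (fun n => fieldA k r (γ n) (α n) p) atTop (𝓝 (A p))
  tendstoB : ∀ p, Tendsto (fun n => fieldB k r (γ n) (α n) p) atTop (𝓝 (B p))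
  tendsto_zero : ∀ᵐ p, Tendsto (fun n => ε n * γ n p) atTop (𝓝 0)

/-- Three extractions in turn: for `A - |p|²`, for `B`, and for `ε γ`, which tends to zero in `L¹`
because the masses are bounded by `r`. The last controls the regularization terms in the Euler
equations almost everywhere. -/
theorem IsKernel.exists_fieldsConverge (hk : IsKernel k M L C) (hr : 0 < r) (hδ : 0 < δ)
    (hε : ∀ n, 0 < ε n) (hε0 : Tendsto ε atTop (𝓝 0))
    (h : ∀ n, IsStationary k r (ε n) δ (γ n) (α n)) :
    ∃ K, 0 < K ∧ ∃ φ : ℕ → ℕ, StrictMono φ ∧ ∃ A B : E3 → ℝ,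
      FieldsConverge k r δ K (fun n => ε (φ n)) (fun n => γ (φ n)) (fun n => α (φ n)) A B := by
  obtain ⟨K, hK, hb⟩ := hk.exists_uniformBound hr hδ
  have hb' : ∀ n, IsUniformBound k r K (γ n) (α n) := fun n => hb _ _ _ (hε n) (h n)
  obtain ⟨φ, hφ, A, hA⟩ := exists_pointwise_subseq
    (f := fun n p => fieldA k r (γ n) (α n) p - ‖p‖ ^ 2)
    (fun n => (hb' n).abs_fieldA_le) (fun n => (hb' n).lipA)
  obtain ⟨ψ, hψ, B, hB⟩ := exists_pointwise_subseq
    (f := fun n => fieldB k r (γ (φ n)) (α (φ n)))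
    (fun n => (hb' _).abs_fieldB_le) (fun n => (hb' _).lipB)
  have hmass : Tendsto (fun n => ∫ p, |ε (φ (ψ n)) * γ (φ (ψ n)) p|) atTop (𝓝 0) := by
    have h1 : Tendsto (fun n => ε (φ (ψ n)) * r) atTop (𝓝 0) := by
      simpa using (hε0.comp (hφ.comp hψ).tendsto_atTop).mul_const r
    refine squeeze_zero (fun n => integral_nonneg fun p => abs_nonneg _) (fun n => ?_) h1
    simp_rw [abs_mul, abs_of_pos (hε _)]
    rw [integral_const_mul]
    exact mul_le_mul_of_nonneg_left (h _).integral_abs_left (hε _).le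
  obtain ⟨χ, hχ, hz⟩ := exists_subseq_tendsto_zero
    (fun n => (h (φ (ψ n))).pair.left.integrable.const_mul (ε (φ (ψ n)))) hmass
  refine ⟨K, hK, fun n => φ (ψ (χ n)), hφ.comp (hψ.comp hχ), fun p => A p + ‖p‖ ^ 2, B,
    fun n => hε _, hε0.comp (hφ.comp (hψ.comp hχ)).tendsto_atTop, fun n => h _, fun n => hb' _,
    fun p => ?_, fun p => (hB p).comp hχ.tendsto_atTop, hz⟩
  have := ((hA p).comp (hψ.comp hχ).tendsto_atTop).add_const (‖p‖ ^ 2)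
  refine this.congr fun n => ?_
  simp only [Function.comp]; ring

variable {A B : E3 → ℝ}

theorem FieldsConverge.continuousA (h : FieldsConverge k r δ K ε γ α A B) : Continuous A := by
  have h1 : Continuous fun p => A p - ‖p‖ ^ 2 :=
    continuous_of_abs_sub_le (K := K) (abs_sub_le_of_tendsto (fun n => (h.bound n).lipA)
      fun p => (h.tendstoA p).sub_const _)
  have h2 : Continuous fun p => (A p - ‖p‖ ^ 2) + ‖p‖ ^ 2 := h1.add (by fun_prop)
  simpa using h2

theorem FieldsConverge.continuousB (h : FieldsConverge k r δ K ε γ α A B) : Continuous B :=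
  continuous_of_abs_sub_le (K := K) (abs_sub_le_of_tendsto (fun n => (h.bound n).lipB) h.tendstoB)

/-- In `euler_field_le` the error `w(2γ + 1)` vanishes in the limit because `ε γ → 0` almost
everywhere. Full measure implies density, and continuity of the limit fields extends the inequality
to every point. -/
theorem FieldsConverge.abs_le (hk : IsKernel k M L C) (hδ : 0 < δ)
    (h : FieldsConverge k r δ K ε γ α A B) (p : E3) : |B p| ≤ A p := by
  have hae : ∀ᵐ p, |B p| ≤ A p := by
    filter_upwards [h.tendsto_zero, ae_all_iff.mpr fun n => (h.stationary n).pair.nonneg,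
      ae_all_iff.mpr fun n => (h.stationary n).sq_eq,
      ae_all_iff.mpr fun n => (h.stationary n).euler] with p h1 h2 h3 h4
    have hlim : Tendsto (fun n => fieldA k r (γ n) (α n) p
        + (4 * wt p ^ 2 * (ε n * γ n p) + 2 * wt p ^ 2 * ε n)) atTop (𝓝 (A p)) := by
      simpa using (h.tendstoA p).add
        ((h1.const_mul (4 * wt p ^ 2)).add (h.eps_tendsto.const_mul (2 * wt p ^ 2)))
    refine le_of_tendsto_of_tendsto' (h.tendstoB p).abs hlim fun n => ?_
    have hA : 0 < fieldA k r (γ n) (α n) p :=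
      lt_of_lt_of_le (by positivity) ((h.stationary n).le_fieldA hk p)
    have := euler_field_le hA (w := 2 * ε n * wt p ^ 2)
      (by have := h.eps_pos n; positivity) (h2 n) (h3 n) (h4 n)
    linarith
  have hd : Dense {p | |B p| ≤ A p} := Measure.dense_of_ae hae
  have hc : IsClosed {p | |B p| ≤ A p} := isClosed_le h.continuousB.abs h.continuousA
  have : p ∈ closure {p | |B p| ≤ A p} := hd p
  rwa [hc.closure_eq] at this

theorem FieldsConverge.radial (hk : IsKernel k M L C) (h : FieldsConverge k r δ K ε γ α A B) :
    IsRadial fun p => A p - |B p| := fun x y hxy => by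
  have hA : A x = A y := tendsto_nhds_unique (h.tendstoA x)
    ((h.tendstoA y).congr fun n => (h.stationary n).radial_fieldA hk y x hxy.symm)
  have hB : B x = B y := tendsto_nhds_unique (h.tendstoB x)
    ((h.tendstoB y).congr fun n => (h.stationary n).radial_fieldB hk y x hxy.symm)
  dsimp only
  rw [hA, hB]

/-- Near a sphere on which it vanishes, the gap `A - |B|` is at most quadratic. -/
theorem FieldsConverge.gap_le (hk : IsKernel k M L C) (hδ : 0 < δ)
    (h : FieldsConverge k r δ K ε γ α A B) {q : E3} (hq : q ≠ 0) (h0 : A q = |B q|) (p : E3) :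
    A p - |B p| ≤ 2 * K * (‖p‖ - ‖q‖) ^ 2 := by
  -- Fixing the sign of `B` at `q` replaces `|B|` by `σB`, which has bounded second differences. The
  -- function `A - σB` is nonnegative and vanishes at `q`, so its second difference there bounds it
  -- quadratically.
  obtain ⟨σ, hσ, hσB⟩ : ∃ σ : ℝ, |σ| = 1 ∧ σ * B q = |B q| := by
    rcases le_total 0 (B q) with hB | hB
    · exact ⟨1, by simp, by rw [abs_of_nonneg hB, one_mul]⟩
    · exact ⟨-1, by simp, by rw [abs_of_nonpos hB, neg_one_mul]⟩
  have hle : ∀ x, A x - |B x| ≤ A x - σ * B x := fun x => by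
    have := le_abs_self (σ * B x)
    rw [abs_mul, hσ, one_mul] at this
    linarith
  have hF0 : ∀ x, 0 ≤ A x - σ * B x := fun x =>
    (sub_nonneg.mpr (h.abs_le hk hδ x)).trans (hle x)
  have hsec : ∀ z, A (q + z) - σ * B (q + z) ≤ 2 * K * ‖z‖ ^ 2 := fun z => by
    have hA : |A (q + z) + A (q - z) - 2 * A q| ≤ K * ‖z‖ ^ 2 :=
      le_of_tendsto' (((h.tendstoA _).add (h.tendstoA _)).sub ((h.tendstoA _).const_mul 2)).abs
        fun n => (h.bound n).secondA q z
    have hB : |B (q + z) + B (q - z) - 2 * B q| ≤ K * ‖z‖ ^ 2 :=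
      le_of_tendsto' (((h.tendstoB _).add (h.tendstoB _)).sub ((h.tendstoB _).const_mul 2)).abs
        fun n => (h.bound n).secondB q z
    have hσB' : |σ * (B (q + z) + B (q - z) - 2 * B q)| ≤ K * ‖z‖ ^ 2 := by
      rwa [abs_mul, hσ, one_mul]
    have h1 := hF0 (q - z)
    have h2 := (le_abs_self _).trans hA
    have h3 := (neg_le_abs _).trans hσB'
    linarith
  have hq' : 0 < ‖q‖ := norm_pos_iff.mpr hq
  -- Moving along the ray through `q` reaches norm `‖p‖`; radiality of the gap does the rest.
  set z : E3 := (‖p‖ / ‖q‖ - 1) • q with hz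
  have e1 : q + z = (‖p‖ / ‖q‖) • q := by rw [hz, sub_smul, one_smul]; abel
  have e2 : ‖q + z‖ = ‖p‖ := by
    rw [e1, norm_smul, Real.norm_of_nonneg (by positivity)]
    field_simp
  have e3 : ‖z‖ ^ 2 = (‖p‖ - ‖q‖) ^ 2 := by
    rw [hz, norm_smul, mul_pow, Real.norm_eq_abs, sq_abs]
    field_simp
  have e4 : A p - |B p| = A (q + z) - |B (q + z)| := h.radial hk _ _ e2.symm
  rw [e4, ← e3]
  exact (hle _).trans (hsec z)

/-- The gap `A - |B|` is strictly positive away from the origin. -/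
theorem FieldsConverge.abs_lt (hk : IsKernel k M L C) (hδ : 0 < δ) (hK : 0 < K)
    (h : FieldsConverge k r δ K ε γ α A B) {q : E3} (hq : q ≠ 0) : |B q| < A q := by
  refine lt_of_le_of_ne (h.abs_le hk hδ q) fun h0 => ?_
  -- The constant comes from `δ/2 ≤ (A - |B|)(2t + 1)²` combined with `A - |B| ≤ 2K(‖p‖ - ‖q‖)²`.
  refine false_of_shell_bound (c := √(δ / (4 * K))) (by positivity) (norm_pos_iff.mpr hq)
    (fun n => (h.stationary n).pair.left.integrable) (fun n => (h.stationary n).pair.nonneg)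
    (fun n => (h.stationary n).pair.mass_le) ?_
  filter_upwards [ae_all_iff.mpr fun n => (h.stationary n).pair.nonneg,
    ae_all_iff.mpr fun n => (h.stationary n).sq_eq,
    ae_all_iff.mpr fun n => (h.stationary n).euler] with p h2 h3 h4 t ht htc
  by_contra hcon
  have hfreq : ∃ᶠ n in atTop, γ n p < t := by
    simpa only [not_eventually, not_le] using hcon
  have hgap0 : 0 ≤ A p - |B p| := sub_nonneg.mpr (h.abs_le hk hδ p)
  -- Before the limit the gap may be negative; its absolute value allows `2γ + 1` to be replaced by
  -- the larger `2t + 1` in the lower bound.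
  have hlim : Tendsto (fun n => abs (fieldA k r (γ n) (α n) p - abs (fieldB k r (γ n) (α n) p))
      * (2 * t + 1) ^ 2 + 2 * ε n * wt p ^ 2 * (2 * t + 1) ^ 3) atTop
      (𝓝 ((A p - |B p|) * (2 * t + 1) ^ 2)) := by
    have e1 := ((h.tendstoA p).sub (h.tendstoB p).abs).abs.mul_const ((2 * t + 1) ^ 2)
    have e2 := ((h.eps_tendsto.const_mul 2).mul_const (wt p ^ 2)).mul_const ((2 * t + 1) ^ 3)
    have := e1.add e2
    rwa [abs_of_nonneg hgap0, mul_zero, zero_mul, zero_mul, add_zero] at this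
  have hkey : δ / 2 ≤ (A p - |B p|) * (2 * t + 1) ^ 2 := by
    refine ge_of_tendsto_of_frequently hlim (hfreq.mono fun n hn => ?_)
    have hAd := (h.stationary n).le_fieldA hk p
    have hA : 0 < fieldA k r (γ n) (α n) p := lt_of_lt_of_le (by positivity) hAd
    have hw : 0 ≤ 2 * ε n * wt p ^ 2 := by
      have := h.eps_pos n
      positivity
    have h5 := euler_lower_bound hA hw (h2 n) (h3 n) (h4 n)
    have h6 : 0 ≤ 2 * γ n p + 1 := by linarith [h2 n]
    have h7 : 2 * γ n p + 1 ≤ 2 * t + 1 := by linarith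
    have h8 := pow_le_pow_left₀ h6 h7 2
    have h9 := pow_le_pow_left₀ h6 h7 3
    have h10 : (fieldA k r (γ n) (α n) p - |fieldB k r (γ n) (α n) p|) * (2 * γ n p + 1) ^ 2
        ≤ abs (fieldA k r (γ n) (α n) p - abs (fieldB k r (γ n) (α n) p)) * (2 * t + 1) ^ 2 :=
      mul_le_mul (le_abs_self _) h8 (by positivity) (abs_nonneg _)
    have h11 := mul_le_mul_of_nonneg_left h9 hw
    linarith [sq_nonneg ‖p‖]
  have h12 := h.gap_le hk hδ hq h0.symm p
  have h13 := mul_le_mul_of_nonneg_right h12 (sq_nonneg (2 * t + 1))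
  have h14 : δ / (4 * K) ≤ ((2 * t + 1) * |‖p‖ - ‖q‖|) ^ 2 := by
    rw [mul_pow, sq_abs, div_le_iff₀ (by positivity)]
    linarith
  have h15 := Real.sqrt_le_sqrt h14
  rw [Real.sqrt_sq (by positivity)] at h15
  linarith

/-- Pointwise convergence of the pairs. -/
theorem FieldsConverge.exists_limit (hk : IsKernel k M L C) (hδ : 0 < δ) (hK : 0 < K)
    (h : FieldsConverge k r δ K ε γ α A B) :
    ∃ g a : E3 → ℝ, (∀ᵐ p, Tendsto (fun n => γ n p) atTop (𝓝 (g p))) ∧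
      ∀ᵐ p, Tendsto (fun n => α n p) atTop (𝓝 (a p)) := by
  have hne : ∀ᵐ p : E3, p ≠ 0 := by simp [ae_iff]
  have hex : ∀ᵐ p, ∃ g a : ℝ, Tendsto (fun n => γ n p) atTop (𝓝 g) ∧
      Tendsto (fun n => α n p) atTop (𝓝 a) := by
    filter_upwards [hne, ae_all_iff.mpr fun n => (h.stationary n).pair.nonneg,
      ae_all_iff.mpr fun n => (h.stationary n).sq_eq,
      ae_all_iff.mpr fun n => (h.stationary n).euler] with p h1 h2 h3 h4
    refine euler_tendsto (h.tendstoA p) (h.tendstoB p) (w := fun n => 2 * ε n * wt p ^ 2) ?_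
      (fun n => lt_of_lt_of_le (by positivity) ((h.stationary n).le_fieldA hk p)) (fun n => ?_)
      h2 h3 h4 (fun n => (h.bound n).abs_fieldB_le p) (h.abs_lt hk hδ hK h1)
    · simpa using (h.eps_tendsto.const_mul 2).mul_const (wt p ^ 2)
    · have := h.eps_pos n
      positivity
  refine ⟨fun p => limUnder atTop fun n => γ n p, fun p => limUnder atTop fun n => α n p, ?_, ?_⟩
  · filter_upwards [hex] with p ⟨g, a, h1, _⟩ using tendsto_nhds_limUnder ⟨g, h1⟩
  · filter_upwards [hex] with p ⟨g, a, _, h2⟩ using tendsto_nhds_limUnder ⟨a, h2⟩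

/-- Away from the origin, the functions `γ` have a common integrable majorant. -/
theorem FieldsConverge.exists_majorant (hk : IsKernel k M L C) (hδ : 0 < δ) (hK : 0 < K)
    (h : FieldsConverge k r δ K ε γ α A B) {s : ℝ} (hs : 0 < s) :
    ∃ f : E3 → ℝ, Integrable f ∧ (∀ p, 0 ≤ f p) ∧
      ∀ᶠ n in atTop, ∀ᵐ p, s ≤ ‖p‖ → γ n p ≤ f p := by
  -- Beyond this radius `2|B| ≤ 2K ≤ |p|² ≤ A` and `A ≥ (1 + |p|²)/2`, so `euler_tail` supplies an
  -- integrable majorant.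
  set R := √(2 * K) + 1 with hR
  set S : Set E3 := Metric.closedBall 0 R ∩ {p | s ≤ ‖p‖} with hS
  have hSc : IsCompact S := (isCompact_closedBall (0 : E3) R).inter_right
    (isClosed_le continuous_const continuous_norm)
  obtain ⟨η, hη, hgap⟩ : ∃ η > 0, ∀ p ∈ S, η ≤ A p - |B p| := by
    rcases S.eq_empty_or_nonempty with hE | hne
    · exact ⟨1, one_pos, by simp [hE]⟩
    · obtain ⟨q, hq, hmin⟩ := hSc.exists_isMinOn hne
        (h.continuousA.sub h.continuousB.abs).continuousOn
      refine ⟨A q - |B q|, sub_pos.mpr (h.abs_lt hk hδ hK ?_), fun p hp => hmin hp⟩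
      exact norm_pos_iff.mp (hs.trans_le hq.2)
  have hunif : ∀ᶠ n in atTop, ∀ p ∈ S,
      η / 2 ≤ fieldA k r (γ n) (α n) p - |fieldB k r (γ n) (α n) p| := by
    have hA := eventually_abs_sub_le hK.le (fun n => (h.bound n).lipA)
      (fun p => (h.tendstoA p).sub_const (‖p‖ ^ 2)) hSc (show 0 < η / 4 by positivity)
    have hB := eventually_abs_sub_le hK.le (fun n => (h.bound n).lipB) h.tendstoB hSc
      (show 0 < η / 4 by positivity)
    filter_upwards [hA, hB] with n h1 h2 p hp
    have h3 := h1 p hp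
    have h4 := (abs_abs_sub_abs_le_abs_sub _ _).trans (h2 p hp)
    have h5 := hgap p hp
    rw [_root_.abs_le] at h3 h4
    linarith
  have hball : MeasurableSet (Metric.closedBall (0 : E3) R) :=
    Metric.isClosed_closedBall.measurableSet
  -- The constant solves `4γ · (η/2)δ ≤ K²`, where `(η/2)δ` bounds `A² - B² = (A - |B|)(A + |B|)`
  -- from below on the shell.
  have i1 : Integrable ((Metric.closedBall (0 : E3) R).indicator fun _ => K ^ 2 / (2 * η * δ)) :=
    (integrableOn_const measure_closedBall_lt_top.ne).integrable_indicator hball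
  have i2 : Integrable fun p : E3 => 4 * K ^ 2 * ((1 + ‖p‖ ^ 2)⁻¹) ^ 2 :=
    memLp_inv_one_add_sq.integrable_sq.const_mul _
  refine ⟨_, i1.add i2, fun p => ?_, ?_⟩
  · have : 0 ≤ (Metric.closedBall (0 : E3) R).indicator (fun _ => K ^ 2 / (2 * η * δ)) p :=
      Set.indicator_nonneg (fun _ _ => by positivity) _
    simp only [Pi.add_apply]; positivity
  filter_upwards [hunif] with n hn
  filter_upwards [(h.stationary n).pair.nonneg, (h.stationary n).sq_eq,
    (h.stationary n).euler] with p h2 h3 h4 hp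
  have hAd := (h.stationary n).le_fieldA hk p
  have hA : 0 < fieldA k r (γ n) (α n) p := lt_of_lt_of_le (by positivity) hAd
  have hw : 0 ≤ 2 * ε n * wt p ^ 2 := by
    have := h.eps_pos n
    positivity
  have hBK := (h.bound n).abs_fieldB_le p
  have hB2 : fieldB k r (γ n) (α n) p ^ 2 ≤ K ^ 2 := by
    rw [← sq_abs]; exact pow_le_pow_left₀ (abs_nonneg _) hBK 2
  simp only [Pi.add_apply]
  by_cases hpR : p ∈ Metric.closedBall (0 : E3) R
  · rw [Set.indicator_of_mem hpR]
    have h5 := hn p ⟨hpR, hp⟩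
    have h6 := euler_upper_bound hA hw h2 h3 h4
    have h7 : η / 2 * δ ≤ fieldA k r (γ n) (α n) p ^ 2 - fieldB k r (γ n) (α n) p ^ 2 := by
      have e : fieldA k r (γ n) (α n) p ^ 2 - fieldB k r (γ n) (α n) p ^ 2
          = (fieldA k r (γ n) (α n) p - |fieldB k r (γ n) (α n) p|)
            * (fieldA k r (γ n) (α n) p + |fieldB k r (γ n) (α n) p|) := by
        rw [← sq_abs (fieldB k r (γ n) (α n) p)]; ring
      rw [e]
      have := abs_nonneg (fieldB k r (γ n) (α n) p)
      exact mul_le_mul h5 (by linarith [sq_nonneg ‖p‖]) hδ.le (by linarith)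
    have h8 : 4 * (γ n p * (1 + γ n p)) * (η / 2 * δ) ≤ K ^ 2 :=
      (mul_le_mul_of_nonneg_left h7 (by positivity)).trans (h6.trans hB2)
    have h9 : γ n p ≤ K ^ 2 / (2 * η * δ) := by
      rw [le_div_iff₀ (by positivity)]
      have : 0 ≤ γ n p * γ n p * (η * δ) := by positivity
      linarith
    have : 0 ≤ 4 * K ^ 2 * ((1 + ‖p‖ ^ 2)⁻¹) ^ 2 := by positivity
    linarith
  · rw [Set.indicator_of_notMem hpR, zero_add]
    rw [mem_closedBall_zero_iff, not_le] at hpR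
    have h5 : 1 ≤ ‖p‖ := by linarith [Real.sqrt_nonneg (2 * K)]
    have h6 : 2 * K ≤ ‖p‖ ^ 2 := by
      rw [← Real.sqrt_le_left (norm_nonneg p)]
      linarith
    have h7 := (euler_tail hA hw h2 h3 h4 (by linarith)).1
    refine h7.trans ?_
    have h8 : (1 + ‖p‖ ^ 2) / 2 ≤ fieldA k r (γ n) (α n) p := by nlinarith
    calc fieldB k r (γ n) (α n) p ^ 2 / fieldA k r (γ n) (α n) p ^ 2
        ≤ K ^ 2 / ((1 + ‖p‖ ^ 2) / 2) ^ 2 :=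
          div_le_div₀ (by positivity) hB2 (by positivity)
            (pow_le_pow_left₀ (by positivity) h8 2)
      _ = 4 * K ^ 2 * ((1 + ‖p‖ ^ 2)⁻¹) ^ 2 := by field_simp; norm_num

end Limit

/-! ### Moving low momenta into the condensate -/

section Condensation

variable {k : E3 → ℝ} {M L C r K s : ℝ} {γ α f g : E3 → ℝ}

theorem integral_indicator_add_compl (hf : Integrable f) {S : Set E3} (hS : MeasurableSet S) :
    (∫ p, Sᶜ.indicator f p) + ∫ p, S.indicator f p = ∫ p, f p := by
  rw [← integral_add (hf.indicator hS.compl) (hf.indicator hS)]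
  congr 1; funext p
  by_cases hp : p ∈ S <;> simp [hp]

theorem integral_abs_indicator_le (hf : Integrable f) {S : Set E3} (hS : MeasurableSet S) :
    ∫ p, |S.indicator f p| ≤ ∫ p, |f p| := by
  refine integral_mono (hf.indicator hS).abs hf.abs fun p => ?_
  by_cases hp : p ∈ S <;> simp [hp]

/-- Near the origin the kernel acts like a constant. -/
theorem IsKernel.abs_pairing_sub_le (hk : IsKernel k M L C) (hf : Integrable f)
    (hg : Integrable g) (hs : ∀ p, s ≤ ‖p‖ → f p = 0) :
    |pairing k f g - (∫ p, f p) * ∫ p, k p * g p| ≤ L * s * (∫ p, |f p|) * ∫ p, |g p| := by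
  unfold pairing
  rw [← hk.conv_zero, ← integral_mul_const, ← integral_sub (hk.integrable_mul_conv hf hg)
    (hf.mul_const _)]
  have e : L * s * (∫ p, |f p|) * ∫ p, |g p| = ∫ p, L * s * (∫ q, |g q|) * |f p| := by
    rw [integral_const_mul]; ring
  rw [e]
  refine abs_integral_le_integral (hf.abs.const_mul _) fun p => ?_
  rw [← mul_sub, abs_mul]
  rcases le_or_gt s ‖p‖ with h | h
  · simp [hs p h]
  · have h1 := hk.abs_conv_sub_le hg p 0
    rw [sub_zero] at h1
    have h2 : L * ‖p‖ * (∫ q, |g q|) ≤ L * s * ∫ q, |g q| :=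
      mul_le_mul_of_nonneg_right (mul_le_mul_of_nonneg_left h.le hk.lip_nonneg)
        (integral_nonneg fun _ => abs_nonneg _)
    rw [mul_comm]
    exact mul_le_mul_of_nonneg_right (h1.trans h2) (abs_nonneg _)

theorem IsKernel.abs_integral_mul_sub_le (hk : IsKernel k M L C) (hf : Integrable f)
    (hs : ∀ p, s ≤ ‖p‖ → f p = 0) :
    |(∫ p, k p * f p) - k 0 * ∫ p, f p| ≤ L * s * ∫ p, |f p| := by
  rw [← integral_const_mul, ← integral_sub (hk.integrable_mul hf) (hf.const_mul _),
    ← integral_const_mul]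
  refine abs_integral_le_integral (hf.abs.const_mul _) fun p => ?_
  rw [← sub_mul, abs_mul]
  rcases le_or_gt s ‖p‖ with h | h
  · simp [hs p h]
  · have h1 := hk.lip p 0
    rw [sub_zero] at h1
    exact mul_le_mul_of_nonneg_right
      (h1.trans (mul_le_mul_of_nonneg_left h.le hk.lip_nonneg)) (abs_nonneg _)

theorem IsKernel.le_pairing_self (hk : IsKernel k M L C) (hf : Integrable f)
    (hs : ∀ p, s ≤ ‖p‖ → f p = 0) :
    k 0 * (∫ p, f p) ^ 2 - 2 * (L * s) * (∫ p, |f p|) ^ 2 ≤ pairing k f f := by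
  have h1 := (_root_.abs_le.mp (hk.abs_pairing_sub_le hf hf hs)).1
  have h2 : |(∫ p, f p) * ((∫ p, k p * f p) - k 0 * ∫ p, f p)|
      ≤ (∫ p, |f p|) * (L * s * ∫ p, |f p|) := by
    rw [abs_mul]
    exact mul_le_mul (abs_integral_le_integral hf.abs fun p => le_rfl)
      (hk.abs_integral_mul_sub_le hf hs) (abs_nonneg _) (integral_nonneg fun _ => abs_nonneg _)
  have h3 := (_root_.abs_le.mp h2).1
  linarith

theorem IsKernel.pairing_add_self (hk : IsKernel k M L C) (hf : Integrable f)
    (hg : Integrable g) : pairing k (fun p => f p + g p) (fun p => f p + g p)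
      = pairing k f f + 2 * pairing k f g + pairing k g g := by
  have := hk.pairing_add_smul hg hf 1
  simp only [one_mul, one_pow] at this
  rw [show (fun p => f p + g p) = fun p => g p + f p by funext p; ring, this]
  ring

/-- The energy of a pair, after optimization over the sign of `α` in the coupling with the
condensate. -/
def flippedEnergy (k : E3 → ℝ) (r : ℝ) (γ α : E3 → ℝ) : ℝ :=
  (∫ p, ‖p‖ ^ 2 * γ p) + (r - ∫ p, γ p) * ((∫ p, k p * γ p) - |∫ p, k p * α p|)
    + 1 / 2 * interaction k γ α

/-- Moving all particles with small momenta to the condensate does not increase the energy,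
up to a small error. -/
theorem IsKernel.flippedEnergy_le (hk : IsKernel k M L C) (h : IsPair γ α) (hα : Integrable α)
    (hm : ∫ p, γ p ≤ r) (hK : ∫ p, |α p| ≤ K) (hs : 0 ≤ s) :
    flippedEnergy k r ({p | s ≤ ‖p‖}.indicator γ) ({p | s ≤ ‖p‖}.indicator α)
      ≤ pairEnergy k r γ α + (L * s * (3 * r ^ 2 + 2 * K ^ 2 + r * K)
        + volume.real (Metric.ball (0 : E3) s) * (M * K + r * M)) := by
  set S : Set E3 := {p | s ≤ ‖p‖} with hSdef
  have hS : MeasurableSet S := measurableSet_le measurable_const measurable_norm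
  have hγ := h.integrable
  have hM := hk.bound_nonneg
  have hLs : 0 ≤ L * s := mul_nonneg hk.lip_nonneg hs
  have iγo := hγ.indicator hS
  have iγi := hγ.indicator hS.compl
  have iαo := hα.indicator hS
  have iαi := hα.indicator hS.compl
  have dec : ∀ f : E3 → ℝ, (fun p => Sᶜ.indicator f p + S.indicator f p) = f := fun f => by
    funext p; by_cases hp : p ∈ S <;> simp [hp]
  have sup : ∀ (f : E3 → ℝ) p, s ≤ ‖p‖ → Sᶜ.indicator f p = 0 := fun f p hp =>
    Set.indicator_of_notMem (by simpa [hSdef] using hp) f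
  have Qγ := hk.pairing_add_self iγi iγo
  have Qα := hk.pairing_add_self iαi iαo
  rw [dec] at Qγ Qα
  have mγ := integral_indicator_add_compl hγ hS
  have kγ := integral_indicator_add_compl (hk.integrable_mul hγ) hS
  have kα := integral_indicator_add_compl (hk.integrable_mul hα) hS
  have kin := integral_indicator_add_compl h.integrable_kin hS
  have ind_mul : ∀ (T : Set E3) (u f : E3 → ℝ),
      (∫ p, T.indicator (fun p => u p * f p) p) = ∫ p, u p * T.indicator f p := fun T u f => by
    congr 1; funext p; by_cases hp : p ∈ T <;> simp [hp]
  rw [ind_mul, ind_mul] at kγ kα kin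
  have n0 : ∀ T : Set E3, ∀ᵐ p, 0 ≤ T.indicator γ p := fun T => by
    filter_upwards [h.nonneg] with p hp
    by_cases hpT : p ∈ T <;> simp [hpT, hp]
  have ni : 0 ≤ ∫ p, Sᶜ.indicator γ p := integral_nonneg_of_ae (n0 _)
  have no : 0 ≤ ∫ p, S.indicator γ p := integral_nonneg_of_ae (n0 _)
  have ki : 0 ≤ ∫ p, ‖p‖ ^ 2 * Sᶜ.indicator γ p :=
    integral_nonneg_of_ae ((n0 _).mono fun p hp => mul_nonneg (sq_nonneg _) hp)
  have absγ : ∀ T : Set E3, ∫ p, |T.indicator γ p| = ∫ p, T.indicator γ p := fun T =>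
    integral_congr_ae ((n0 T).mono fun p hp => abs_of_nonneg hp)
  have bi : ∫ p, |Sᶜ.indicator α p| ≤ K := (integral_abs_indicator_le hα hS.compl).trans hK
  have bo : ∫ p, |S.indicator α p| ≤ K := (integral_abs_indicator_le hα hS).trans hK
  have b0 : 0 ≤ ∫ p, |Sᶜ.indicator α p| := integral_nonneg fun _ => abs_nonneg _
  have b1 : 0 ≤ ∫ p, |S.indicator α p| := integral_nonneg fun _ => abs_nonneg _
  have q1 := hk.le_pairing_self iγi (sup γ)
  have q2 := hk.le_pairing_self iαi (sup α)
  have q3 := (_root_.abs_le.mp (hk.abs_pairing_sub_le iγi iγo (sup γ))).1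
  have q4 := (_root_.abs_le.mp (hk.abs_pairing_sub_le iαi iαo (sup α))).1
  have q5 := (_root_.abs_le.mp (hk.abs_integral_mul_sub_le iγi (sup γ))).1
  have q6 := (_root_.abs_le.mp (hk.abs_integral_mul_sub_le iαi (sup α))).1
  rw [absγ] at q1 q5
  rw [absγ, absγ] at q3
  have hS0 : |∫ p, k p * S.indicator α p| ≤ M * K := by
    have h1 := hk.abs_conv_le iαo 0
    rw [hk.conv_zero] at h1
    exact h1.trans (mul_le_mul_of_nonneg_left bo hM)
  -- The low-momentum part of `α` acts on the rest like condensate, but cannot exceed the available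
  -- mass `c` by more than half the volume of the small ball.
  have ha : |∫ p, Sᶜ.indicator α p|
      ≤ (∫ p, Sᶜ.indicator γ p) + volume.real (Metric.ball (0 : E3) s) * (1 / 2) := by
    have hSc : Sᶜ = Metric.ball (0 : E3) s := by
      ext p; simp [hSdef]
    have i1 : Integrable (Sᶜ.indicator fun _ => (1 / 2 : ℝ)) := by
      rw [hSc]
      exact (integrableOn_const measure_ball_lt_top.ne).integrable_indicator
        Metric.isOpen_ball.measurableSet
    have h1 : |∫ p, Sᶜ.indicator α p| ≤ ∫ p, (Sᶜ.indicator γ p + Sᶜ.indicator (fun _ => 1 / 2) p) := by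
      rw [← Real.norm_eq_abs]
      refine norm_integral_le_of_norm_le (iγi.add i1) ?_
      filter_upwards [h.abs_le] with p hp
      by_cases hpS : p ∈ Sᶜ
      · simpa only [Set.indicator_of_mem hpS, Real.norm_eq_abs] using hp
      · simp [Set.indicator_of_notMem hpS]
    rw [integral_add iγi i1, integral_indicator (f := fun _ => (1 / 2 : ℝ)) hS.compl,
      setIntegral_const, smul_eq_mul] at h1
    rwa [hSc] at h1 ⊢
  have hk0 := hk.nonneg 0
  have hk0M := hk.le 0
  unfold flippedEnergy pairEnergy
  rw [hk.interaction_eq_pairing iγo iαo, hk.interaction_eq_pairing hγ hα, hk.integral_mul_add h,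
    Qγ, Qα, ← mγ, ← kγ, ← kα, ← kin]
  rw [← mγ] at hm
  set V := volume.real (Metric.ball (0 : E3) s)
  have hV : 0 ≤ V := measureReal_nonneg
  set c := ∫ p, Sᶜ.indicator γ p
  set m := ∫ p, S.indicator γ p
  set a := ∫ p, Sᶜ.indicator α p
  set ai := ∫ p, |Sᶜ.indicator α p|
  set ao := ∫ p, |S.indicator α p|
  set S0 := ∫ p, k p * S.indicator α p
  set x := r - (c + m) with hx
  have hx0 : 0 ≤ x := sub_nonneg.mpr hm
  have hr0 : 0 ≤ r := by linarith
  have hK0 : 0 ≤ K := b0.trans bi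
  have hxr : x ≤ r := by linarith
  have hcr : c ≤ r := by linarith
  have hmr : m ≤ r := by linarith
  have e1 : r - m = x + c := by rw [hx]; ring
  rw [e1]
  have t1 := mul_le_mul_of_nonneg_left q5 hx0
  have t2 := mul_le_mul_of_nonneg_left q6 hx0
  -- The high-momentum `α` sees the total source `a + x`; after the move the condensate is `x + c`,
  -- and with the best sign of `α` this does at least as well, up to the volume error.
  have t3 : -((c + V * (1 / 2) + x) * |S0|) ≤ (a + x) * S0 := by
    have h1 : |(a + x) * S0| ≤ (c + V * (1 / 2) + x) * |S0| := by
      rw [abs_mul]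
      refine mul_le_mul_of_nonneg_right ((abs_add_le _ _).trans ?_) (abs_nonneg _)
      rw [abs_of_nonneg hx0]; linarith
    exact (_root_.abs_le.mp h1).1
  have t4 : V * (1 / 2) * |S0| ≤ V * (1 / 2) * (M * K) :=
    mul_le_mul_of_nonneg_left hS0 (by positivity)
  have t5 : -(x * k 0 * (V * (1 / 2))) ≤ x * k 0 * (c + a) := by
    have : -(V * (1 / 2)) ≤ c + a := by linarith [(_root_.abs_le.mp ha).1]
    have := mul_le_mul_of_nonneg_left this (mul_nonneg hx0 hk0)
    linarith
  have t6 : x * k 0 * (V * (1 / 2)) ≤ r * M * (V * (1 / 2)) :=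
    mul_le_mul_of_nonneg_right (mul_le_mul hxr hk0M hk0 hr0) (by positivity)
  have t7 : 0 ≤ k 0 * c ^ 2 := by positivity
  have t8 : 0 ≤ k 0 * a ^ 2 := by positivity
  have u1 : L * s * (c * c + c * m + x * c) ≤ L * s * (3 * r ^ 2) := by
    refine mul_le_mul_of_nonneg_left ?_ hLs
    have := mul_le_mul hcr hcr ni hr0
    have := mul_le_mul hcr hmr no hr0
    have := mul_le_mul hxr hcr ni hr0
    linarith
  have u2 : L * s * (ai * ai + ai * ao + x * ai) ≤ L * s * (2 * K ^ 2 + r * K) := by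
    refine mul_le_mul_of_nonneg_left ?_ hLs
    have := mul_le_mul bi bi b0 hK0
    have := mul_le_mul bi bo b1 hK0
    have := mul_le_mul hxr bi b0 hr0
    linarith
  have u3 : 0 ≤ V * (M * K) := by positivity
  have u4 : 0 ≤ V * (r * M) := by positivity
  linarith

end Condensation

/-! ### Existence of a minimizing pair -/

section Existence

variable {k : E3 → ℝ} {M L C r : ℝ}

/-- Fatou's lemma for real-valued functions. -/
theorem integrable_and_integral_le_of_tendsto {f : ℕ → E3 → ℝ} {g : E3 → ℝ} {c : ℕ → ℝ} {c₀ : ℝ}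
    (hf : ∀ n, Integrable (f n)) (h0 : ∀ n, ∀ᵐ p, 0 ≤ f n p)
    (hg : ∀ᵐ p, Tendsto (fun n => f n p) atTop (𝓝 (g p))) (hc : ∀ n, ∫ p, f n p ≤ c n)
    (hc0 : Tendsto c atTop (𝓝 c₀)) : Integrable g ∧ ∫ p, g p ≤ c₀ := by
  have hm : AEStronglyMeasurable g volume :=
    aestronglyMeasurable_of_tendsto_ae atTop (fun n => (hf n).1) hg
  have hg0 : ∀ᵐ p, 0 ≤ g p := by
    filter_upwards [hg, ae_all_iff.mpr h0] with p h1 h2 using ge_of_tendsto' h1 h2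
  have hcn : 0 ≤ c₀ :=
    ge_of_tendsto' hc0 fun n => (integral_nonneg_of_ae (h0 n)).trans (hc n)
  have hle : ∫⁻ p, ENNReal.ofReal (g p) ≤ ENNReal.ofReal c₀ := by
    have h1 : ∫⁻ p, ENNReal.ofReal (g p) = ∫⁻ p, liminf (fun n => ENNReal.ofReal (f n p)) atTop := by
      refine lintegral_congr_ae ?_
      filter_upwards [hg] with p hp
      exact ((ENNReal.continuous_ofReal.tendsto _).comp hp).liminf_eq.symm
    rw [h1]
    refine (lintegral_liminf_le' fun n => (hf n).1.aemeasurable.ennreal_ofReal).trans ?_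
    rw [← ((ENNReal.continuous_ofReal.tendsto _).comp hc0).liminf_eq]
    refine liminf_le_liminf (Eventually.of_forall fun n => ?_)
    rw [← ofReal_integral_eq_lintegral_ofReal (hf n) (h0 n)]
    exact ENNReal.ofReal_le_ofReal (hc n)
  have hi : Integrable g :=
    ⟨hm, (hasFiniteIntegral_iff_ofReal hg0).mpr (hle.trans_lt ENNReal.ofReal_lt_top)⟩
  refine ⟨hi, ?_⟩
  rw [← ofReal_integral_eq_lintegral_ofReal hi hg0] at hle
  exact (ENNReal.ofReal_le_ofReal_iff hcn).mp hle

theorem IsKernel.interaction_nonneg (hk : IsKernel k M L C) {γ α : E3 → ℝ} (hγ : Integrable γ)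
    (hα : Integrable α) : 0 ≤ interaction k γ α := by
  rw [hk.interaction_eq_pairing hγ hα]
  exact add_nonneg (hk.pairing_self_nonneg hγ) (hk.pairing_self_nonneg hα)

/-- The energy of the limit of a sequence of pairs, after removal of the small momenta. -/
theorem IsKernel.flippedEnergy_limit_le (hk : IsKernel k M L C) {γ α : ℕ → E3 → ℝ}
    {g a f : E3 → ℝ} {K E s : ℝ} (hs : 0 ≤ s) (hp : ∀ n, IsPair (γ n) (α n))
    (hα : ∀ n, Integrable (α n)) (hm : ∀ n, ∫ p, γ n p ≤ r) (hK : ∀ n, ∫ p, |α n p| ≤ K)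
    (hE : ∀ n, pairEnergy k r (γ n) (α n) ≤ E) (hf : Integrable f) (hf0 : ∀ p, 0 ≤ f p)
    (hfle : ∀ n, ∀ᵐ p, s ≤ ‖p‖ → γ n p ≤ f p)
    (hg : ∀ᵐ p, Tendsto (fun n => γ n p) atTop (𝓝 (g p)))
    (ha : ∀ᵐ p, Tendsto (fun n => α n p) atTop (𝓝 (a p))) :
    flippedEnergy k r ({p | s ≤ ‖p‖}.indicator g) ({p | s ≤ ‖p‖}.indicator a)
      ≤ E + (L * s * (3 * r ^ 2 + 2 * K ^ 2 + r * K)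
        + volume.real (Metric.ball (0 : E3) s) * (M * K + r * M)) := by
  set err := L * s * (3 * r ^ 2 + 2 * K ^ 2 + r * K)
        + volume.real (Metric.ball (0 : E3) s) * (M * K + r * M)
  set S : Set E3 := {p | s ≤ ‖p‖} with hSdef
  have hS : MeasurableSet S := measurableSet_le measurable_const measurable_norm
  have hpS := fun n => (hp n).indicator_one hS
  have hlimS : ∀ {u : ℕ → E3 → ℝ} {v : E3 → ℝ}, (∀ᵐ p, Tendsto (fun n => u n p) atTop (𝓝 (v p))) →
      ∀ᵐ p, Tendsto (fun n => S.indicator (u n) p) atTop (𝓝 (S.indicator v p)) := fun h => by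
    filter_upwards [h] with p hp
    by_cases hpS : p ∈ S
    · simpa only [Set.indicator_of_mem hpS] using hp
    · simp only [Set.indicator_of_notMem hpS, tendsto_const_nhds]
  obtain ⟨-, -, -, -, t1, t2, t3, t4⟩ := hk.tendsto_of_dominated hf
    (fun n => (hpS n).integrable.1) (fun n => (hpS n).aesm) (fun n => (hpS n).nonneg)
    (fun n => (hpS n).sq_le) (fun n => by
      filter_upwards [hfle n] with p h1
      by_cases hpS : p ∈ S
      · rw [Set.indicator_of_mem hpS]; exact h1 hpS
      · rw [Set.indicator_of_notMem hpS]; exact hf0 p)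
    (hlimS hg) (hlimS ha)
  have hP := ((t1.const_sub r).mul (t2.sub t3.abs)).add (t4.const_mul (1 / 2))
  -- Only the kinetic energy lacks a common majorant. Fatou's lemma suffices, once the energy bound
  -- is rearranged into a bound on it by terms that converge.
  have hkin := integrable_and_integral_le_of_tendsto (fun n => (hpS n).integrable_kin)
    (fun n => (hpS n).nonneg.mono fun p h0 => mul_nonneg (sq_nonneg _) h0)
    ((hlimS hg).mono fun p h0 => h0.const_mul (‖p‖ ^ 2)) (fun n => ?_) (hP.const_sub (E + err))
  · have := hkin.2
    unfold flippedEnergy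
    linarith
  · have h1 := hk.flippedEnergy_le (hp n) (hα n) (hm n) (hK n) hs
    have h2 := hE n
    unfold flippedEnergy at h1
    linarith

theorem tendsto_volume_ball_zero :
    Tendsto (fun n : ℕ => volume.real (Metric.ball (0 : E3) (1 / ((n : ℝ) + 1)))) atTop (𝓝 0) := by
  have h : ∀ s : ℝ, 0 ≤ s → volume.real (Metric.ball (0 : E3) s)
      = s ^ 3 * volume.real (Metric.ball (0 : E3) 1) := fun s hs => by
    rw [measureReal_def, measureReal_def, Measure.addHaar_ball volume (0 : E3) hs,
      ENNReal.toReal_mul, ENNReal.toReal_ofReal (by positivity)]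
    simp
  have h1 : Tendsto (fun n : ℕ => 1 / ((n : ℝ) + 1)) atTop (𝓝 0) :=
    tendsto_one_div_add_atTop_nhds_zero_nat
  have h2 := (h1.pow 3).mul_const (volume.real (Metric.ball (0 : E3) 1))
  rw [zero_pow three_ne_zero, zero_mul] at h2
  exact h2.congr fun n => (h _ (by positivity)).symm

theorem pairEnergy_zero : pairEnergy k r (fun _ => 0) (fun _ => 0) = 0 := by
  simp [pairEnergy, interaction]

/-- Positive definiteness is available only for integrable functions, so the bound is obtained for
regular pairs and extended by density in energy. -/
theorem IsKernel.neg_le_pairEnergy (hk : IsKernel k M L C) {γ α : E3 → ℝ} (h : IsPair γ α)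
    (hm : ∫ p, γ p ≤ r) : -(r * (1 / 2 * ∫ p, k p)) ≤ pairEnergy k r γ α := by
  refine le_of_forall_pos_le_add fun η hη => ?_
  obtain ⟨g, a, h1, h2⟩ := hk.exists_regular_pair h hm hη
  have h3 := hk.le_regEnergy (ε := 0) le_rfl h1
  unfold regEnergy at h3
  linarith

/-- A pair attaining a strictly negative infimum of the energy. -/
theorem IsKernel.exists_pair_of_neg (hk : IsKernel k M L C) (hr : 0 < r) {I : ℝ} (hI : I < 0)
    (hinf : ∀ η > 0, ∃ γ α, IsPair γ α ∧ ∫ p, γ p ≤ r ∧ pairEnergy k r γ α < I + η) :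
    ∃ γ α, IsPair γ α ∧ ∫ p, γ p ≤ r ∧ pairEnergy k r γ α ≤ I := by
  obtain ⟨ε, γ₀, α₀, hε, hε0, hst, hE⟩ := hk.exists_stationary_sequence hr hI hinf
  have hδ : 0 < -I / 2 / r := div_pos (by linarith) hr
  obtain ⟨K, hK, φ, hφ, A, B, hF⟩ := hk.exists_fieldsConverge hr hδ hε hε0 hst
  set γ : ℕ → E3 → ℝ := fun n => γ₀ (φ n)
  set α : ℕ → E3 → ℝ := fun n => α₀ (φ n)
  have hE' : ∀ η > 0, ∀ᶠ n in atTop, pairEnergy k r (γ n) (α n) < I + η := fun η hη =>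
    hφ.tendsto_atTop.eventually (hE η hη)
  obtain ⟨g, a, hg, ha⟩ := hF.exists_limit hk hδ hK
  have hp : ∀ n, IsPair (γ n) (α n) := fun n => (hF.stationary n).pair.isPair
  have hαi : ∀ n, Integrable (α n) := fun n => (hF.stationary n).pair.right.integrable
  have hm : ∀ n, ∫ p, γ n p ≤ r := fun n => (hF.stationary n).pair.mass_le
  have hKn : ∀ n, ∫ p, |α n p| ≤ K := fun n => (hF.bound n).integral_abs_le
  obtain ⟨ig, mg⟩ := integrable_and_integral_le_of_tendsto (fun n => (hp n).integrable)
    (fun n => (hp n).nonneg) hg hm tendsto_const_nhds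
  -- The energies are bounded above and the condensate term below, the interaction being
  -- nonnegative; this bounds the kinetic energies uniformly.
  have ikin : Integrable fun p => ‖p‖ ^ 2 * g p := by
    obtain ⟨N, hN⟩ := eventually_atTop.mp (hE' 1 one_pos)
    refine (integrable_and_integral_le_of_tendsto (f := fun n p => ‖p‖ ^ 2 * γ (n + N) p)
      (c := fun _ => I + 1 + r * (1 / 2 * ∫ p, k p))
      (fun n => (hp _).integrable_kin)
      (fun n => (hp _).nonneg.mono fun p h0 => mul_nonneg (sq_nonneg _) h0)
      (hg.mono fun p h0 => ((tendsto_add_atTop_iff_nat N).mpr h0).const_mul _)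
      (fun n => ?_) tendsto_const_nhds).1
    have h1 := hN (n + N) (Nat.le_add_left _ _)
    have h2 := hk.interaction_nonneg (hp (n + N)).integrable (hαi (n + N))
    have h3 := hk.le_pairing_integral (hp (n + N))
    have h4 : 0 ≤ ∫ p, γ (n + N) p := integral_nonneg_of_ae (hp _).nonneg
    have h5 : 0 ≤ ∫ p, k p := integral_nonneg hk.nonneg
    have h6 := mul_le_mul_of_nonneg_left h3 (sub_nonneg.mpr (hm (n + N)))
    have h7 := mul_nonneg h4 h5
    unfold pairEnergy at h1
    linarith
  have hpair : IsPair g a := by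
    refine IsPair.mk_of_integrable ig ikin
      (aestronglyMeasurable_of_tendsto_ae atTop (fun n => (hp n).aesm) ha) ?_ ?_
    · filter_upwards [hg, ae_all_iff.mpr fun n => (hp n).nonneg] with p h1 h2
      exact ge_of_tendsto' h1 h2
    · filter_upwards [hg, ha, ae_all_iff.mpr fun n => (hp n).sq_le] with p h1 h2 h3
      exact le_of_tendsto_of_tendsto' (h2.pow 2) (h1.mul (h1.const_add 1)) h3
  have hflip : flippedEnergy k r g a ≤ I := by
    have hS : ∀ n : ℕ, MeasurableSet {p : E3 | 1 / ((n : ℝ) + 1) ≤ ‖p‖} := fun n =>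
      measurableSet_le measurable_const measurable_norm
    have hs0 : Tendsto (fun n : ℕ => 1 / ((n : ℝ) + 1)) atTop (𝓝 0) :=
      tendsto_one_div_add_atTop_nhds_zero_nat
    have hne : ∀ᵐ p : E3, p ≠ 0 := by simp [ae_iff]
    obtain ⟨t1, t2, t3, t4, t5⟩ := hk.tendsto_indicator hpair hS (by
      filter_upwards [hne] with p hp0
      exact hs0.eventually_le_const (norm_pos_iff.mpr hp0))
    have hlim : Tendsto (fun n : ℕ => flippedEnergy k r
        ({p : E3 | 1 / ((n : ℝ) + 1) ≤ ‖p‖}.indicator g)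
        ({p : E3 | 1 / ((n : ℝ) + 1) ≤ ‖p‖}.indicator a)) atTop (𝓝 (flippedEnergy k r g a)) := by
      unfold flippedEnergy
      exact (t1.add ((t2.const_sub r).mul (t3.sub t4.abs))).add (t5.const_mul _)
    have herr : Tendsto (fun n : ℕ => I + 1 / ((n : ℝ) + 1)
        + (L * (1 / ((n : ℝ) + 1)) * (3 * r ^ 2 + 2 * K ^ 2 + r * K)
        + volume.real (Metric.ball (0 : E3) (1 / ((n : ℝ) + 1))) * (M * K + r * M))) atTop (𝓝 I) := by
      simpa using (hs0.const_add I).add (((hs0.const_mul L).mul_const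
        (3 * r ^ 2 + 2 * K ^ 2 + r * K)).add (tendsto_volume_ball_zero.mul_const (M * K + r * M)))
    refine le_of_tendsto_of_tendsto' hlim herr fun n => ?_
    have hs : (0 : ℝ) < 1 / ((n : ℝ) + 1) := by positivity
    -- For each fixed cut-off there is a majorant valid from some index on; `n → ∞` is taken before
    -- the cut-off is removed.
    obtain ⟨f, hf, hf0, hfle⟩ := hF.exists_majorant hk hδ hK hs
    obtain ⟨N, hN⟩ := eventually_atTop.mp (hfle.and (hE' _ hs))
    exact hk.flippedEnergy_limit_le (γ := fun j => γ (j + N)) (α := fun j => α (j + N)) hs.le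
      (fun j => hp _) (fun j => hαi _) (fun j => hm _) (fun j => hKn _)
      (fun j => (hN (j + N) (Nat.le_add_left _ _)).2.le) hf hf0
      (fun j => (hN (j + N) (Nat.le_add_left _ _)).1)
      (hg.mono fun p h0 => (tendsto_add_atTop_iff_nat N).mpr h0)
      (ha.mono fun p h0 => (tendsto_add_atTop_iff_nat N).mpr h0)
  -- A global change of sign of `α` leaves the interaction unchanged and realizes the optimal sign
  -- in `flippedEnergy`.
  obtain ⟨σ, hσ, hσa⟩ : ∃ σ : ℝ, σ ^ 2 = 1 ∧ σ * ∫ p, k p * a p = -|∫ p, k p * a p| := by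
    rcases le_total 0 (∫ p, k p * a p) with h | h
    · exact ⟨-1, by norm_num, by rw [abs_of_nonneg h, neg_one_mul]⟩
    · exact ⟨1, by norm_num, by rw [abs_of_nonpos h, one_mul, neg_neg]⟩
  have hpσ : IsPair g (fun p => σ * a p) := by
    simpa using hpair.indicator MeasurableSet.univ hσ.le
  refine ⟨g, fun p => σ * a p, hpσ, mg, ?_⟩
  have e : ∫ p, k p * (σ * a p) = -|∫ p, k p * a p| := by
    rw [← hσa, ← integral_const_mul]
    congr 1; funext p; ring
  unfold pairEnergy
  rw [hk.integral_mul_add hpσ, e, interaction_const_mul_right hσ]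
  exact hflip

/-- Existence of minimizers for the energy of pairs with bounded mass. -/
theorem IsKernel.exists_minimizer (hk : IsKernel k M L C) (hr : 0 ≤ r) :
    ∃ γ α, IsPair γ α ∧ ∫ p, γ p ≤ r ∧
      ∀ g a, IsPair g a → ∫ p, g p ≤ r → pairEnergy k r γ α ≤ pairEnergy k r g a := by
  set S : Set ℝ := {x | ∃ g a, IsPair g a ∧ ∫ p, g p ≤ r ∧ pairEnergy k r g a = x} with hS
  have hzero : (0 : ℝ) ∈ S := ⟨_, _, isPair_zero, by simpa using hr, pairEnergy_zero⟩
  have hlow : ∀ x ∈ S, -(r * (1 / 2 * ∫ p, k p)) ≤ x := by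
    rintro x ⟨g, a, h1, h2, rfl⟩
    exact hk.neg_le_pairEnergy h1 h2
  have hbd : BddBelow S := ⟨_, hlow⟩
  have hI : ∀ g a, IsPair g a → ∫ p, g p ≤ r → sInf S ≤ pairEnergy k r g a :=
    fun g a h1 h2 => csInf_le hbd ⟨g, a, h1, h2, rfl⟩
  rcases le_or_gt 0 (sInf S) with h0 | h0
  · refine ⟨_, _, isPair_zero, by simpa using hr, fun g a h1 h2 => ?_⟩
    rw [pairEnergy_zero]
    exact h0.trans (hI g a h1 h2)
  · have hr' : 0 < r := by
      refine lt_of_le_of_ne hr fun hr0 => ?_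
      have := le_csInf ⟨_, hzero⟩ hlow
      rw [← hr0] at this
      linarith
    obtain ⟨γ, α, h1, h2, h3⟩ := hk.exists_pair_of_neg hr' h0 fun η hη => by
      obtain ⟨x, ⟨g, a, h1, h2, rfl⟩, h3⟩ := exists_lt_of_csInf_lt ⟨_, hzero⟩
        (lt_add_of_pos_right (sInf S) hη)
      exact ⟨g, a, h1, h2, h3⟩
    exact ⟨γ, α, h1, h2, fun g a h4 h5 => h3.trans (hI g a h4 h5)⟩

end Existence

/-! ### Positivity, symmetry and regularity of the Fourier transform -/

section Fourier

/-- The plane wave `e^{-i p·x}`. -/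
def planeWave (p x : E3) : ℂ := Complex.exp (-(Complex.I * ((inner ℝ p x : ℝ) : ℂ)))

theorem norm_planeWave (p x : E3) : ‖planeWave p x‖ = 1 := by
  rw [planeWave, Complex.norm_exp]; simp

theorem continuous_planeWave : Continuous fun z : E3 × E3 => planeWave z.1 z.2 := by
  unfold planeWave; fun_prop

theorem planeWave_sub (p q x : E3) :
    planeWave (p - q) x = planeWave p x * (starRingEnd ℂ) (planeWave q x) := by
  unfold planeWave
  rw [← Complex.exp_conj, ← Complex.exp_add]
  congr 1
  simp [inner_sub_left]
  ring

theorem integrable_planeWave_mul {u : E3 → ℂ} (hu : Integrable u) (p : E3) :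
    Integrable fun x => planeWave p x * u x :=
  hu.bdd_mul (c := 1) (continuous_planeWave.comp (by fun_prop :
    Continuous fun x : E3 => (p, x))).aestronglyMeasurable
    (Eventually.of_forall fun x => (norm_planeWave p x).le)

/-- Fubini's theorem for the Fourier kernel. -/
theorem integral_planeWave_swap {u v : E3 → ℂ} (hu : Integrable u) (hv : Integrable v) :
    ∫ p, u p * ∫ x, planeWave p x * v x = ∫ x, (∫ p, planeWave p x * u p) * v x := by
  have hi : Integrable (fun z : E3 × E3 => planeWave z.1 z.2 * (u z.1 * v z.2))
      (volume.prod volume) :=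
    (hu.mul_prod hv).bdd_mul (c := 1) continuous_planeWave.aestronglyMeasurable
      (Eventually.of_forall fun z => (norm_planeWave _ _).le)
  simp_rw [← integral_const_mul, ← integral_mul_const]
  calc ∫ p, ∫ x, u p * (planeWave p x * v x)
      = ∫ p, ∫ x, planeWave p x * (u p * v x) := by
        congr 1; funext p; congr 1; funext x; ring
    _ = ∫ x, ∫ p, planeWave p x * (u p * v x) := integral_integral_swap hi
    _ = _ := by congr 1; funext x; congr 1; funext p; ring

theorem integrable_planeWave_mul' {u : E3 → ℂ} (hu : Integrable u) (x : E3) :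
    Integrable fun p => planeWave p x * u p :=
  hu.bdd_mul (c := 1) (continuous_planeWave.comp (by fun_prop :
    Continuous fun p : E3 => (p, x))).aestronglyMeasurable
    (Eventually.of_forall fun p => (norm_planeWave p x).le)

/-- Fubini applied twice turns convolution by the Fourier transform into multiplication by `V`; with
`V ≥ 0` this is the source of positive definiteness. -/
theorem fourierC_pairing {V f : E3 → ℝ} (hV : Integrable V) (hf : Integrable f) :
    ∫ p, (f p : ℂ) * ∫ q, fourierC V (p - q) * (f q : ℂ)
      = ∫ x, ((V x * ‖∫ p, planeWave p x * (f p : ℂ)‖ ^ 2 : ℝ) : ℂ) := by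
  set F : E3 → ℂ := fun x => ∫ p, planeWave p x * (f p : ℂ) with hF
  have hfc : Integrable fun p => (f p : ℂ) := hf.ofReal
  have hVc : Integrable fun x => (V x : ℂ) := hV.ofReal
  have hFc : Continuous F := by
    refine continuous_of_dominated (bound := fun p => ‖(f p : ℂ)‖)
      (fun x => (integrable_planeWave_mul' hfc x).1) (fun x => Eventually.of_forall fun p => ?_)
      hfc.norm (Eventually.of_forall fun p => ?_)
    · rw [norm_mul, norm_planeWave, one_mul]
    · exact (continuous_planeWave.comp (by fun_prop :
        Continuous fun x : E3 => (p, x))).mul continuous_const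
  have hFb : ∀ x, ‖(starRingEnd ℂ) (F x)‖ ≤ ∫ p, ‖(f p : ℂ)‖ := fun x => by
    rw [RCLike.norm_conj]
    refine norm_integral_le_of_norm_le hfc.norm (Eventually.of_forall fun p => ?_)
    rw [norm_mul, norm_planeWave, one_mul]
  have hw : Integrable fun x => (starRingEnd ℂ) (F x) * (V x : ℂ) :=
    hVc.bdd_mul (Complex.continuous_conj.comp hFc).aestronglyMeasurable
      (Eventually.of_forall hFb)
  have inner_eq : ∀ p, ∫ q, fourierC V (p - q) * (f q : ℂ)
      = ∫ x, planeWave p x * ((starRingEnd ℂ) (F x) * (V x : ℂ)) := fun p => by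
    have hv : Integrable fun x => (starRingEnd ℂ) (planeWave p x * (V x : ℂ)) :=
      (Complex.conjCLE : ℂ →L[ℝ] ℂ).integrable_comp (integrable_planeWave_mul hVc p)
    have h1 := congrArg (starRingEnd ℂ) (integral_planeWave_swap hfc hv)
    rw [← integral_conj, ← integral_conj] at h1
    calc ∫ q, fourierC V (p - q) * (f q : ℂ)
        = ∫ q, (starRingEnd ℂ) ((f q : ℂ) * ∫ x, planeWave q x
            * (starRingEnd ℂ) (planeWave p x * (V x : ℂ))) := by
          congr 1; funext q
          rw [map_mul, ← integral_conj, Complex.conj_ofReal, mul_comm]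
          congr 1
          change ∫ x, planeWave (p - q) x * (V x : ℂ) = _
          congr 1; funext x
          rw [planeWave_sub, map_mul, Complex.conj_conj]; ring
      _ = _ := by
          rw [h1]
          congr 1; funext x
          rw [map_mul, Complex.conj_conj]
          ring
  simp_rw [inner_eq]
  rw [integral_planeWave_swap hfc hw]
  congr 1; funext x
  have : F x * (starRingEnd ℂ) (F x) = ((‖F x‖ ^ 2 : ℝ) : ℂ) := by
    rw [Complex.mul_conj, Complex.normSq_eq_norm_sq]
  change F x * ((starRingEnd ℂ) (F x) * (V x : ℂ)) = _
  rw [← mul_assoc, this, Complex.ofReal_mul, mul_comm]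

theorem fourier_posdef {V f : E3 → ℝ} (hV : Integrable V) (hr : IsRadial V) (h0 : ∀ x, 0 ≤ V x)
    (hf : Integrable f) : 0 ≤ ∫ p, f p * ∫ q, fourier V (p - q) * f q := by
  have h := fourierC_pairing hV hf
  simp_rw [← ofReal_fourier hr] at h
  have h1 : ((∫ p, f p * ∫ q, fourier V (p - q) * f q : ℝ) : ℂ)
      = ((∫ x, V x * ‖∫ p, planeWave p x * (f p : ℂ)‖ ^ 2 : ℝ) : ℂ) := by
    rw [← integral_complex_ofReal, ← integral_complex_ofReal, ← h]
    congr 1; funext p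
    rw [Complex.ofReal_mul, ← integral_complex_ofReal]
    simp only [Complex.ofReal_mul]
  rw [Complex.ofReal_inj.mp h1]
  exact integral_nonneg fun x => mul_nonneg (h0 x) (sq_nonneg _)

theorem fourier_radial {V : E3 → ℝ} (hr : IsRadial V) : IsRadial (fourier V) := by
  intro p q hpq
  obtain ⟨R, hR⟩ : ∃ R : E3 ≃ₗᵢ[ℝ] E3, R p = q := ⟨_, Submodule.reflection_sub hpq⟩
  unfold fourier fourierC
  congr 1
  rw [← hR, ← R.measurePreserving.integral_comp R.toHomeomorph.measurableEmbedding
    fun x => Complex.exp (-(Complex.I * ((inner ℝ (R p) x : ℝ) : ℂ))) * (V x : ℂ)]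
  congr 1; funext x
  rw [R.inner_map_map, hr (R x) x (R.norm_map x)]

theorem abs_sub_le_of_iteratedFDeriv {f : E3 → ℝ} (hf : ContDiff ℝ 3 f) {c : ℝ}
    (hc : ∀ p, ‖iteratedFDeriv ℝ 1 f p‖ ≤ c) (x y : E3) : |f x - f y| ≤ c * ‖x - y‖ :=
  Convex.norm_image_sub_le_of_norm_fderiv_le (𝕜 := ℝ) (s := Set.univ)
    (fun p _ => (hf.differentiable (by norm_num)) p)
    (fun p _ => by rw [← norm_iteratedFDeriv_one]; exact hc p) convex_univ trivial trivial

theorem second_difference_le {f : E3 → ℝ} (hf : ContDiff ℝ 3 f) {c : ℝ}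
    (hc : ∀ p, ‖iteratedFDeriv ℝ 2 f p‖ ≤ c) (x h : E3) :
    |f (x + h) + f (x - h) - 2 * f x| ≤ 2 * c * ‖h‖ ^ 2 := by
  have hd : Differentiable ℝ f := hf.differentiable (by norm_num)
  have hd2 : Differentiable ℝ (fderiv ℝ f) :=
    (hf.fderiv_right (m := 2) (by norm_num)).differentiable (by norm_num)
  have hlip : ∀ a b, ‖fderiv ℝ f a - fderiv ℝ f b‖ ≤ c * ‖a - b‖ := fun a b =>
    Convex.norm_image_sub_le_of_norm_fderiv_le (𝕜 := ℝ) (s := Set.univ) (fun p _ => hd2 p)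
      (fun p _ => by
        rw [← norm_iteratedFDeriv_one, norm_iteratedFDeriv_fderiv]; exact hc p)
      convex_univ trivial trivial
  have hc0 : 0 ≤ c := (norm_nonneg _).trans (hc 0)
  -- The second difference is the increment over `[0, 1]` of `t ↦ f(x + th) + f(x - th)`, whose
  -- derivative compares the gradients of `f` at points at distance `2t‖h‖`.
  have key := norm_image_sub_le_of_norm_deriv_le_segment_01'
    (f := fun t : ℝ => f (x + t • h) + f (x - t • h))
    (f' := fun t : ℝ => fderiv ℝ f (x + t • h) h + fderiv ℝ f (x - t • h) (-h))
    (C := 2 * c * ‖h‖ ^ 2) (fun t _ => HasDerivAt.hasDerivWithinAt ?_) fun t ht => ?_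
  · simp only [one_smul, zero_smul, add_zero, sub_zero, Real.norm_eq_abs] at key
    rwa [← two_mul] at key
  · have e1 : HasDerivAt (fun t : ℝ => x + t • h) h t := by
      simpa using ((hasDerivAt_id t).smul_const h).const_add x
    have e2 : HasDerivAt (fun t : ℝ => x - t • h) (-h) t := by
      simpa using ((hasDerivAt_id t).smul_const h).const_sub x
    exact ((hd _).hasFDerivAt.comp_hasDerivAt t e1).add ((hd _).hasFDerivAt.comp_hasDerivAt t e2)
  · rw [map_neg, ← sub_eq_add_neg, ← sub_apply]
    refine (ContinuousLinearMap.le_opNorm _ _).trans ?_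
    have h1 := hlip (x + t • h) (x - t • h)
    have h2 : ‖x + t • h - (x - t • h)‖ ≤ 2 * ‖h‖ := by
      rw [show x + t • h - (x - t • h) = (2 * t) • h by rw [mul_smul, two_smul]; abel, norm_smul,
        Real.norm_of_nonneg (by linarith [ht.1])]
      exact mul_le_mul_of_nonneg_right (by linarith [ht.2]) (norm_nonneg _)
    have h3 := h1.trans (mul_le_mul_of_nonneg_left h2 hc0)
    calc _ ≤ c * (2 * ‖h‖) * ‖h‖ := mul_le_mul_of_nonneg_right h3 (norm_nonneg _)
      _ = _ := by ring

theorem IsKernel.const_mul {k : E3 → ℝ} {M L C : ℝ} (hk : IsKernel k M L C) {c : ℝ}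
    (hc : 0 ≤ c) : IsKernel (fun p => c * k p) (c * M) (c * L) (c * C) where
  continuous := hk.continuous.const_mul c
  nonneg p := mul_nonneg hc (hk.nonneg p)
  integrable := hk.integrable.const_mul c
  le p := mul_le_mul_of_nonneg_left (hk.le p) hc
  radial x y hxy := by dsimp only; rw [hk.radial x y hxy]
  posdef f hf := by
    have e0 : ∀ p, ∫ q, c * k (p - q) * f q = c * ∫ q, k (p - q) * f q := fun p => by
      rw [← integral_const_mul]; congr 1; funext q; ring
    have e : ∫ p, f p * ∫ q, c * k (p - q) * f q = c * ∫ p, f p * ∫ q, k (p - q) * f q := by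
      simp_rw [e0]
      rw [← integral_const_mul]
      congr 1; funext p; ring
    rw [e]
    exact mul_nonneg hc (hk.posdef f hf)
  lip x y := by
    rw [← mul_sub, abs_mul, abs_of_nonneg hc, mul_assoc]
    exact mul_le_mul_of_nonneg_left (hk.lip x y) hc
  second x h := by
    rw [show c * k (x + h) + c * k (x - h) - 2 * (c * k x)
      = c * (k (x + h) + k (x - h) - 2 * k x) by ring, abs_mul, abs_of_nonneg hc, mul_assoc]
    exact mul_le_mul_of_nonneg_left (hk.second x h) hc

theorem IsInteractionPotential.exists_isKernel {V : E3 → ℝ} (hV : IsInteractionPotential V)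
    (hC3 : ContDiff ℝ 3 (fourier V))
    (hbdd : ∀ j : ℕ, j ≤ 3 → ∃ C : ℝ, ∀ p : E3, ‖iteratedFDeriv ℝ j (fourier V) p‖ ≤ C) :
    ∃ M L C, IsKernel (fourier V) M L C := by
  obtain ⟨c0, h0⟩ := hbdd 0 (by norm_num)
  obtain ⟨c1, h1⟩ := hbdd 1 (by norm_num)
  obtain ⟨c2, h2⟩ := hbdd 2 (by norm_num)
  exact ⟨c0, c1, 2 * c2, hC3.continuous, hV.fourier_nonneg, hV.fourier_integrable,
    fun p => (le_abs_self _).trans (by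
      have := h0 p
      rwa [norm_iteratedFDeriv_zero, Real.norm_eq_abs] at this),
    fourier_radial hV.radial, fun f hf => fourier_posdef hV.integrable hV.radial hV.nonneg hf,
    abs_sub_le_of_iteratedFDeriv hC3 h1, second_difference_le hC3 h2⟩

end Fourier

/-! ### Reduction of the canonical problem to pairs -/

section Canonical

theorem mem_domain_iff (u : (E3 → ℝ) × (E3 → ℝ) × ℝ) :
    u ∈ domain ↔ IsPair u.1 u.2.1 ∧ 0 ≤ u.2.2 :=
  ⟨fun ⟨h1, h2, h3, h4, h5⟩ => ⟨⟨h1, h2, h3, h4⟩, h5⟩,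
    fun ⟨⟨h1, h2, h3, h4⟩, h5⟩ => ⟨h1, h2, h3, h4, h5⟩⟩

/-- The canonical free energy at zero temperature in terms of the energy of pairs. -/
theorem canonicalFreeEnergy_eq (V : E3 → ℝ) {ρ : ℝ} {u : (E3 → ℝ) × (E3 → ℝ) × ℝ}
    (hu : u.2.2 + rhoGamma u.1 = ρ) :
    canonicalFreeEnergy V 0 u = fourier V 0 / 2 * ρ ^ 2 + ((2 * Real.pi) ^ 3)⁻¹
      * pairEnergy (fun p => ((2 * Real.pi) ^ 3)⁻¹ * fourier V p) ((2 * Real.pi) ^ 3 * ρ)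
        u.1 u.2.1 := by
  have hpi : ((2 * Real.pi) ^ 3 : ℝ) ≠ 0 := by positivity
  have e1 : ∫ p, ((2 * Real.pi) ^ 3)⁻¹ * fourier V p * (u.1 p + u.2.1 p)
      = ((2 * Real.pi) ^ 3)⁻¹ * ∫ p, fourier V p * (u.1 p + u.2.1 p) := by
    rw [← integral_const_mul]; congr 1; funext p; ring
  have e2 : interaction (fun p => ((2 * Real.pi) ^ 3)⁻¹ * fourier V p) u.1 u.2.1
      = ((2 * Real.pi) ^ 3)⁻¹ * interaction (fourier V) u.1 u.2.1 := by
    unfold interaction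
    rw [← integral_const_mul]; congr 1; funext p
    rw [← integral_const_mul]; congr 1; funext q; ring
  have e3 : u.2.2 = ((2 * Real.pi) ^ 3)⁻¹ * ((2 * Real.pi) ^ 3 * ρ - ∫ p, u.1 p) := by
    rw [mul_sub, inv_mul_cancel_left₀ hpi, ← hu, rhoGamma]; ring
  have e4 : ((2 * Real.pi) ^ 6 : ℝ)⁻¹ = ((2 * Real.pi) ^ 3)⁻¹ * ((2 * Real.pi) ^ 3)⁻¹ := by
    rw [← mul_inv, ← pow_add]
  unfold canonicalFreeEnergy pairEnergy
  dsimp only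
  rw [hu, e1, e2, e4]
  conv_lhs => rw [e3]
  unfold interaction
  ring

end Canonical

end Bogoliubov

end

theorem theorem2p4 (V : Bogoliubov.E3 → ℝ) (hV : Bogoliubov.IsInteractionPotential V)
    (hC3 : ContDiff ℝ 3 (Bogoliubov.fourier V))
    (hbdd : ∀ k : ℕ, k ≤ 3 → ∃ C : ℝ, ∀ p : Bogoliubov.E3,
      ‖iteratedFDeriv ℝ k (Bogoliubov.fourier V) p‖ ≤ C)
    (ρ : ℝ) (hρ : 0 ≤ ρ) :
    ∃ u ∈ Bogoliubov.canonicalDomain ρ,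
      IsMinOn (Bogoliubov.canonicalFreeEnergy V 0) (Bogoliubov.canonicalDomain ρ) u := by
  obtain ⟨M, L, C, hk⟩ := hV.exists_isKernel hC3 hbdd
  have hpi : (0 : ℝ) < (2 * Real.pi) ^ 3 := by positivity
  obtain ⟨γ, α, hp, hm, hmin⟩ := (hk.const_mul (inv_nonneg.mpr hpi.le)).exists_minimizer
    (mul_nonneg hpi.le hρ)
  have hle : ∀ {g : Bogoliubov.E3 → ℝ}, ∫ p, g p ≤ (2 * Real.pi) ^ 3 * ρ ↔
      Bogoliubov.rhoGamma g ≤ ρ := fun {g} => (inv_mul_le_iff₀ hpi).symm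
  -- The density not carried by `γ` is placed in the condensate, and the mass bound is exactly its
  -- nonnegativity.
  have hmem : (γ, α, ρ - Bogoliubov.rhoGamma γ) ∈ Bogoliubov.canonicalDomain ρ :=
    ⟨(Bogoliubov.mem_domain_iff _).mpr ⟨hp, sub_nonneg.mpr (hle.mp hm)⟩, sub_add_cancel _ _⟩
  refine ⟨_, hmem, fun u hu => ?_⟩
  obtain ⟨hu1, hu2⟩ := (Bogoliubov.mem_domain_iff u).mp hu.1
  rw [Set.mem_ofPred_eq, Bogoliubov.canonicalFreeEnergy_eq V hmem.2,
    Bogoliubov.canonicalFreeEnergy_eq V hu.2]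
  have := hmin u.1 u.2.1 hu1 (hle.mpr (by linarith [hu.2]))
  have := mul_le_mul_of_nonneg_left this (inv_nonneg.mpr hpi.le)
  linarith
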